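/- Fix a finite relational schema $\mathbf S$ and an infinite domain of values (say $\mathbb N$). A database is a finite set of facts over $\mathbf S$; a Boolean query $q$ is an arbitrary map from databases to $\{0,1\}$. $\mathrm{Shapley}(q)$ is the problem: given disjoint databases $D_{\mathrm n}$ (endogenous facts), $D_{\mathrm x}$ (exogenous facts) and $f\in D_{\mathrm n}$, compute the Shapley value of the player $f$ in the game with players $D_{\mathrm n}$ and wealth function $E\mapsto q(E\cup D_{\mathrm x})-q(D_{\mathrm x})$, that is, $$\frac1{|D_{\mathrm n}|!}\sum_{\pi}\bigl[q(D_{\mathrm x}\cup\pi_f\cup\{f\})-q(D_{\mathrm x}\cup\pi_f)\bigr],$$ where $\pi$ ranges over the permutations of $D_{\mathrm n}$ and $\pi_f$ is the set of facts before $f$ in $\pi$. $\mathrm{PQE}(q)$ is the problem: given a tuple-independent database, i.e. a database $D$ with a rational probability $\pi(f)\in[0,1]$ for every $f\in D$, compute $$\sum_{D'\subseteq D}\;\prod_{f\in D'}\pi(f)\prod_{f\in D\setminus D'}(1-\pi(f))\;q(D').$$ The query is fixed (data complexity); integers are written in binary, and rationals as numerator and denominator. A Boolean union of conjunctive queries (UCQ)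 is called safe (in the sense of Dalvi and Suciu) if the rules of lifted inference reduce it to single facts: independent conjunction, independent disjunction, independent project on a separator variable, and inclusion–exclusion in which the terms whose coefficient (Möbius value) cancels after collecting logically equivalent ones are dropped. The rules are applied up to logical equivalence, to positive existential formulas with comparisons $=,<$ (which express the splitting of relations by ranking and shattering), their free variables being parameters; two queries are independent if no fact is relevant to both, and $x$ is a separator of $\varphi$ if $\varphi$ holds only for values of $x$ that occur in the database and distinct values of $x$ give independent queries. **Theorem.** 1. For every Boolean query $q$, the problem $\mathrm{Shapley}(q)$ reduces in polynomial time (polynomial-time Turing reduction) to $\mathrm{PQE}(q)$. 2. For every safe Boolean UCQ $q$, the problem $\mathrm{Shapley}(q)$ is in $\mathrm{FP}$, i.e. computable in polynomial time. -/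

import Mathlib

/-! ### Databases, queries, Shapley values, tuple-independent databases -/

/-- A database schema: finitely many relation symbols, each with a number of attributes. -/
structure Schema where
  numRel : ℕ
  arity : Fin numRel → ℕ

/-- A fact `R(c₁,…,c_k)`. The fixed infinite domain of values is `ℕ`. -/
abbrev DBFact (S : Schema) : Type := (R : Fin S.numRel) × (Fin (S.arity R) → ℕ)

/-- A Boolean query over `S`: an arbitrary map from databases (finite sets of facts) to truth
values. -/
abbrev BoolQuery (S : Schema) : Type := Finset (DBFact S) → Prop

open Classical in
/-- The query viewed as a numerical query, with values `0` and `1`. -/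
noncomputable def BoolQuery.val {S : Schema} (q : BoolQuery S) (D : Finset (DBFact S)) : ℚ :=
  if q D then 1 else 0

/-- The set of players that come before `a` in the permutation `π` of the players in `L`
(`π` gives the position of each player). -/
def playersBefore {α : Type*} {L : Finset α} (π : L ≃ Fin L.card) (a : L) : Finset α :=
  (Finset.univ.filter fun b : L => π b < π a).map (Function.Embedding.subtype _)

/-- The Shapley value of the player `a` in the cooperative game `G` with set of players `L`. -/
def shapleyValue {α : Type*} [DecidableEq α] (L : Finset α) (G : Finset α → ℚ) (a : L) : ℚ :=
  1 / (L.card.factorial : ℚ) *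
    ∑ π : L ≃ Fin L.card, (G (insert (a : α) (playersBefore π a)) - G (playersBefore π a))

/-- The Shapley value of the endogenous fact `f` for `q` in the database `Dn ∪ Dx`: the players are
the endogenous facts and the wealth of `E ⊆ Dn` is `q(E ∪ Dx) - q(Dx)`. -/
noncomputable def queryShapley {S : Schema} (q : BoolQuery S) (Dn Dx : Finset (DBFact S))
    (f : Dn) : ℚ :=
  shapleyValue Dn (fun E => q.val (E ∪ Dx) - q.val Dx) f

/-- The probability that `q` holds in the tuple-independent database `(D, π)`. -/
noncomputable def queryProb {S : Schema} (q : BoolQuery S) (D : Finset (DBFact S))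
    (π : DBFact S → ℚ) : ℚ :=
  ∑ D' ∈ D.powerset, ((∏ f ∈ D', π f) * ∏ f ∈ D \ D', (1 - π f)) * q.val D'

/-! ### Random access machines with logarithmic cost, possibly with an oracle

The machine is the random access machine under the logarithmic cost criterion, with addition,
truncated subtraction, multiplication and integer division; the control flow is structured. Input,
output, queries to the oracle and its answers are on tapes whose cells hold natural numbers. -/

/-- The length of a number in binary, plus one for a delimiter. -/
def bitLen (n : ℕ) : ℕ := n.size + 1

/-- The length of a tape. -/
def tapeSize (l : List ℕ) : ℕ := (l.map bitLen).sum

/-- Configurations (apart from the control). -/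
structure RamState where
  mem : ℕ → ℕ
  inp : List ℕ
  out : List ℕ
  qry : List ℕ
  ans : List ℕ

/-- Operands: a constant, a register, or the register whose address is in a register. -/
inductive Operand where
  | const (c : ℕ)
  | dir (i : ℕ)
  | ind (i : ℕ)

def Operand.value : Operand → (ℕ → ℕ) → ℕ
  | const c, _ => c
  | dir i, m => m i
  | ind i, m => m (m i)

def Operand.cost : Operand → (ℕ → ℕ) → ℕ
  | const c, _ => bitLen c
  | dir i, m => bitLen i + bitLen (m i)
  | ind i, m => bitLen i + bitLen (m i) + bitLen (m (m i))

/-- Destinations: a register, or the register whose address is in a register. -/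
inductive Dest where
  | dir (i : ℕ)
  | ind (i : ℕ)

def Dest.addr : Dest → (ℕ → ℕ) → ℕ
  | dir i, _ => i
  | ind i, m => m i

def Dest.cost : Dest → (ℕ → ℕ) → ℕ
  | dir i, _ => bitLen i
  | ind i, m => bitLen i + bitLen (m i)

inductive ArithOp where
  | add
  | sub
  | mul
  | div

def ArithOp.apply : ArithOp → ℕ → ℕ → ℕ
  | add, a, b => a + b
  | sub, a, b => a - b
  | mul, a, b => a * b
  | div, a, b => a / b

/-- Programs. `read` takes the next number from the input tape (`0` if there is none), `write`
appends a number to the output tape, `send` appends a number to the query tape, `ask` consults the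
oracle, and `recv` takes the next number of the answer of the oracle (`0` if there is none).
Branching and loops test whether an operand is non-zero. -/
inductive RamProg where
  | skip
  | arith (o : ArithOp) (d : Dest) (a b : Operand)
  | read (d : Dest)
  | write (a : Operand)
  | send (a : Operand)
  | ask
  | recv (d : Dest)
  | seq (P Q : RamProg)
  | cond (a : Operand) (P Q : RamProg)
  | loop (a : Operand) (P : RamProg)

/-- The program does not use the oracle. -/
def RamProg.OracleFree : RamProg → Prop
  | skip => True
  | arith _ _ _ _ => True
  | read _ => True
  | write _ => True
  | send _ => False
  | ask => False
  | recv _ => False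
  | seq P Q => P.OracleFree ∧ Q.OracleFree
  | cond _ P Q => P.OracleFree ∧ Q.OracleFree
  | loop _ P => P.OracleFree

def RamState.store (s : RamState) (d : Dest) (v : ℕ) : RamState :=
  { s with mem := Function.update s.mem (d.addr s.mem) v }

/-- `RamExec O P s s' t`: with the oracle `O`, the program `P` started in `s` halts in `s'`, and the
run has logarithmic cost `t`. A call of the oracle is one step. -/
inductive RamExec (O : List ℕ → List ℕ) : RamProg → RamState → RamState → ℕ → Prop
  | skip (s : RamState) : RamExec O .skip s s 1
  | arith (o : ArithOp) (d : Dest) (a b : Operand) (s : RamState) :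
      RamExec O (.arith o d a b) s
        (s.store d (o.apply (a.value s.mem) (b.value s.mem)))
        (1 + d.cost s.mem + a.cost s.mem + b.cost s.mem)
  | read (d : Dest) (s : RamState) :
      RamExec O (.read d) s
        ({ s with inp := s.inp.tail }.store d (s.inp.headD 0))
        (1 + d.cost s.mem + bitLen (s.inp.headD 0))
  | write (a : Operand) (s : RamState) :
      RamExec O (.write a) s { s with out := s.out ++ [a.value s.mem] } (1 + a.cost s.mem)
  | send (a : Operand) (s : RamState) :
      RamExec O (.send a) s { s with qry := s.qry ++ [a.value s.mem] } (1 + a.cost s.mem)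
  | ask (s : RamState) :
      RamExec O .ask s { s with qry := [], ans := O s.qry } 1
  | recv (d : Dest) (s : RamState) :
      RamExec O (.recv d) s
        ({ s with ans := s.ans.tail }.store d (s.ans.headD 0))
        (1 + d.cost s.mem + bitLen (s.ans.headD 0))
  | seq {P Q : RamProg} {s₁ s₂ s₃ : RamState} {t u : ℕ}
      (hP : RamExec O P s₁ s₂ t) (hQ : RamExec O Q s₂ s₃ u) :
      RamExec O (.seq P Q) s₁ s₃ (t + u)
  | cond_true {a : Operand} {P Q : RamProg} {s s' : RamState} {t : ℕ}
      (ha : a.value s.mem ≠ 0) (h : RamExec O P s s' t) :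
      RamExec O (.cond a P Q) s s' (1 + a.cost s.mem + t)
  | cond_false {a : Operand} {P Q : RamProg} {s s' : RamState} {t : ℕ}
      (ha : a.value s.mem = 0) (h : RamExec O Q s s' t) :
      RamExec O (.cond a P Q) s s' (1 + a.cost s.mem + t)
  | loop_done {a : Operand} {P : RamProg} {s : RamState} (ha : a.value s.mem = 0) :
      RamExec O (.loop a P) s s (1 + a.cost s.mem)
  | loop_step {a : Operand} {P : RamProg} {s₁ s₂ s₃ : RamState} {t u : ℕ}
      (ha : a.value s₁.mem ≠ 0) (hP : RamExec O P s₁ s₂ t)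
      (hL : RamExec O (.loop a P) s₂ s₃ u) :
      RamExec O (.loop a P) s₁ s₃ (1 + a.cost s₁.mem + t + u)

/-- The initial configuration: the memory is zero and all tapes but the input are empty. -/
def RamState.start (x : List ℕ) : RamState := ⟨fun _ => 0, x, [], [], []⟩

/-! ### Computational problems, FP, polynomial-time reductions -/

/-- A rational number, as sign bit, numerator and denominator (in lowest terms). -/
def encRat (r : ℚ) : List ℕ := [if r < 0 then 1 else 0, r.num.natAbs, r.den]

/-- A computational problem: compute the rational number `goal x` for a given instance `x`. -/
structure NumProblem where
  Inst : Type
  enc : Inst → List ℕ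
  enc_injective : Function.Injective enc
  goal : Inst → ℚ

/-- With the oracle `O`, the program `P` solves the problem `A` in time bounded by the polynomial
`p` in the length of the input. -/
def RamProg.SolvesIn (P : RamProg) (O : List ℕ → List ℕ) (A : NumProblem)
    (p : Polynomial ℕ) : Prop :=
  ∀ x : A.Inst, ∃ (s : RamState) (t : ℕ), RamExec O P (RamState.start (A.enc x)) s t ∧
    t ≤ p.eval (tapeSize (A.enc x)) ∧ s.out = encRat (A.goal x)

/-- The problem `A` is in FP: some program without oracle solves it in polynomial time. -/
def InFP (A : NumProblem) : Prop :=
  ∃ P : RamProg, P.OracleFree ∧ ∃ p : Polynomial ℕ, P.SolvesIn (fun _ => []) A p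

/-- `O` is an oracle for `B`: it gives the right answer to every instance of `B` (and anything to
what is not an instance). -/
def IsOracleFor (O : List ℕ → List ℕ) (B : NumProblem) : Prop :=
  ∀ y : B.Inst, O (B.enc y) = encRat (B.goal y)

/-- `A` reduces in polynomial time to `B` (polynomial-time Turing reduction): a single program
solves `A` in polynomial time with any oracle for `B`. -/
def PolyTimeReducible (A B : NumProblem) : Prop :=
  ∃ (P : RamProg) (p : Polynomial ℕ), ∀ O : List ℕ → List ℕ, IsOracleFor O B → P.SolvesIn O A p

/-! ### Instances and their encodings -/

def encFact {S : Schema} (f : DBFact S) : List ℕ := (f.1 : ℕ) :: List.ofFn f.2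

/-- A list, preceded by its length. -/
def encList {α : Type} (e : α → List ℕ) (l : List α) : List ℕ := l.length :: l.flatMap e

/-- No code is a proper prefix of another one, and codes are unique. -/
def PrefixFree {α : Type} (e : α → List ℕ) : Prop :=
  ∀ ⦃a b : α⦄ ⦃r r' : List ℕ⦄, e a ++ r = e b ++ r' → a = b ∧ r = r'

theorem prefixFree_encFact {S : Schema} : PrefixFree (encFact (S := S)) := by
  rintro ⟨R, c⟩ ⟨R', c'⟩ r r' h
  simp only [encFact, List.cons_append, List.cons.injEq] at h
  obtain ⟨h1, h2⟩ := h
  obtain rfl : R = R' := Fin.ext h1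
  obtain ⟨h3, h4⟩ := List.append_inj h2 (by simp)
  exact ⟨by rw [List.ofFn_injective h3], h4⟩

theorem prefixFree_encRat : PrefixFree encRat := by
  intro a b r r' h
  simp only [encRat, List.cons_append, List.nil_append, List.cons.injEq] at h
  obtain ⟨h1, h2, h3, h4⟩ := h
  refine ⟨Rat.ext ?_ h3, h4⟩
  have ha : a < 0 ↔ a.num < 0 := Rat.num_neg.symm
  have hb : b < 0 ↔ b.num < 0 := Rat.num_neg.symm
  by_cases h5 : a < 0 <;> by_cases h6 : b < 0 <;> simp [h5, h6] at h1 <;>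
    rw [ha] at h5 <;> rw [hb] at h6 <;> omega

theorem PrefixFree.encList {α : Type} {e : α → List ℕ} (he : PrefixFree e) :
    PrefixFree (encList e) := by
  intro l
  induction l with
  | nil =>
    rintro (_ | ⟨b, l'⟩) r r' h
    · simpa [_root_.encList] using h
    · simp [_root_.encList] at h
  | cons a l ih =>
    rintro (_ | ⟨b, l'⟩) r r' h
    · simp [_root_.encList] at h
    · simp only [_root_.encList, List.length_cons, List.flatMap_cons, List.cons_append,
        List.append_assoc, List.cons.injEq] at h
      obtain ⟨h1, h2⟩ := h
      obtain ⟨rfl, h3⟩ := he h2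
      obtain ⟨rfl, h4⟩ := @ih l' r r' (by simp [_root_.encList, h3]; omega)
      exact ⟨rfl, h4⟩

theorem PrefixFree.pair {α β : Type} {e : α → List ℕ} {e' : β → List ℕ} (he : PrefixFree e)
    (he' : PrefixFree e') : PrefixFree (fun x : α × β => e x.1 ++ e' x.2) := by
  rintro ⟨a, b⟩ ⟨a', b'⟩ r r' h
  simp only [List.append_assoc] at h
  obtain ⟨rfl, h1⟩ := he h
  obtain ⟨rfl, h2⟩ := he' h1
  exact ⟨rfl, h2⟩

theorem PrefixFree.injective {α : Type} {e : α → List ℕ} (he : PrefixFree e) :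
    Function.Injective e := fun a b h => (@he a b [] [] (by rw [h])).1

/-- An input of the Shapley problem: the endogenous and the exogenous facts, listed in any order and
without repetition, and an endogenous fact. -/
@[ext] structure ShapleyInst (S : Schema) where
  endo : List (DBFact S)
  exo : List (DBFact S)
  nodup : (endo ++ exo).Nodup
  fact : DBFact S
  mem : fact ∈ endo

def ShapleyInst.enc {S : Schema} (x : ShapleyInst S) : List ℕ :=
  encList encFact x.endo ++ (encList encFact x.exo ++ encFact x.fact)

theorem ShapleyInst.enc_injective {S : Schema} : Function.Injective (enc (S := S)) := by
  intro x y h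
  obtain ⟨h1, h⟩ := prefixFree_encFact.encList h
  obtain ⟨h2, h⟩ := prefixFree_encFact.encList h
  exact ShapleyInst.ext h1 h2 (prefixFree_encFact.injective h)

/-- The problem of computing the Shapley value of a fact for the fixed query `q`. -/
noncomputable def shapleyProblem {S : Schema} (q : BoolQuery S) : NumProblem where
  Inst := ShapleyInst S
  enc := ShapleyInst.enc
  enc_injective := ShapleyInst.enc_injective
  goal x := queryShapley q x.endo.toFinset x.exo.toFinset ⟨x.fact, List.mem_toFinset.2 x.mem⟩

/-- A tuple-independent database: facts, listed in any order and without repetition, each with a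
rational probability. -/
@[ext] structure TID (S : Schema) where
  entries : List (DBFact S × ℚ)
  nodup : (entries.map Prod.fst).Nodup
  prob_mem : ∀ e ∈ entries, 0 ≤ e.2 ∧ e.2 ≤ 1

/-- The facts of a tuple-independent database. -/
def TID.facts {S : Schema} (T : TID S) : Finset (DBFact S) := (T.entries.map Prod.fst).toFinset

/-- The probability of a fact of a tuple-independent database. -/
def TID.prob {S : Schema} (T : TID S) (f : DBFact S) : ℚ := (T.entries.lookup f).getD 0

def TID.enc {S : Schema} (T : TID S) : List ℕ :=
  encList (fun e : DBFact S × ℚ => encFact e.1 ++ encRat e.2) T.entries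

theorem TID.enc_injective {S : Schema} : Function.Injective (enc (S := S)) := fun _ _ h =>
  TID.ext ((prefixFree_encFact.pair prefixFree_encRat).encList.injective h)

/-- Probabilistic query evaluation for the fixed query `q`. -/
noncomputable def pqeProblem {S : Schema} (q : BoolQuery S) : NumProblem where
  Inst := TID S
  enc := TID.enc
  enc_injective := TID.enc_injective
  goal T := queryProb q T.facts T.prob

/-! ### Unions of conjunctive queries and safety -/

/-- A value (constant) or a variable. -/
inductive QTerm where
  | const (c : ℕ)
  | var (x : ℕ)

def QTerm.eval (v : ℕ → ℕ) : QTerm → ℕ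
  | const c => c
  | var x => v x

/-- An atomic formula `R(t₁,…,t_k)`. -/
structure QAtom (S : Schema) where
  rel : Fin S.numRel
  args : Fin (S.arity rel) → QTerm

def QAtom.ground {S : Schema} (A : QAtom S) (v : ℕ → ℕ) : DBFact S :=
  ⟨A.rel, fun i => (A.args i).eval v⟩

/-- A Boolean conjunctive query: a conjunction of atoms, all variables of which are existentially
quantified. -/
abbrev CQ (S : Schema) : Type := List (QAtom S)

/-- A Boolean union of conjunctive queries. -/
abbrev UCQ (S : Schema) : Type := List (CQ S)

def UCQ.toQuery {S : Schema} (Q : UCQ S) : BoolQuery S := fun D =>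
  ∃ C ∈ Q, ∃ v : ℕ → ℕ, ∀ A ∈ C, A.ground v ∈ D

/-- Positive existential formulas with comparisons, the intermediate queries of lifted inference.
Free variables are parameters. The comparisons express the restrictions of relations to which
lifted inference passes (ranking and shattering): the part of `R` where the first attribute is less
than the second, or different from a constant, and so on. -/
inductive PEForm (S : Schema) where
  | tru
  | fls
  | atom (A : QAtom S)
  | eq (t u : QTerm)
  | lt (t u : QTerm)
  | and (φ ψ : PEForm S)
  | or (φ ψ : PEForm S)
  | ex (x : ℕ) (φ : PEForm S)

/-- `φ.Sat v D`: the database `D` satisfies `φ` under the assignment `v`. -/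
def PEForm.Sat {S : Schema} : PEForm S → (ℕ → ℕ) → Finset (DBFact S) → Prop
  | tru, _, _ => True
  | fls, _, _ => False
  | atom A, v, D => A.ground v ∈ D
  | eq t u, v, _ => t.eval v = u.eval v
  | lt t u, v, _ => t.eval v < u.eval v
  | and φ ψ, v, D => φ.Sat v D ∧ ψ.Sat v D
  | or φ ψ, v, D => φ.Sat v D ∨ ψ.Sat v D
  | ex x φ, v, D => ∃ a : ℕ, φ.Sat (Function.update v x a) D

/-- Logical equivalence. -/
def PEForm.Equivalent {S : Schema} (φ ψ : PEForm S) : Prop := ∀ v D, φ.Sat v D ↔ ψ.Sat v D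

/-- The fact `f` is relevant (critical) for `q`: it makes a difference in some database. -/
def BoolQuery.Relevant {S : Schema} (q : BoolQuery S) (f : DBFact S) : Prop :=
  ∃ D : Finset (DBFact S), ¬ (q (insert f D) ↔ q D)

/-- Two queries are independent if no fact is relevant for both. -/
def BoolQuery.Indep {S : Schema} (q q' : BoolQuery S) : Prop :=
  ∀ f : DBFact S, ¬ (q.Relevant f ∧ q'.Relevant f)

/-- The variable `x` is a separator of `φ`: it takes only values of facts of the database, and
instantiating it by distinct values gives independent queries. -/
def PEForm.IsSeparator {S : Schema} (x : ℕ) (φ : PEForm S) : Prop :=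
  (∀ v D, φ.Sat v D → ∃ f ∈ D, ∃ i, f.2 i = v x) ∧
  ∀ (v : ℕ → ℕ) (a b : ℕ), a ≠ b →
    BoolQuery.Indep (φ.Sat (Function.update v x a)) (φ.Sat (Function.update v x b))

/-- The disjunction of the `φ i` with `i ∈ s`. -/
def PEForm.bigOr {S : Schema} {k : ℕ} (φ : Fin k → PEForm S) (s : Finset (Fin k)) : PEForm S :=
  ((List.finRange k).filter (· ∈ s)).foldr (fun i ψ => (φ i).or ψ) fls

/-- The conjunction of all `φ i`. -/
def PEForm.bigAnd {S : Schema} {k : ℕ} (φ : Fin k → PEForm S) : PEForm S :=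
  (List.finRange k).foldr (fun i ψ => (φ i).and ψ) tru

open Classical in
/-- The coefficient that the equivalence class of `⋁_{i ∈ s} φ i` has, after collecting equivalent
terms, in the inclusion-exclusion formula
`P(⋀ i, φ i) = - ∑_{∅ ≠ s} (-1)^|s| P(⋁_{i ∈ s} φ i)`. By the cross-cut theorem this is, up to sign,
the value of the Möbius function at this class in the lattice of the disjunctions. -/
noncomputable def PEForm.mobiusCoeff {S : Schema} {k : ℕ} (φ : Fin k → PEForm S)
    (s : Finset (Fin k)) : ℤ :=
  - ∑ t : Finset (Fin k) with t.Nonempty ∧ (bigOr φ t).Equivalent (bigOr φ s), (-1) ^ t.card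

/-- The formulas whose probability is computed by the rules of lifted inference: independent join,
independent union, independent project on a separator variable, and inclusion-exclusion with Möbius
cancellation, applied up to logical equivalence until facts (and comparisons of parameters) are
left. -/
inductive PEForm.Liftable {S : Schema} : PEForm S → Prop
  | tru : Liftable .tru
  | fls : Liftable .fls
  | atom (A : QAtom S) : Liftable (.atom A)
  | eq (t u : QTerm) : Liftable (.eq t u)
  | lt (t u : QTerm) : Liftable (.lt t u)
  | equiv {φ ψ : PEForm S} (h : φ.Equivalent ψ) (hφ : Liftable φ) : Liftable ψ
  | join {φ ψ : PEForm S} (h : ∀ v, BoolQuery.Indep (φ.Sat v) (ψ.Sat v))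
      (hφ : Liftable φ) (hψ : Liftable ψ) : Liftable (.and φ ψ)
  | union {φ ψ : PEForm S} (h : ∀ v, BoolQuery.Indep (φ.Sat v) (ψ.Sat v))
      (hφ : Liftable φ) (hψ : Liftable ψ) : Liftable (.or φ ψ)
  | project {x : ℕ} {φ : PEForm S} (h : φ.IsSeparator x) (hφ : Liftable φ) : Liftable (.ex x φ)
  | mobius {k : ℕ} (φ : Fin k → PEForm S)
      (h : ∀ s : Finset (Fin k), s.Nonempty → mobiusCoeff φ s ≠ 0 → Liftable (bigOr φ s)) :
      Liftable (bigAnd φ)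

/-- A union of conjunctive queries is safe if the rules of lifted inference succeed on it. -/
def UCQ.IsSafe {S : Schema} (Q : UCQ S) : Prop :=
  ∃ φ : PEForm S, φ.Liftable ∧ ∀ v D, φ.Sat v D ↔ Q.toQuery D

/-! Let n be the number of endogenous facts, and let c₀(k) and c₁(k) be the numbers of k-element
sets E of endogenous facts other than f for which q holds in E ∪ Dx and in E ∪ {f} ∪ Dx,
respectively. Exactly k!(n-1-k)! permutations put a given k-element set before f and the rest after
it, so the Shapley value times n! is the sum over k < n of k!(n-1-k)!(c₁(k) - c₀(k))
(`queryShapley_eq`). It is therefore enough to find these 2n numbers.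

All of them are read off from one weighted count. Put B = 2^n and give the facts weights for
presence and absence: B and 1 for endogenous facts other than f, B^n and 1 for f, 1 and 0 for
exogenous facts. The total weight of the sets of facts that satisfy q is ∑ B^k c₀(k) + B^n ∑ B^k
c₁(k) (`wmc_factWeight`). Each c is at most 2^(n-1) < B, so the c are the digits of this number to
base B (`sum_pow_mul_digit`). The total weight W of all sets has O(n²) bits (`wtot_factWeight_le`).

The two claims differ only in how the weighted count is found. For the reduction, the facts get
probability a/(a+b), where a and b are the weights; the probability of q is then the weighted count
divided by W (`queryProb_eq_wmc_div`), and one call of the oracle suffices. For a safe query, lifted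
inference is run on weighted counts instead of probabilities. Counts divided by W are probabilities
of a product measure, so independent conjunction, disjunction and projection hold with a division by
W that is exact, and inclusion-exclusion is linear (`wmc_and`, `wmc_or`, `wmc_forall_cons`,
`PEForm.exists_count_bigAnd`). Induction on the derivation of `Liftable` turns each formula into a
program (`PEForm.Liftable.computable`). Logical equivalences and Möbius coefficients are used only
in constructing the program, never at run time, because the query is fixed.

For the running time, programs are written in a small structured language that is compiled to the
machine. The judgement `WP` is total correctness together with the invariant that all numbers have
at most L bits; its loop rule allows at most L rounds. The cost is then at most a polynomial in L
that depends on the program only (`Cmd.exists_polynomial_cost_le`), and L is chosen polynomial in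
the length of the input (`CountsWeighted.solvesIn`). -/

/-! ### A structured language over registers, parameters and a table, compiled to the machine -/

/-- Configurations of the structured language: registers, values of query variables, a
two-dimensional table (first index: column), and the tapes. -/
structure MState where
  reg : ℕ → ℕ
  env : ℕ → ℕ
  arr : ℕ → ℕ → ℕ
  inp : List ℕ
  out : List ℕ
  qry : List ℕ
  ans : List ℕ

/-- The address of the table entry in column `c` and row `j`. -/
def cellAddr (c j : ℕ) : ℕ := ((c + j) * (c + j) + c) * 4 + 2

/-- The address of the temporary register `d`. -/
def tmp (d : ℕ) : ℕ := 4 * d + 3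

/-- As c ≤ c + j, the integer square root of (c + j)² + c is c + j, which leaves c as the rest.
Addresses are separated modulo 4: registers have residue 0, query variables 1, table cells 2 and
temporaries 3. -/
theorem cellAddr_inj {c j c' j' : ℕ} (h : cellAddr c j = cellAddr c' j') : c = c' ∧ j = j' := by
  have h1 : (c + j) * (c + j) + c = (c' + j') * (c' + j') + c' := by unfold cellAddr at h; omega
  have h2 := Nat.sqrt_add_eq (c + j) (a := c) (by omega)
  have h3 := Nat.sqrt_add_eq (c' + j') (a := c') (by omega)
  rw [h1, h3] at h2
  rw [h2] at h1
  omega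

theorem bitLen_le {n L : ℕ} (h : n < 2 ^ L) : bitLen n ≤ L + 1 := by
  have := Nat.size_le.2 h
  unfold bitLen; omega

/-- The memory `m` represents the registers, variables and table of `s`. -/
structure MemRep (m : ℕ → ℕ) (s : MState) : Prop where
  reg : ∀ i, m (4 * i) = s.reg i
  env : ∀ x, m (4 * x + 1) = s.env x
  arr : ∀ c j, m (cellAddr c j) = s.arr c j

/-- All numbers in the configuration have at most `L` bits. -/
structure Bdd (L : ℕ) (s : MState) : Prop where
  ten_le : 10 ≤ L
  reg : ∀ i, s.reg i < 2 ^ L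
  env : ∀ x, s.env x < 2 ^ L
  arr : ∀ c j, s.arr c j < 2 ^ L
  inp : ∀ x ∈ s.inp, x < 2 ^ L
  ans : ∀ x ∈ s.ans, x < 2 ^ L

/-- Temporaries are not part of the represented configuration, so evaluating an expression does not
disturb the representation. -/
theorem MemRep.congr {m m' : ℕ → ℕ} {s : MState} (h : MemRep m s)
    (hm : ∀ a, (∀ k, a ≠ tmp k) → m' a = m a) : MemRep m' s where
  reg i := by rw [hm _ (fun k => by unfold tmp; omega), h.reg]
  env i := by rw [hm _ (fun k => by unfold tmp; omega), h.env]
  arr c j := by rw [hm _ (fun k => by unfold tmp cellAddr; omega), h.arr]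

/-- The coefficient of `L + 1` in the cost of an access: a number fixed in the program counts with
its own length, and each number found in memory, having at most `L` bits, counts once. -/
def Operand.wt : Operand → ℕ
  | const c => bitLen c
  | dir i => bitLen i + 1
  | ind i => bitLen i + 2

def Operand.Small (L : ℕ) (m : ℕ → ℕ) : Operand → Prop
  | const _ => True
  | dir i => m i < 2 ^ L
  | ind i => m i < 2 ^ L ∧ m (m i) < 2 ^ L

def Dest.wt : Dest → ℕ
  | dir i => bitLen i
  | ind i => bitLen i + 1

def Dest.Small (L : ℕ) (m : ℕ → ℕ) : Dest → Prop
  | dir _ => True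
  | ind i => m i < 2 ^ L

theorem Operand.cost_le {L : ℕ} {m : ℕ → ℕ} {a : Operand} (h : a.Small L m) :
    a.cost m ≤ a.wt * (L + 1) := by
  cases a with
  | const c => simp only [cost, wt]; nlinarith
  | dir i => have := bitLen_le h; simp only [cost, wt]; nlinarith
  | ind i => have := bitLen_le h.1; have := bitLen_le h.2; simp only [cost, wt]; nlinarith

theorem Dest.cost_le {L : ℕ} {m : ℕ → ℕ} {a : Dest} (h : a.Small L m) :
    a.cost m ≤ a.wt * (L + 1) := by
  cases a with
  | dir i => simp only [cost, wt]; nlinarith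
  | ind i => have := bitLen_le h; simp only [cost, wt]; nlinarith

theorem exec_arith (O : List ℕ → List ℕ) {L : ℕ} (o : ArithOp) (d : Dest) (a b : Operand)
    (ρ : RamState) (hd : d.Small L ρ.mem) (ha : a.Small L ρ.mem) (hb : b.Small L ρ.mem) :
    ∃ t, RamExec O (.arith o d a b) ρ
      (ρ.store d (o.apply (a.value ρ.mem) (b.value ρ.mem))) t ∧
      t ≤ (1 + d.wt + a.wt + b.wt) * (L + 1) := by
  refine ⟨_, RamExec.arith o d a b ρ, ?_⟩
  have := d.cost_le hd; have := a.cost_le ha; have := b.cost_le hb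
  nlinarith

theorem exec_arith_dir (O : List ℕ → List ℕ) {L : ℕ} (o : ArithOp) (i : ℕ) (a b : Operand)
    (ρ : RamState) (ha : a.Small L ρ.mem) (hb : b.Small L ρ.mem) :
    ∃ m t, RamExec O (.arith o (.dir i) a b) ρ { ρ with mem := m } t ∧
      m i = o.apply (a.value ρ.mem) (b.value ρ.mem) ∧ (∀ x, x ≠ i → m x = ρ.mem x) ∧
      t ≤ (1 + bitLen i + a.wt + b.wt) * (L + 1) := by
  obtain ⟨t, h1, h2⟩ := exec_arith O o (.dir i) a b ρ trivial ha hb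
  exact ⟨_, t, h1, Function.update_self .., fun x hx => Function.update_of_ne hx .., h2⟩

/-- Expressions. -/
inductive Ex where
  | const (c : ℕ)
  | reg (i : ℕ)
  | env (x : ℕ)
  | arr (c j : Ex)
  | op (o : ArithOp) (a b : Ex)

/-! ### Expressions: values, size conditions and compilation -/

namespace Ex

instance (n : ℕ) : OfNat Ex n := ⟨const n⟩
instance : Add Ex := ⟨op .add⟩
instance : Sub Ex := ⟨op .sub⟩
instance : Mul Ex := ⟨op .mul⟩
instance : Div Ex := ⟨op .div⟩

def val (s : MState) : Ex → ℕ
  | const c => c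
  | reg i => s.reg i
  | env x => s.env x
  | arr c j => s.arr (c.val s) (j.val s)
  | op o a b => o.apply (a.val s) (b.val s)

/-- All intermediate results are small, and table entries are accessed near the origin. -/
def Ok (L : ℕ) (s : MState) : Ex → Prop
  | const c => c < 2 ^ L
  | reg _ => True
  | env _ => True
  | arr c j => c.Ok L s ∧ j.Ok L s ∧ c.val s + j.val s ≤ L
  | op .add a b => a.Ok L s ∧ b.Ok L s ∧ a.val s + b.val s < 2 ^ L
  | op .mul a b => a.Ok L s ∧ b.Ok L s ∧ a.val s * b.val s < 2 ^ L
  | op _ a b => a.Ok L s ∧ b.Ok L s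

variable (s : MState) (L : ℕ)
@[simp] theorem val_const (c : ℕ) : (const c).val s = c := rfl
@[simp] theorem val_ofNat (n : ℕ) : (no_index (OfNat.ofNat n) : Ex).val s = n := rfl
@[simp] theorem val_reg (i : ℕ) : (reg i).val s = s.reg i := rfl
@[simp] theorem val_env (i : ℕ) : (env i).val s = s.env i := rfl
@[simp] theorem val_arr (c j : Ex) : (arr c j).val s = s.arr (c.val s) (j.val s) := rfl
@[simp] theorem val_add (a b : Ex) : (a + b).val s = a.val s + b.val s := rfl
@[simp] theorem val_sub (a b : Ex) : (a - b).val s = a.val s - b.val s := rfl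
@[simp] theorem val_mul (a b : Ex) : (a * b).val s = a.val s * b.val s := rfl
@[simp] theorem val_div (a b : Ex) : (a / b).val s = a.val s / b.val s := rfl
@[simp] theorem ok_const (c : ℕ) : (const c).Ok L s ↔ c < 2 ^ L := Iff.rfl
@[simp] theorem ok_ofNat (n : ℕ) : (no_index (OfNat.ofNat n) : Ex).Ok L s ↔ n < 2 ^ L := Iff.rfl
@[simp] theorem ok_reg (i : ℕ) : (reg i).Ok L s ↔ True := Iff.rfl
@[simp] theorem ok_env (i : ℕ) : (env i).Ok L s ↔ True := Iff.rfl
@[simp] theorem ok_arr (c j : Ex) : (arr c j).Ok L s ↔ c.Ok L s ∧ j.Ok L s ∧ c.val s + j.val s ≤ L :=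
  Iff.rfl
@[simp] theorem ok_add (a b : Ex) : (a + b).Ok L s ↔ a.Ok L s ∧ b.Ok L s ∧ a.val s + b.val s < 2 ^ L :=
  Iff.rfl
@[simp] theorem ok_sub (a b : Ex) : (a - b).Ok L s ↔ a.Ok L s ∧ b.Ok L s := Iff.rfl
@[simp] theorem ok_mul (a b : Ex) : (a * b).Ok L s ↔ a.Ok L s ∧ b.Ok L s ∧ a.val s * b.val s < 2 ^ L :=
  Iff.rfl
@[simp] theorem ok_div (a b : Ex) : (a / b).Ok L s ↔ a.Ok L s ∧ b.Ok L s := Iff.rfl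

/-- The test `a = b`. -/
def eqE (a b : Ex) : Ex := (1 - (a - b)) * (1 - (b - a))

@[simp] theorem val_eqE (a b : Ex) : (eqE a b).val s = if a.val s = b.val s then 1 else 0 := by
  simp only [eqE, val_mul, val_sub, val_ofNat]
  split_ifs with h
  · simp [h]
  · rcases Nat.lt_or_gt_of_ne h with h | h
    · rw [Nat.sub_eq_zero_of_le (m := b.val s - a.val s) (by omega), mul_zero]
    · rw [Nat.sub_eq_zero_of_le (m := a.val s - b.val s) (by omega), zero_mul]

variable {s L}

theorem Ok.val_lt (hb : Bdd L s) : ∀ {e : Ex}, e.Ok L s → e.val s < 2 ^ L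
  | const _, h => h
  | reg _, _ => hb.reg _
  | env _, _ => hb.env _
  | arr _ _, _ => hb.arr _ _
  | op .add _ _, h => h.2.2
  | op .mul _ _, h => h.2.2
  | op .sub _ _, h => (Nat.sub_le _ _).trans_lt (val_lt hb h.1)
  | op .div _ _, h => (Nat.div_le_self _ _).trans_lt (val_lt hb h.1)

theorem ok_eqE {a b : Ex} (h1 : 1 < 2 ^ L) (ha : a.Ok L s) (hb : b.Ok L s) : (eqE a b).Ok L s := by
  simp only [eqE, ok_mul, ok_sub, ok_ofNat, val_sub, val_ofNat]
  refine ⟨⟨h1, ha, hb⟩, ⟨h1, hb, ha⟩, lt_of_le_of_lt ?_ h1⟩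
  exact Nat.mul_le_mul (Nat.sub_le _ _) (Nat.sub_le _ _)

/-- Turns the column in temporary register `d` and the row in `d + 1` into the address. -/
def addrProg (d : ℕ) : RamProg :=
  .seq (.arith .add (.dir (tmp (d + 1))) (.dir (tmp d)) (.dir (tmp (d + 1)))) <|
  .seq (.arith .mul (.dir (tmp (d + 1))) (.dir (tmp (d + 1))) (.dir (tmp (d + 1)))) <|
  .seq (.arith .add (.dir (tmp d)) (.dir (tmp (d + 1))) (.dir (tmp d))) <|
  .seq (.arith .mul (.dir (tmp d)) (.dir (tmp d)) (.const 4)) <|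
  .arith .add (.dir (tmp d)) (.dir (tmp d)) (.const 2)

def addrCost (d : ℕ) : ℕ := 40 + 10 * (bitLen (tmp d) + bitLen (tmp (d + 1)))

/-- The reason for `10 ≤ L` in `Bdd`: the address of a cell with column plus row at most `L` then
has at most `L` bits itself. -/
theorem sq_lt_two_pow {L : ℕ} (hL : 10 ≤ L) : (L * L + L) * 4 + 2 < 2 ^ L := by
  induction L, hL using Nat.le_induction with
  | base => norm_num
  | succ n hn ih => rw [pow_succ]; nlinarith

theorem cellAddr_lt {c j : ℕ} (hL : 10 ≤ L) (h : c + j ≤ L) : cellAddr c j < 2 ^ L := by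
  refine lt_of_le_of_lt ?_ (sq_lt_two_pow hL)
  unfold cellAddr
  have : (c + j) * (c + j) ≤ L * L := Nat.mul_le_mul h h
  omega

theorem exec_addrProg (O : List ℕ → List ℕ) (hL : 10 ≤ L) (d : ℕ) (ρ : RamState)
    (h : ρ.mem (tmp d) + ρ.mem (tmp (d + 1)) ≤ L) :
    ∃ m t, RamExec O (addrProg d) ρ { ρ with mem := m } t ∧
      m (tmp d) = cellAddr (ρ.mem (tmp d)) (ρ.mem (tmp (d + 1))) ∧
      (∀ a, a ≠ tmp d → a ≠ tmp (d + 1) → m a = ρ.mem a) ∧ t ≤ addrCost d * (L + 1) := by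
  have hne : tmp d ≠ tmp (d + 1) := by unfold tmp; omega
  have hA := sq_lt_two_pow hL
  set c := ρ.mem (tmp d) with hc
  set j := ρ.mem (tmp (d + 1)) with hj
  have hcj : (c + j) * (c + j) ≤ L * L := Nat.mul_le_mul h h
  obtain ⟨m1, t1, e1, v1, f1, c1⟩ := exec_arith_dir O (L := L) .add (tmp (d + 1)) (.dir (tmp d))
    (.dir (tmp (d + 1))) ρ (by simp only [Operand.Small, ← hc]; omega)
    (by simp only [Operand.Small, ← hj]; omega)
  simp only [ArithOp.apply, Operand.value, ← hc, ← hj] at v1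
  have w1 : m1 (tmp d) = c := f1 _ hne
  obtain ⟨m2, t2, e2, v2, f2, c2⟩ := exec_arith_dir O (L := L) .mul (tmp (d + 1))
    (.dir (tmp (d + 1))) (.dir (tmp (d + 1))) { ρ with mem := m1 }
    (by simp only [Operand.Small, v1]; omega) (by simp only [Operand.Small, v1]; omega)
  simp only [ArithOp.apply, Operand.value, v1] at v2
  have w2 : m2 (tmp d) = c := (f2 _ hne).trans w1
  obtain ⟨m3, t3, e3, v3, f3, c3⟩ := exec_arith_dir O (L := L) .add (tmp d)
    (.dir (tmp (d + 1))) (.dir (tmp d)) { ρ with mem := m2 }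
    (by simp only [Operand.Small, v2]; omega) (by simp only [Operand.Small, w2]; omega)
  simp only [ArithOp.apply, Operand.value, v2, w2] at v3
  obtain ⟨m4, t4, e4, v4, f4, c4⟩ := exec_arith_dir O (L := L) .mul (tmp d)
    (.dir (tmp d)) (.const 4) { ρ with mem := m3 }
    (by simp only [Operand.Small, v3]; omega) trivial
  simp only [ArithOp.apply, Operand.value, v3] at v4
  obtain ⟨m5, t5, e5, v5, f5, c5⟩ := exec_arith_dir O (L := L) .add (tmp d)
    (.dir (tmp d)) (.const 2) { ρ with mem := m4 }
    (by simp only [Operand.Small, v4]; omega) trivial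
  simp only [ArithOp.apply, Operand.value, v4] at v5
  refine ⟨_, _, .seq e1 (.seq e2 (.seq e3 (.seq e4 e5))), v5, ?_, ?_⟩
  · intro a h1 h2
    exact (f5 a h1).trans ((f4 a h1).trans ((f3 a h1).trans ((f2 a h2).trans (f1 a h2))))
  · simp only [Operand.wt] at *
    have b4 : bitLen 4 = 4 := by decide
    have b2 : bitLen 2 = 3 := by decide
    rw [b4] at c4; rw [b2] at c5
    unfold addrCost
    nlinarith

/-- The program that evaluates the expression into the temporary register `d`. -/
def compile : Ex → ℕ → RamProg
  | const c, d => .arith .add (.dir (tmp d)) (.const c) (.const 0)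
  | reg i, d => .arith .add (.dir (tmp d)) (.dir (4 * i)) (.const 0)
  | env i, d => .arith .add (.dir (tmp d)) (.dir (4 * i + 1)) (.const 0)
  | arr c j, d => .seq (c.compile d) <| .seq (j.compile (d + 1)) <| .seq (addrProg d) <|
      .arith .add (.dir (tmp d)) (.ind (tmp d)) (.const 0)
  | op o a b, d => .seq (a.compile d) <| .seq (b.compile (d + 1)) <|
      .arith o (.dir (tmp d)) (.dir (tmp d)) (.dir (tmp (d + 1)))

def cost : Ex → ℕ → ℕ
  | const c, d => 5 + bitLen (tmp d) + bitLen c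
  | reg i, d => 5 + bitLen (tmp d) + bitLen (4 * i)
  | env i, d => 5 + bitLen (tmp d) + bitLen (4 * i + 1)
  | arr c j, d => c.cost d + j.cost (d + 1) + addrCost d + (6 + 2 * bitLen (tmp d))
  | op _ a b, d => a.cost d + b.cost (d + 1) + (6 + 2 * bitLen (tmp d) + bitLen (tmp (d + 1)))

/-- The temporaries form a stack. Evaluation at depth `d` changes only the temporaries from `d` on,
so the first operand, left in `tmp d`, survives the evaluation of the second one at depth `d + 1`.
-/
theorem compile_exec (O : List ℕ → List ℕ) (hb : Bdd L s) :
    ∀ (e : Ex) (d : ℕ) (ρ : RamState), MemRep ρ.mem s → e.Ok L s →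
      ∃ m t, RamExec O (e.compile d) ρ { ρ with mem := m } t ∧ m (tmp d) = e.val s ∧
        (∀ a, (∀ k, d ≤ k → a ≠ tmp k) → m a = ρ.mem a) ∧ t ≤ e.cost d * (L + 1) := by
  have b0 : bitLen 0 = 1 := by decide
  intro e
  induction e with
  | const c =>
    intro d ρ hρ hok
    obtain ⟨t, e1, c1⟩ := exec_arith O (L := L) .add (.dir (tmp d)) (.const c) (.const 0) ρ
      trivial trivial trivial
    refine ⟨_, _, e1, ?_, ?_, ?_⟩
    · simp [Dest.addr, ArithOp.apply, Operand.value]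
    · intro a ha
      simp [Dest.addr, ha d le_rfl]
    · simp only [Operand.wt, Dest.wt, b0] at c1
      simp only [cost]; nlinarith
  | reg i =>
    intro d ρ hρ hok
    obtain ⟨t, e1, c1⟩ := exec_arith O (L := L) .add (.dir (tmp d)) (.dir (4 * i)) (.const 0) ρ
      trivial (by simp only [Operand.Small, hρ.reg]; exact hb.reg i) trivial
    refine ⟨_, _, e1, ?_, ?_, ?_⟩
    · simp [Dest.addr, ArithOp.apply, Operand.value, hρ.reg]
    · intro a ha
      simp [Dest.addr, ha d le_rfl]
    · simp only [Operand.wt, Dest.wt, b0] at c1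
      simp only [cost]; nlinarith
  | env i =>
    intro d ρ hρ hok
    obtain ⟨t, e1, c1⟩ := exec_arith O (L := L) .add (.dir (tmp d)) (.dir (4 * i + 1)) (.const 0) ρ
      trivial (by simp only [Operand.Small, hρ.env]; exact hb.env i) trivial
    refine ⟨_, _, e1, ?_, ?_, ?_⟩
    · simp [Dest.addr, ArithOp.apply, Operand.value, hρ.env]
    · intro a ha
      simp [Dest.addr, ha d le_rfl]
    · simp only [Operand.wt, Dest.wt, b0] at c1
      simp only [cost]; nlinarith
  | arr c j ihc ihj =>
    intro d ρ hρ hok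
    obtain ⟨m1, t1, e1, v1, f1, c1⟩ := ihc d ρ hρ hok.1
    obtain ⟨m2, t2, e2, v2, f2, c2⟩ := ihj (d + 1) { ρ with mem := m1 }
      (hρ.congr fun a ha => f1 a fun k _ => ha k) hok.2.1
    have v1' : m2 (tmp d) = c.val s := by
      rw [f2 _ fun k hk => by unfold tmp; omega]; exact v1
    obtain ⟨m3, t3, e3, v3, f3, c3⟩ := exec_addrProg O (L := L) hb.ten_le d { ρ with mem := m2 }
      (by simp only [v1', v2]; exact hok.2.2)
    simp only [v1', v2] at v3
    have v4 : m3 (cellAddr (c.val s) (j.val s)) = s.arr (c.val s) (j.val s) := by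
      have ht : ∀ k, cellAddr (c.val s) (j.val s) ≠ tmp k := fun k => by
        unfold cellAddr tmp; omega
      rw [f3 _ (ht _) (ht _)]
      simp only
      rw [f2 _ fun k _ => ht k]
      simp only
      rw [f1 _ fun k _ => ht k, hρ.arr]
    obtain ⟨t4, e4, c4⟩ := exec_arith O (L := L) .add (.dir (tmp d)) (.ind (tmp d)) (.const 0)
      { ρ with mem := m3 } trivial
      (by simp only [Operand.Small, v3, v4]; exact ⟨cellAddr_lt hb.ten_le hok.2.2, hb.arr _ _⟩)
      trivial
    refine ⟨_, _, .seq e1 (.seq e2 (.seq e3 e4)), ?_, ?_, ?_⟩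
    · simp [Dest.addr, ArithOp.apply, Operand.value, v3, v4]
    · intro a ha
      simp only [Dest.addr]
      rw [Function.update_of_ne (ha d le_rfl), f3 _ (ha d le_rfl) (ha _ (Nat.le_succ d))]
      simp only
      rw [f2 _ fun k hk => ha k (by omega)]
      exact f1 _ ha
    · simp only [Operand.wt, Dest.wt, b0] at c4
      simp only [cost]; nlinarith
  | op o a b iha ihb =>
    intro d ρ hρ hok
    have hoa : a.Ok L s := by cases o <;> exact hok.1
    have hob : b.Ok L s := by cases o <;> first | exact hok.2.1 | exact hok.2
    obtain ⟨m1, t1, e1, v1, f1, c1⟩ := iha d ρ hρ hoa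
    obtain ⟨m2, t2, e2, v2, f2, c2⟩ := ihb (d + 1) { ρ with mem := m1 }
      (hρ.congr fun a ha => f1 a fun k _ => ha k) hob
    have v1' : m2 (tmp d) = a.val s := by
      rw [f2 _ fun k hk => by unfold tmp; omega]; exact v1
    obtain ⟨t3, e3, c3⟩ := exec_arith O (L := L) o (.dir (tmp d)) (.dir (tmp d))
      (.dir (tmp (d + 1))) { ρ with mem := m2 } trivial
      (by simp only [Operand.Small, v1']; exact hoa.val_lt hb)
      (by simp only [Operand.Small, v2]; exact hob.val_lt hb)
    refine ⟨_, _, .seq e1 (.seq e2 e3), ?_, ?_, ?_⟩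
    · simp [Dest.addr, Operand.value, v1', v2, val]
    · intro x hx
      simp only [Dest.addr]
      rw [Function.update_of_ne (hx d le_rfl), f2 _ fun k hk => hx k (by omega)]
      exact f1 _ hx
    · simp only [Operand.wt, Dest.wt] at c3
      simp only [cost]; nlinarith

theorem oracleFree_addrProg (d : ℕ) : (addrProg d).OracleFree := by
  simp [addrProg, RamProg.OracleFree]

theorem oracleFree_compile (e : Ex) : ∀ d, (e.compile d).OracleFree := by
  induction e <;> intro d <;> simp_all [compile, RamProg.OracleFree, oracleFree_addrProg]

end Ex

/-- The components of a configuration. -/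
inductive Loc where
  | reg (i : ℕ)
  | env
  | arr
  | inp
  | out
  | qry
  | ans

/-- The configurations have the same value of a component. -/
def Loc.Agree (s s' : MState) : Loc → Prop
  | reg i => s'.reg i = s.reg i
  | env => s'.env = s.env
  | arr => s'.arr = s.arr
  | inp => s'.inp = s.inp
  | out => s'.out = s.out
  | qry => s'.qry = s.qry
  | ans => s'.ans = s.ans

namespace MState

def setReg (s : MState) (i v : ℕ) : MState := { s with reg := Function.update s.reg i v }
def setEnv (s : MState) (x v : ℕ) : MState := { s with env := Function.update s.env x v }
def setArr (s : MState) (c j v : ℕ) : MState :=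
  { s with arr := fun c' j' => if c' = c ∧ j' = j then v else s.arr c' j' }

variable (s : MState) (i j c v x : ℕ)
theorem setReg_reg : (s.setReg i v).reg j = if j = i then v else s.reg j := by
  simp [setReg, Function.update_apply]
@[simp] theorem setReg_env : (s.setReg i v).env = s.env := rfl
@[simp] theorem setReg_arr : (s.setReg i v).arr = s.arr := rfl
@[simp] theorem setReg_inp : (s.setReg i v).inp = s.inp := rfl
@[simp] theorem setReg_out : (s.setReg i v).out = s.out := rfl
@[simp] theorem setReg_qry : (s.setReg i v).qry = s.qry := rfl
@[simp] theorem setReg_ans : (s.setReg i v).ans = s.ans := rfl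
@[simp] theorem setEnv_env : (s.setEnv x v).env = Function.update s.env x v := rfl
@[simp] theorem setEnv_reg : (s.setEnv x v).reg = s.reg := rfl
@[simp] theorem setEnv_arr : (s.setEnv x v).arr = s.arr := rfl
@[simp] theorem setEnv_inp : (s.setEnv x v).inp = s.inp := rfl
@[simp] theorem setEnv_out : (s.setEnv x v).out = s.out := rfl
@[simp] theorem setEnv_qry : (s.setEnv x v).qry = s.qry := rfl
@[simp] theorem setEnv_ans : (s.setEnv x v).ans = s.ans := rfl
theorem setArr_arr (c' j' : ℕ) : (s.setArr c j v).arr c' j' =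
  if c' = c ∧ j' = j then v else s.arr c' j' := rfl
@[simp] theorem setArr_reg : (s.setArr c j v).reg = s.reg := rfl
@[simp] theorem setArr_env : (s.setArr c j v).env = s.env := rfl
@[simp] theorem setArr_inp : (s.setArr c j v).inp = s.inp := rfl
@[simp] theorem setArr_out : (s.setArr c j v).out = s.out := rfl
@[simp] theorem setArr_qry : (s.setArr c j v).qry = s.qry := rfl
@[simp] theorem setArr_ans : (s.setArr c j v).ans = s.ans := rfl

end MState

/-- Programs of the structured language. -/
inductive Cmd where
  | skip
  | set (i : ℕ) (e : Ex)
  | setv (x : ℕ) (e : Ex)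
  | seta (c j e : Ex)
  | read (i : ℕ)
  | recv (i : ℕ)
  | write (e : Ex)
  | send (e : Ex)
  | ask
  | seq (P Q : Cmd)
  | ite (e : Ex) (P Q : Cmd)
  | loop (e : Ex) (P : Cmd)

/-! ### Commands: compilation, cost bounds and frames -/

namespace Cmd

infixr:60 ";;" => Cmd.seq

/-- The machine tests an operand and not an expression, so the condition of a loop is evaluated into
`tmp 0` once before the loop and again at the end of each round. -/
def compile : Cmd → RamProg
  | skip => .skip
  | set i e => .seq (e.compile 0) (.arith .add (.dir (4 * i)) (.dir (tmp 0)) (.const 0))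
  | setv x e => .seq (e.compile 0) (.arith .add (.dir (4 * x + 1)) (.dir (tmp 0)) (.const 0))
  | seta c j e => .seq (c.compile 0) <| .seq (j.compile 1) <| .seq (e.compile 2) <|
      .seq (Ex.addrProg 0) <| .arith .add (.ind (tmp 0)) (.dir (tmp 2)) (.const 0)
  | read i => .read (.dir (4 * i))
  | recv i => .recv (.dir (4 * i))
  | write e => .seq (e.compile 0) (.write (.dir (tmp 0)))
  | send e => .seq (e.compile 0) (.send (.dir (tmp 0)))
  | ask => .ask
  | seq P Q => .seq P.compile Q.compile
  | ite e P Q => .seq (e.compile 0) (.cond (.dir (tmp 0)) P.compile Q.compile)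
  | loop e P => .seq (e.compile 0) (.loop (.dir (tmp 0)) (.seq P.compile (e.compile 0)))

/-- A bound on the cost of runs with numbers of at most `L` bits and loops of at most `L` rounds. -/
def cost : Cmd → ℕ → ℕ
  | skip, _ => 1
  | set i e, L => (e.cost 0 + bitLen (4 * i) + 10) * (L + 1)
  | setv x e, L => (e.cost 0 + bitLen (4 * x + 1) + 10) * (L + 1)
  | seta c j e, L => (c.cost 0 + j.cost 1 + e.cost 2 + Ex.addrCost 0 + 20) * (L + 1)
  | read i, L => (2 + bitLen (4 * i)) * (L + 1)
  | recv i, L => (2 + bitLen (4 * i)) * (L + 1)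
  | write e, L => (e.cost 0 + 10) * (L + 1)
  | send e, L => (e.cost 0 + 10) * (L + 1)
  | ask, _ => 1
  | seq P Q, L => P.cost L + Q.cost L
  | ite e P Q, L => (e.cost 0 + 10) * (L + 1) + P.cost L + Q.cost L
  | loop e P, L => (L + 2) * (P.cost L + (e.cost 0 + 10) * (L + 1))

/-- Every loop contributes a factor `L + 2`, and the nesting of loops is fixed by the program. -/
theorem exists_polynomial_cost_le (P : Cmd) :
    ∃ p : Polynomial ℕ, ∀ L, P.cost L ≤ p.eval L := by
  induction P with
  | skip => exact ⟨1, fun L => by simp [cost]⟩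
  | ask => exact ⟨1, fun L => by simp [cost]⟩
  | seq P Q ihP ihQ =>
    obtain ⟨p, hp⟩ := ihP
    obtain ⟨q, hq⟩ := ihQ
    exact ⟨p + q, fun L => by simpa [cost] using add_le_add (hp L) (hq L)⟩
  | ite e P Q ihP ihQ =>
    obtain ⟨p, hp⟩ := ihP
    obtain ⟨q, hq⟩ := ihQ
    refine ⟨Polynomial.C (e.cost 0 + 10) * (Polynomial.X + 1) + p + q, fun L => ?_⟩
    have := hp L; have := hq L
    simp only [cost, Polynomial.eval_add, Polynomial.eval_mul, Polynomial.eval_C,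
      Polynomial.eval_X, Polynomial.eval_one]
    omega
  | loop e P ihP =>
    obtain ⟨p, hp⟩ := ihP
    refine ⟨(Polynomial.X + Polynomial.C 2) * (p + Polynomial.C (e.cost 0 + 10) *
      (Polynomial.X + 1)), fun L => ?_⟩
    have := hp L
    simp only [cost, Polynomial.eval_add, Polynomial.eval_mul, Polynomial.eval_C,
      Polynomial.eval_X, Polynomial.eval_one]
    gcongr
  | _ =>
    simp only [cost]
    exact ⟨Polynomial.C _ * (Polynomial.X + 1), fun L => by
      simp only [Polynomial.eval_add, Polynomial.eval_mul, Polynomial.eval_C,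
        Polynomial.eval_X, Polynomial.eval_one]; exact le_rfl⟩

/-- The program does not use the oracle. -/
def OracleFree : Cmd → Prop
  | send _ => False
  | ask => False
  | recv _ => False
  | seq P Q => P.OracleFree ∧ Q.OracleFree
  | ite _ P Q => P.OracleFree ∧ Q.OracleFree
  | loop _ P => P.OracleFree
  | _ => True

theorem OracleFree.compile {P : Cmd} (h : P.OracleFree) : P.compile.OracleFree := by
  induction P <;> simp_all [OracleFree, Cmd.compile, RamProg.OracleFree, Ex.oracleFree_compile,
    Ex.oracleFree_addrProg]

/-- The program does not assign to the component. -/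
def Keeps (l : Loc) : Cmd → Prop
  | skip => True
  | set i _ => l ≠ .reg i
  | setv _ _ => l ≠ .env
  | seta _ _ _ => l ≠ .arr
  | read i => l ≠ .reg i ∧ l ≠ .inp
  | recv i => l ≠ .reg i ∧ l ≠ .ans
  | write _ => l ≠ .out
  | send _ => l ≠ .qry
  | ask => l ≠ .qry ∧ l ≠ .ans
  | seq P Q => P.Keeps l ∧ Q.Keeps l
  | ite _ P Q => P.Keeps l ∧ Q.Keeps l
  | loop _ P => P.Keeps l

/-- Components to which the program does not assign are the same in both configurations. -/
def Frame (P : Cmd) (s s' : MState) : Prop := ∀ l, P.Keeps l → l.Agree s s'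

end Cmd

theorem Loc.Agree.refl (l : Loc) (s : MState) : l.Agree s s := by cases l <;> rfl

theorem Loc.Agree.trans {l : Loc} {s s' s'' : MState} (h : l.Agree s s') (h' : l.Agree s' s'') :
    l.Agree s s'' := by
  cases l <;> exact Eq.trans h' h

namespace Cmd.Frame
variable {P : Cmd} {s s' : MState} (h : P.Frame s s')
include h
theorem reg (i : ℕ) (hk : P.Keeps (.reg i)) : s'.reg i = s.reg i := h _ hk
theorem arr (hk : P.Keeps .arr) : s'.arr = s.arr := h _ hk
theorem inp (hk : P.Keeps .inp) : s'.inp = s.inp := h _ hk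
theorem out (hk : P.Keeps .out) : s'.out = s.out := h _ hk
theorem qry (hk : P.Keeps .qry) : s'.qry = s.qry := h _ hk
end Cmd.Frame

theorem Cmd.Frame.refl (P : Cmd) (s : MState) : P.Frame s s := fun l _ => .refl l s

theorem Cmd.Frame.trans {P : Cmd} {s s' s'' : MState} (h : P.Frame s s') (h' : P.Frame s' s'') :
    P.Frame s s'' := fun l hl => (h l hl).trans (h' l hl)

/-- The machine configuration represents `s`. -/
structure Represents (ρ : RamState) (s : MState) : Prop where
  mem : MemRep ρ.mem s
  inp : ρ.inp = s.inp
  out : ρ.out = s.out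
  qry : ρ.qry = s.qry
  ans : ρ.ans = s.ans

/-- Started in a configuration `s` all whose numbers have at most `L` bits, the program halts in
such a configuration within its cost bound, and the result satisfies `Q`. -/
def WP (O : List ℕ → List ℕ) (L : ℕ) (P : Cmd) (s : MState) (Q : MState → Prop) : Prop :=
  Bdd L s → ∀ ρ, Represents ρ s → ∃ s' ρ' t, RamExec O P.compile ρ ρ' t ∧ Represents ρ' s' ∧ Bdd L s' ∧
    t ≤ P.cost L ∧ P.Frame s s' ∧ Q s'

/-! ### Rules of the program logic -/

namespace WP

variable {O : List ℕ → List ℕ} {L : ℕ} {P P' : Cmd} {s : MState} {Q R : MState → Prop} {e : Ex}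

theorem of_bdd (h : Bdd L s → WP O L P s Q) : WP O L P s Q := fun hb => h hb hb

theorem mono (h : WP O L P s Q) (hQ : ∀ s', Bdd L s' → P.Frame s s' → Q s' → R s') :
    WP O L P s R := by
  intro hb ρ hρ
  obtain ⟨s', ρ', t, h1, h2, h3, h4, h5, h6⟩ := h hb ρ hρ
  exact ⟨s', ρ', t, h1, h2, h3, h4, h5, hQ _ h3 h5 h6⟩

theorem skip (h : Q s) : WP O L .skip s Q := fun hb ρ hρ =>
  ⟨s, ρ, 1, .skip ρ, hρ, hb, le_rfl, .refl _ _, h⟩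

theorem seq (h : WP O L P s fun s' => WP O L P' s' Q) : WP O L (P ;; P') s Q := by
  intro hb ρ hρ
  obtain ⟨s1, ρ1, t1, h1, h2, h3, h4, h5, h6⟩ := h hb ρ hρ
  obtain ⟨s2, ρ2, t2, g1, g2, g3, g4, g5, g6⟩ := h6 h3 ρ1 h2
  exact ⟨s2, ρ2, _, .seq h1 g1, g2, g3, add_le_add h4 g4,
    fun l hl => (h5 l hl.1).trans (g5 l hl.2), g6⟩

theorem bitLen_zero : bitLen 0 = 1 := by decide
theorem bitLen_tmp : bitLen (tmp 0) = 3 := by decide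

theorem ite (hok : Bdd L s → e.Ok L s) (h1 : e.val s ≠ 0 → WP O L P s Q)
    (h0 : e.val s = 0 → WP O L P' s Q) : WP O L (.ite e P P') s Q := by
  intro hb ρ hρ
  obtain ⟨m, t, x1, v1, f1, c1⟩ := e.compile_exec O hb 0 ρ hρ.mem (hok hb)
  have hρ' : Represents { ρ with mem := m } s :=
    ⟨hρ.mem.congr fun a ha => f1 a fun k _ => ha k, hρ.inp, hρ.out, hρ.qry, hρ.ans⟩
  have hlt := (hok hb).val_lt hb
  have hc := Operand.cost_le (a := .dir (tmp 0)) (L := L) (m := m) (by rw [Operand.Small, v1]; exact hlt)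
  simp only [Operand.wt, bitLen_tmp] at hc
  by_cases hv : e.val s = 0
  · obtain ⟨s', ρ', u, g1, g2, g3, g4, g5, g6⟩ := h0 hv hb _ hρ'
    refine ⟨s', ρ', _, .seq x1 (.cond_false (by simp [Operand.value, v1, hv]) g1), g2, g3, ?_,
      fun l hl => g5 l hl.2, g6⟩
    simp only [Cmd.cost]
    nlinarith
  · obtain ⟨s', ρ', u, g1, g2, g3, g4, g5, g6⟩ := h1 hv hb _ hρ'
    refine ⟨s', ρ', _, .seq x1 (.cond_true (by simp [Operand.value, v1, hv]) g1), g2, g3, ?_,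
      fun l hl => g5 l hl.1, g6⟩
    simp only [Cmd.cost]
    nlinarith

/-- The index `k` of the invariant is a rank that decreases strictly in each round. Starting at most
at `L`, it gives both termination and the bound on the number of rounds that `Cmd.cost` presupposes.
-/
theorem loop {I : ℕ → MState → Prop} {k : ℕ} (hk : k ≤ L) (h0 : I k s)
    (hok : ∀ k s', Bdd L s' → P.Frame s s' → I k s' → e.Ok L s')
    (hstep : ∀ k s', P.Frame s s' → I k s' → e.val s' ≠ 0 →
      WP O L P s' fun s'' => ∃ k' < k, I k' s'')
    (hQ : ∀ k s', P.Frame s s' → I k s' → e.val s' = 0 → Q s') :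
    WP O L (.loop e P) s Q := by
  intro hb ρ hρ
  obtain ⟨m, t, x1, v1, f1, c1⟩ := e.compile_exec O hb 0 ρ hρ.mem (hok k s hb (.refl _ _) h0)
  -- The induction must also carry the frame relative to the initial configuration and the fact that
  -- `tmp 0` holds the current value of the condition.
  have key : ∀ (k : ℕ) (s' : MState) (ρ : RamState), P.Frame s s' → I k s' → Bdd L s' → Represents ρ s' →
      ρ.mem (tmp 0) = e.val s' → ∃ s'' ρ' t,
        RamExec O (.loop (.dir (tmp 0)) (.seq P.compile (e.compile 0))) ρ ρ' t ∧ Represents ρ' s'' ∧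
        Bdd L s'' ∧ t ≤ (k + 1) * (P.cost L + (e.cost 0 + 10) * (L + 1)) ∧ P.Frame s s'' ∧
        Q s'' := by
    intro k
    induction k using Nat.strong_induction_on with
    | _ k ih =>
      intro s' ρ hF hI hb hρ hv
      have hlt := (hok k s' hb hF hI).val_lt hb
      have hc := Operand.cost_le (a := .dir (tmp 0)) (L := L) (m := ρ.mem)
        (by rw [Operand.Small, hv]; exact hlt)
      simp only [Operand.wt, bitLen_tmp] at hc
      by_cases hz : e.val s' = 0
      · refine ⟨s', ρ, _, .loop_done (by simp [Operand.value, hv, hz]), hρ, hb, ?_, hF,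
          hQ k s' hF hI hz⟩
        nlinarith
      · obtain ⟨s1, ρ1, t1, g1, g2, g3, g4, g5, k', hk', hI'⟩ := hstep k s' hF hI hz hb ρ hρ
        have hF' := hF.trans g5
        obtain ⟨m, t, x1, v1, f1, c1⟩ := e.compile_exec O g3 0 ρ1 g2.mem (hok k' s1 g3 hF' hI')
        have hρ' : Represents { ρ1 with mem := m } s1 :=
          ⟨g2.mem.congr fun a ha => f1 a fun k _ => ha k, g2.inp, g2.out, g2.qry, g2.ans⟩
        obtain ⟨s2, ρ2, t2, y1, y2, y3, y4, y5, y6⟩ := ih k' hk' s1 _ hF' hI' g3 hρ' v1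
        refine ⟨s2, ρ2, _, .loop_step (by simp [Operand.value, hv, hz]) (.seq g1 x1) y1, y2, y3,
          ?_, y5, y6⟩
        have : (k' + 1) * (P.cost L + (e.cost 0 + 10) * (L + 1)) ≤
          k * (P.cost L + (e.cost 0 + 10) * (L + 1)) := Nat.mul_le_mul_right _ hk'
        nlinarith
  have hρ' : Represents { ρ with mem := m } s :=
    ⟨hρ.mem.congr fun a ha => f1 a fun k _ => ha k, hρ.inp, hρ.out, hρ.qry, hρ.ans⟩
  obtain ⟨s2, ρ2, t2, y1, y2, y3, y4, y5, y6⟩ := key k s _ (.refl _ _) h0 hb hρ' v1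
  refine ⟨s2, ρ2, _, .seq x1 y1, y2, y3, ?_, y5, y6⟩
  have : (k + 1) * (P.cost L + (e.cost 0 + 10) * (L + 1)) ≤
    (L + 1) * (P.cost L + (e.cost 0 + 10) * (L + 1)) := Nat.mul_le_mul_right _ (by omega)
  simp only [Cmd.cost]
  nlinarith

theorem set {i : ℕ} (hok : Bdd L s → e.Ok L s) (hQ : Q (s.setReg i (e.val s))) :
    WP O L (.set i e) s Q := by
  intro hb ρ hρ
  obtain ⟨m, t, x1, v1, f1, c1⟩ := e.compile_exec O hb 0 ρ hρ.mem (hok hb)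
  have hlt := (hok hb).val_lt hb
  obtain ⟨m2, t2, x2, v2, f2, c2⟩ := exec_arith_dir O (L := L) .add (4 * i) (.dir (tmp 0))
    (.const 0) { ρ with mem := m } (by simp only [Operand.Small, v1, hlt]) trivial
  simp only [ArithOp.apply, Operand.value, v1, add_zero] at v2
  have hm := hρ.mem.congr (m' := m) fun a ha => f1 a fun k _ => ha k
  refine ⟨s.setReg i (e.val s), _, _, .seq x1 x2, ⟨⟨?_, ?_, ?_⟩, hρ.inp, hρ.out, hρ.qry, hρ.ans⟩, ?_, ?_, ?_, hQ⟩
  · intro j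
    rw [MState.setReg_reg]
    split_ifs with h
    · rw [h]; exact v2
    · exact (f2 _ (by omega)).trans (hm.reg j)
  · intro j
    exact (f2 _ (by omega)).trans (hm.env j)
  · intro c j
    exact (f2 _ (by unfold cellAddr; omega)).trans (hm.arr c j)
  · refine ⟨hb.ten_le, fun j => ?_, hb.env, hb.arr, hb.inp, hb.ans⟩
    rw [MState.setReg_reg]
    split_ifs
    · exact hlt
    · exact hb.reg j
  · simp only [Operand.wt, bitLen_tmp, bitLen_zero] at c2
    simp only [Cmd.cost]
    nlinarith
  · rintro (j | _ | _ | _ | _ | _ | _) hl <;> simp_all [Cmd.Keeps, Loc.Agree, MState.setReg_reg]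

theorem setv {x : ℕ} (hok : Bdd L s → e.Ok L s) (hQ : Q (s.setEnv x (e.val s))) :
    WP O L (.setv x e) s Q := by
  intro hb ρ hρ
  obtain ⟨m, t, x1, v1, f1, c1⟩ := e.compile_exec O hb 0 ρ hρ.mem (hok hb)
  have hlt := (hok hb).val_lt hb
  obtain ⟨m2, t2, x2, v2, f2, c2⟩ := exec_arith_dir O (L := L) .add (4 * x + 1) (.dir (tmp 0))
    (.const 0) { ρ with mem := m } (by simp only [Operand.Small, v1, hlt]) trivial
  simp only [ArithOp.apply, Operand.value, v1, add_zero] at v2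
  have hm := hρ.mem.congr (m' := m) fun a ha => f1 a fun k _ => ha k
  refine ⟨s.setEnv x (e.val s), _, _, .seq x1 x2, ⟨⟨?_, ?_, ?_⟩, hρ.inp, hρ.out, hρ.qry, hρ.ans⟩, ?_, ?_, ?_, hQ⟩
  · intro j
    exact (f2 _ (by omega)).trans (hm.reg j)
  · intro j
    rw [MState.setEnv_env, Function.update_apply]
    split_ifs with h
    · rw [h]; exact v2
    · exact (f2 _ (by omega)).trans (hm.env j)
  · intro c j
    exact (f2 _ (by unfold cellAddr; omega)).trans (hm.arr c j)
  · refine ⟨hb.ten_le, hb.reg, fun j => ?_, hb.arr, hb.inp, hb.ans⟩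
    rw [MState.setEnv_env, Function.update_apply]
    split_ifs
    · exact hlt
    · exact hb.env j
  · simp only [Operand.wt, bitLen_tmp, bitLen_zero] at c2
    simp only [Cmd.cost]
    nlinarith
  · rintro (j | _ | _ | _ | _ | _ | _) hl <;> simp_all [Cmd.Keeps, Loc.Agree]

theorem seta {c j : Ex} (hok : Bdd L s → c.Ok L s ∧ j.Ok L s ∧ e.Ok L s ∧ c.val s + j.val s ≤ L)
    (hQ : Q (s.setArr (c.val s) (j.val s) (e.val s))) : WP O L (.seta c j e) s Q := by
  intro hb ρ hρ
  obtain ⟨okc, okj, oke, hcj⟩ := hok hb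
  obtain ⟨m, t, x1, v1, f1, c1⟩ := c.compile_exec O hb 0 ρ hρ.mem okc
  have hm := hρ.mem.congr (m' := m) fun a ha => f1 a fun k _ => ha k
  obtain ⟨m2, t2, x2, v2, f2, c2⟩ := j.compile_exec O hb 1 { ρ with mem := m } hm okj
  have hm2 := hm.congr (m' := m2) fun a ha => f2 a fun k _ => ha k
  obtain ⟨m3, t3, x3, v3, f3, c3⟩ := e.compile_exec O hb 2 { ρ with mem := m2 } hm2 oke
  have hm3 := hm2.congr (m' := m3) fun a ha => f3 a fun k _ => ha k
  have v2' : m3 (tmp 1) = j.val s := (f3 _ fun k hk => by unfold tmp; omega).trans v2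
  have v1' : m3 (tmp 0) = c.val s := (f3 _ fun k hk => by unfold tmp; omega).trans
    ((f2 _ fun k hk => by unfold tmp; omega).trans v1)
  obtain ⟨m4, t4, x4, v4, f4, c4⟩ := Ex.exec_addrProg O (L := L) hb.ten_le 0 { ρ with mem := m3 }
    (by simp only [v1', v2']; exact hcj)
  have hm4 := hm3.congr (m' := m4) fun a ha => f4 a (ha 0) (ha 1)
  have v3' : m4 (tmp 2) = e.val s := (f4 _ (by decide) (by decide)).trans v3
  simp only [v1', v2'] at v4
  have hlt := oke.val_lt hb
  obtain ⟨t5, x5, c5⟩ := exec_arith O (L := L) .add (.ind (tmp 0)) (.dir (tmp 2)) (.const 0)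
    { ρ with mem := m4 } (by simp only [Dest.Small, v4]; exact Ex.cellAddr_lt hb.ten_le hcj)
    (by simp only [Operand.Small, v3', hlt]) trivial
  simp only [RamState.store, Dest.addr, ArithOp.apply, Operand.value, v3', v4, add_zero] at x5
  refine ⟨s.setArr (c.val s) (j.val s) (e.val s), _, _, .seq x1 (.seq x2 (.seq x3 (.seq x4 x5))),
    ⟨⟨?_, ?_, ?_⟩, hρ.inp, hρ.out, hρ.qry, hρ.ans⟩, ?_, ?_, ?_, hQ⟩
  · intro i
    exact (Function.update_of_ne (by unfold cellAddr; omega) ..).trans (hm4.reg i)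
  · intro i
    exact (Function.update_of_ne (by unfold cellAddr; omega) ..).trans (hm4.env i)
  · intro c' j'
    rw [MState.setArr_arr]
    simp only [Function.update_apply]
    split_ifs with h h' h'
    · rfl
    · exact absurd (cellAddr_inj h) h'
    · exact absurd (by rw [h'.1, h'.2]) h
    · exact hm4.arr c' j'
  · refine ⟨hb.ten_le, hb.reg, hb.env, fun c' j' => ?_, hb.inp, hb.ans⟩
    rw [MState.setArr_arr]
    split_ifs
    · exact hlt
    · exact hb.arr _ _
  · have : bitLen (tmp 2) = 5 := by decide
    simp only [Operand.wt, Dest.wt, bitLen_tmp, bitLen_zero, this] at c5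
    simp only [Cmd.cost]
    nlinarith
  · rintro (j | _ | _ | _ | _ | _ | _) hl <;> simp_all [Cmd.Keeps, Loc.Agree]

theorem MemRep.setReg {m : ℕ → ℕ} (h : MemRep m s) (i v : ℕ) :
    MemRep (Function.update m (4 * i) v) (s.setReg i v) where
  reg j := by
    rw [MState.setReg_reg, Function.update_apply, h.reg]
    exact if_congr ⟨fun h => by omega, fun h => by omega⟩ rfl rfl
  env j := (Function.update_of_ne (by omega) ..).trans (h.env j)
  arr c j := (Function.update_of_ne (by unfold cellAddr; omega) ..).trans (h.arr c j)

theorem headD_lt {l : List ℕ} (h : ∀ x ∈ l, x < 2 ^ L) : l.headD 0 < 2 ^ L := by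
  cases l with
  | nil => simp
  | cons a l => exact h a (by simp)

theorem bdd_setReg (hb : Bdd L s) {i v : ℕ} (hv : v < 2 ^ L) : Bdd L (s.setReg i v) := by
  refine ⟨hb.ten_le, fun j => ?_, hb.env, hb.arr, hb.inp, hb.ans⟩
  rw [MState.setReg_reg]
  split_ifs
  · exact hv
  · exact hb.reg j

theorem read {i : ℕ} (hQ : Q ({ s with inp := s.inp.tail }.setReg i (s.inp.headD 0))) :
    WP O L (.read i) s Q := by
  rintro hb ⟨m, inp, out, qry, ans⟩ ⟨hm, h1, h2, h3, h4⟩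
  simp only at hm h1 h2 h3 h4
  subst h1 h2 h3 h4
  have hlt := headD_lt hb.inp
  refine ⟨{ s with inp := s.inp.tail }.setReg i (s.inp.headD 0), _, _, .read (.dir (4 * i)) _,
    ⟨?_, rfl, rfl, rfl, rfl⟩, bdd_setReg (s := { s with inp := s.inp.tail }) ?_ hlt, ?_, ?_, hQ⟩
  · exact MemRep.setReg (s := { s with inp := s.inp.tail }) ⟨hm.reg, hm.env, hm.arr⟩ i _
  · exact ⟨hb.ten_le, hb.reg, hb.env, hb.arr, fun x hx => hb.inp x (List.mem_of_mem_tail hx), hb.ans⟩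
  · have := bitLen_le hlt
    simp only [Dest.cost, Cmd.cost]
    nlinarith
  · rintro (j | _ | _ | _ | _ | _ | _) hl <;> simp_all [Cmd.Keeps, Loc.Agree, MState.setReg_reg]

theorem recv {i : ℕ} (hQ : Q ({ s with ans := s.ans.tail }.setReg i (s.ans.headD 0))) :
    WP O L (.recv i) s Q := by
  rintro hb ⟨m, inp, out, qry, ans⟩ ⟨hm, h1, h2, h3, h4⟩
  simp only at hm h1 h2 h3 h4
  subst h1 h2 h3 h4
  have hlt := headD_lt hb.ans
  refine ⟨{ s with ans := s.ans.tail }.setReg i (s.ans.headD 0), _, _, .recv (.dir (4 * i)) _,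
    ⟨?_, rfl, rfl, rfl, rfl⟩, bdd_setReg (s := { s with ans := s.ans.tail }) ?_ hlt, ?_, ?_, hQ⟩
  · exact MemRep.setReg (s := { s with ans := s.ans.tail }) ⟨hm.reg, hm.env, hm.arr⟩ i _
  · exact ⟨hb.ten_le, hb.reg, hb.env, hb.arr, hb.inp,
      fun x hx => hb.ans x (List.mem_of_mem_tail hx)⟩
  · have := bitLen_le hlt
    simp only [Dest.cost, Cmd.cost]
    nlinarith
  · rintro (j | _ | _ | _ | _ | _ | _) hl <;> simp_all [Cmd.Keeps, Loc.Agree, MState.setReg_reg]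

theorem write (hok : Bdd L s → e.Ok L s) (hQ : Q { s with out := s.out ++ [e.val s] }) :
    WP O L (.write e) s Q := by
  intro hb ρ hρ
  obtain ⟨m, t, x1, v1, f1, c1⟩ := e.compile_exec O hb 0 ρ hρ.mem (hok hb)
  have hlt := (hok hb).val_lt hb
  have hm := hρ.mem.congr (m' := m) fun a ha => f1 a fun k _ => ha k
  have hc := Operand.cost_le (a := .dir (tmp 0)) (L := L) (m := m)
    (by rw [Operand.Small, v1]; exact hlt)
  simp only [Operand.wt, bitLen_tmp] at hc
  refine ⟨{ s with out := s.out ++ [e.val s] }, _, _, .seq x1 (.write (.dir (tmp 0)) _), ⟨⟨hm.reg, hm.env, hm.arr⟩, hρ.inp,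
    by simp [Operand.value, v1, hρ.out], hρ.qry, hρ.ans⟩,
    ⟨hb.ten_le, hb.reg, hb.env, hb.arr, hb.inp, hb.ans⟩, ?_, ?_, hQ⟩
  · simp only [Cmd.cost]
    nlinarith
  · rintro (j | _ | _ | _ | _ | _ | _) hl <;> simp_all [Cmd.Keeps, Loc.Agree]

theorem send (hok : Bdd L s → e.Ok L s) (hQ : Q { s with qry := s.qry ++ [e.val s] }) :
    WP O L (.send e) s Q := by
  intro hb ρ hρ
  obtain ⟨m, t, x1, v1, f1, c1⟩ := e.compile_exec O hb 0 ρ hρ.mem (hok hb)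
  have hlt := (hok hb).val_lt hb
  have hm := hρ.mem.congr (m' := m) fun a ha => f1 a fun k _ => ha k
  have hc := Operand.cost_le (a := .dir (tmp 0)) (L := L) (m := m)
    (by rw [Operand.Small, v1]; exact hlt)
  simp only [Operand.wt, bitLen_tmp] at hc
  refine ⟨{ s with qry := s.qry ++ [e.val s] }, _, _, .seq x1 (.send (.dir (tmp 0)) _), ⟨⟨hm.reg, hm.env, hm.arr⟩, hρ.inp, hρ.out,
    by simp [Operand.value, v1, hρ.qry], hρ.ans⟩,
    ⟨hb.ten_le, hb.reg, hb.env, hb.arr, hb.inp, hb.ans⟩, ?_, ?_, hQ⟩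
  · simp only [Cmd.cost]
    nlinarith
  · rintro (j | _ | _ | _ | _ | _ | _) hl <;> simp_all [Cmd.Keeps, Loc.Agree]

theorem ask (ho : ∀ x ∈ O s.qry, x < 2 ^ L) (hQ : Q { s with qry := [], ans := O s.qry }) :
    WP O L .ask s Q := by
  intro hb ρ hρ
  refine ⟨{ s with qry := [], ans := O s.qry }, _, _, .ask ρ, ⟨⟨hρ.mem.reg, hρ.mem.env, hρ.mem.arr⟩, hρ.inp, hρ.out, rfl,
    by simp [hρ.qry]⟩, ⟨hb.ten_le, hb.reg, hb.env, hb.arr, hb.inp, ho⟩, le_rfl, ?_, hQ⟩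
  rintro (j | _ | _ | _ | _ | _ | _) hl <;> simp_all [Cmd.Keeps, Loc.Agree]

end WP

/-- `for i = 0, …, e - 1 do P` -/
def Cmd.for (i : ℕ) (e : Ex) (P : Cmd) : Cmd :=
  .set i 0 ;; .loop (e - .reg i) (P ;; .set i (.reg i + 1))

/-- The bound `e` is evaluated anew in each round, hence the requirement that it keeps the value
`n`. The body has to preserve the counter, and the invariant is asked for after the increment. -/
theorem WP.for {O : List ℕ → List ℕ} {L : ℕ} {P : Cmd} {s : MState} {Q : MState → Prop} {e : Ex}
    {i : ℕ} (n : ℕ) (I : ℕ → MState → Prop) (hn : n ≤ L) (h0 : I 0 (s.setReg i 0))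
    (he : ∀ k ≤ n, ∀ s', Bdd L s' → (Cmd.for i e P).Frame s s' → I k s' → e.Ok L s' ∧ e.val s' = n)
    (hstep : ∀ k < n, ∀ s', (Cmd.for i e P).Frame s s' → I k s' → s'.reg i = k →
      WP O L P s' fun s'' => s''.reg i = k ∧ I (k + 1) (s''.setReg i (k + 1)))
    (hQ : ∀ s', (Cmd.for i e P).Frame s s' → I n s' → Q s') : WP O L (.for i e P) s Q := by
  refine WP.of_bdd fun hb => ?_
  have hL : L < 2 ^ L := Nat.lt_two_pow_self
  have h1 : 1 < 2 ^ L := Nat.one_lt_two_pow (by have := hb.ten_le; omega)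
  have hfr : ∀ s', (P ;; .set i (.reg i + 1)).Frame (s.setReg i 0) s' →
      (Cmd.for i e P).Frame s s' := by
    intro s' hF l hl
    simp only [Cmd.for, Cmd.Keeps] at hl
    refine Loc.Agree.trans (s' := s.setReg i 0) ?_ (hF l ⟨hl.2.1, hl.2.2⟩)
    rcases l with (j | _ | _ | _ | _ | _ | _) <;> simp_all [Loc.Agree, MState.setReg_reg]
  have hb' : Bdd L (s.setReg i 0) := bdd_setReg hb (by omega)
  refine WP.seq (WP.set (fun _ => by simp) ?_)
  refine WP.of_bdd fun hb' => ?_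
  -- The rank is the number `n - j` of remaining rounds. The size bound is put into the invariant
  -- because `he` needs it to evaluate the bound of the loop.
  refine WP.loop (k := n)
    (I := fun k s' => ∃ j ≤ n, k = n - j ∧ s'.reg i = j ∧ I j s' ∧ Bdd L s')
    hn ⟨0, by omega, rfl, by simp [MState.setReg_reg], h0, hb'⟩ ?_ ?_ ?_
  · rintro k s' hb hF ⟨j, hj, -, hr, hI, hB⟩
    exact ⟨(he j hj s' hb (hfr _ hF) hI).1, trivial⟩
  · rintro k s' hF ⟨j, hj, rfl, hr, hI, hB⟩ hv
    simp only [Ex.val_sub, Ex.val_reg, hr, (he j hj s' hB (hfr _ hF) hI).2] at hv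
    refine WP.seq ((hstep j (by omega) s' (hfr _ hF) hI hr).mono ?_)
    rintro s'' hb'' hF'' ⟨hr'', hI''⟩
    refine WP.set (fun _ => by simp [hr'']; omega) ⟨n - (j + 1), by omega, j + 1, by omega, rfl, ?_, ?_, ?_⟩
    · simp [MState.setReg_reg, hr'']
    · simpa [hr''] using hI''
    · exact bdd_setReg hb'' (by simp [hr'']; omega)
  · rintro k s' hF ⟨j, hj, rfl, hr, hI, hB⟩ hv
    simp only [Ex.val_sub, Ex.val_reg, hr, (he j hj s' hB (hfr _ hF) hI).2] at hv
    obtain rfl : j = n := by omega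
    exact hQ s' (hfr _ hF) hI

/-- Programs for the structured language give programs for the machine. -/
theorem WP.exec {O : List ℕ → List ℕ} {L : ℕ} {P : Cmd} {x : List ℕ} {Q : MState → Prop}
    (hL : 10 ≤ L) (hx : ∀ a ∈ x, a < 2 ^ L)
    (h : WP O L P ⟨fun _ => 0, fun _ => 0, fun _ _ => 0, x, [], [], []⟩ Q) :
    ∃ s ρ t, RamExec O P.compile (RamState.start x) ρ t ∧ t ≤ P.cost L ∧ ρ.out = s.out ∧ Q s := by
  obtain ⟨s, ρ, t, h1, h2, h3, h4, h5, h6⟩ := h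
    ⟨hL, fun _ => by positivity, fun _ => by positivity, fun _ _ => by positivity, hx, by simp⟩
    (RamState.start x) ⟨⟨fun _ => rfl, fun _ => rfl, fun _ _ => rfl⟩, rfl, rfl, rfl, rfl⟩
  exact ⟨s, ρ, t, h1, h4, h2.out, h6⟩

/-! ### Weighted model counting -/

section WeightedCount

variable {α : Type*} [DecidableEq α]

/-- The sum of `F E` over the subsets `E` of `D`, weighted by the product of the weights `a` of the
members and `b` of the other elements. -/
def wsum (D : Finset α) (a b : α → ℕ) (F : Finset α → ℕ) : ℕ :=
  ∑ E ∈ D.powerset, ((∏ f ∈ E, a f) * ∏ f ∈ D \ E, b f) * F E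

open Classical in
/-- The weighted number of subsets of `D` that satisfy `q`. -/
noncomputable def wmc (D : Finset α) (a b : α → ℕ) (q : Finset α → Prop) : ℕ :=
  wsum D a b fun E => if q E then 1 else 0

/-- The weighted number of all subsets of `D`. -/
def wtot (D : Finset α) (a b : α → ℕ) : ℕ := ∏ f ∈ D, (a f + b f)

variable {D : Finset α} {a b : α → ℕ} {F G : Finset α → ℕ} {q r : Finset α → Prop}

@[simp] theorem wsum_empty : wsum ∅ a b F = F ∅ := by simp [wsum]

theorem wsum_insert {f : α} (hf : f ∉ D) :
    wsum (insert f D) a b F = b f * wsum D a b F + a f * wsum D a b fun E => F (insert f E) := by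
  unfold wsum
  rw [Finset.sum_powerset_insert hf, Finset.mul_sum, Finset.mul_sum]
  congr 1
  · refine Finset.sum_congr rfl fun E hE => ?_
    have hfE : f ∉ E := fun h => hf (Finset.mem_powerset.1 hE h)
    rw [Finset.insert_sdiff_of_notMem _ hfE, Finset.prod_insert (by simp [hf])]
    ring
  · refine Finset.sum_congr rfl fun E hE => ?_
    have hfE : f ∉ E := fun h => hf (Finset.mem_powerset.1 hE h)
    rw [Finset.insert_sdiff_insert, Finset.sdiff_insert_of_notMem hf, Finset.prod_insert hfE]
    ring

theorem wsum_congr (h : ∀ E ⊆ D, F E = G E) : wsum D a b F = wsum D a b G :=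
  Finset.sum_congr rfl fun E hE => by rw [h E (Finset.mem_powerset.1 hE)]

theorem wsum_mono (h : ∀ E ⊆ D, F E ≤ G E) : wsum D a b F ≤ wsum D a b G :=
  Finset.sum_le_sum fun E hE => Nat.mul_le_mul_left _ (h E (Finset.mem_powerset.1 hE))

theorem wsum_add : wsum D a b (fun E => F E + G E) = wsum D a b F + wsum D a b G := by
  simp [wsum, mul_add, Finset.sum_add_distrib]

theorem wsum_one : wsum D a b (fun _ => 1) = wtot D a b := by
  induction D using Finset.induction_on with
  | empty => simp [wtot]
  | insert f D hf ih =>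
    rw [wsum_insert hf, ih, wtot, wtot, Finset.prod_insert hf]
    ring

/-- Multiplicativity of expectation for a product measure, multiplied out so that it stays in `ℕ`.
In the induction on `D`, the new element affects at most one of the two factors, and the other
factor is common to both of its branches. -/
theorem wsum_mul (h : ∀ f, (∀ E, F (insert f E) = F E) ∨ (∀ E, G (insert f E) = G E)) :
    wsum D a b (fun E => F E * G E) * wtot D a b = wsum D a b F * wsum D a b G := by
  induction D using Finset.induction_on generalizing F G with
  | empty => simp [wtot]
  | insert f D hf ih =>
    have ht : wtot (insert f D) a b = (a f + b f) * wtot D a b := by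
      rw [wtot, Finset.prod_insert hf, wtot]
    rw [wsum_insert hf, wsum_insert hf, wsum_insert hf, ht]
    have h1 := ih h
    rcases h f with hF | hG
    · have h2 := ih (F := F) (G := fun E => G (insert f E)) fun g => (h g).imp id fun hg E => by
        rw [Finset.insert_comm, hg]
      simp only [hF]
      linear_combination (a f + b f) * b f * h1 + (a f + b f) * a f * h2
    · have h2 := ih (F := fun E => F (insert f E)) (G := G) fun g => (h g).imp (fun hg E => by
        rw [Finset.insert_comm, hg]) id
      simp only [hG]
      linear_combination (a f + b f) * b f * h1 + (a f + b f) * a f * h2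

theorem wmc_congr (h : ∀ E ⊆ D, q E ↔ r E) : wmc D a b q = wmc D a b r := by
  classical
  unfold wmc
  refine wsum_congr fun E hE => ?_
  by_cases hq : q E
  · rw [if_pos hq, if_pos ((h E hE).1 hq)]
  · rw [if_neg hq, if_neg fun hr => hq ((h E hE).2 hr)]

theorem wmc_le : wmc D a b q ≤ wtot D a b := by
  rw [← wsum_one]
  exact wsum_mono fun E _ => by split_ifs <;> simp

theorem wmc_true : wmc D a b (fun _ => True) = wtot D a b := by simp [wmc, wsum_one]
theorem wmc_false : wmc D a b (fun _ => False) = 0 := by simp [wmc, wsum]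

theorem wmc_not : wmc D a b (fun E => ¬ q E) = wtot D a b - wmc D a b q := by
  rw [← wsum_one, eq_tsub_iff_add_eq_of_le (by rw [wsum_one]; exact wmc_le), wmc, wmc, ← wsum_add]
  exact wsum_congr fun E _ => by by_cases h : q E <;> simp [h]

theorem wmc_or_add_and :
    wmc D a b (fun E => q E ∨ r E) + wmc D a b (fun E => q E ∧ r E) =
      wmc D a b q + wmc D a b r := by
  simp only [wmc, ← wsum_add]
  exact wsum_congr fun E _ => by by_cases h : q E <;> by_cases h' : r E <;> simp [h, h']

/-- No element is relevant for both properties. -/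
def SetIndep (q r : Finset α → Prop) : Prop :=
  ∀ f, (∀ E, q (insert f E) ↔ q E) ∨ (∀ E, r (insert f E) ↔ r E)

theorem wmc_and_mul (h : SetIndep q r) :
    wmc D a b (fun E => q E ∧ r E) * wtot D a b = wmc D a b q * wmc D a b r := by
  classical
  unfold wmc
  rw [← wsum_mul fun f => (h f).imp (fun hq E => by simp [hq]) (fun hr E => by simp [hr])]
  congr 1
  exact wsum_congr fun E _ => by by_cases h : q E <;> by_cases h' : r E <;> simp [h, h']

/-- The division is exact by `wmc_and_mul`; hence natural number arithmetic is enough for lifted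
inference. -/
theorem wmc_and (h : SetIndep q r) (h0 : 0 < wtot D a b) :
    wmc D a b (fun E => q E ∧ r E) = wmc D a b q * wmc D a b r / wtot D a b := by
  rw [← wmc_and_mul h, Nat.mul_div_cancel _ h0]

theorem wmc_or (h : SetIndep q r) (h0 : 0 < wtot D a b) :
    wmc D a b (fun E => q E ∨ r E) =
      wmc D a b q + wmc D a b r - wmc D a b q * wmc D a b r / wtot D a b := by
  rw [← wmc_and h h0, ← wmc_or_add_and, Nat.add_sub_cancel]

/-- Requiring f to be present replaces its factor `a f + b f` in the total weight by `a f`. -/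
theorem wmc_mem (f : α) (h0 : f ∈ D → 0 < a f + b f) :
    wmc D a b (fun E => f ∈ E) = if f ∈ D then wtot D a b / (a f + b f) * a f else 0 := by
  split_ifs with hf
  · obtain ⟨D, hf', rfl⟩ : ∃ D', f ∉ D' ∧ insert f D' = D :=
      ⟨D.erase f, by simp, Finset.insert_erase hf⟩
    rw [wmc, wsum_insert hf', wtot, Finset.prod_insert hf', Nat.mul_div_cancel_left _ (h0 hf),
      ← wtot, ← wsum_one, mul_comm _ (a f)]
    have : wmc D a b (fun E => f ∈ E) = 0 := by
      rw [wmc_congr (r := fun _ => False) fun E hE => iff_false_intro fun h => hf' (hE h), wmc_false]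
    rw [wmc] at this
    rw [this, mul_zero, zero_add]
    congr 1
    exact wsum_congr fun E _ => by simp
  · rw [wmc_congr (r := fun _ => False) fun E hE => by simpa using fun h => hf (hE h), wmc_false]

/-- The weighted count for the conjunction of the negations of pairwise independent properties. -/
theorem wmc_forall_cons {ι : Type*} (q : ι → Finset α → Prop) (i : ι) (l : List ι)
    (h : ∀ j ∈ l, SetIndep (q i) (q j)) (h0 : 0 < wtot D a b) :
    wmc D a b (fun E => ∀ j ∈ l ++ [i], ¬ q j E) =
      wmc D a b (fun E => ∀ j ∈ l, ¬ q j E) * (wtot D a b - wmc D a b (q i)) / wtot D a b := by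
  rw [← wmc_not, ← wmc_and _ h0]
  · exact wmc_congr fun E _ => by
      simp only [List.mem_append, List.mem_singleton, or_imp, forall_and, forall_eq]
  · intro f
    -- If f makes a difference for `q i`, independence makes every other `q j`, and so their
    -- conjunction, insensitive to f.
    by_cases hi : ∀ E, ¬ q i (insert f E) ↔ ¬ q i E
    · exact Or.inr hi
    · refine Or.inl fun E => forall₂_congr fun j hj => not_congr ?_
      rcases h j hj f with h | h
      · exact absurd (fun E => not_congr (h E)) hi
      · exact h E

/-- Inclusion-exclusion: the conjunction of properties in terms of their disjunctions. -/
theorem wmc_forall_eq_sum {k : ℕ} (hk : k ≠ 0) (q : Fin k → Finset α → Prop) :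
    (wmc D a b (fun E => ∀ i, q i E) : ℤ) =
      - ∑ s : Finset (Fin k) with s.Nonempty,
        (-1) ^ s.card * (wmc D a b (fun E => ∃ i ∈ s, q i E) : ℤ) := by
  classical
  have key : ∀ E, (if ∀ i, q i E then (1 : ℤ) else 0) =
      - ∑ s : Finset (Fin k) with s.Nonempty, (-1) ^ s.card *
        (if ∃ i ∈ s, q i E then 1 else 0) := by
    intro E
    have h1 : ∑ s : Finset (Fin k) with s.Nonempty, (-1 : ℤ) ^ s.card *
        (if ∃ i ∈ s, q i E then 1 else 0) =
        ∑ s : Finset (Fin k), (-1 : ℤ) ^ s.card * (if ∃ i ∈ s, q i E then 1 else 0) := by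
      refine Finset.sum_filter_of_ne fun s _ hs => ?_
      rw [Finset.nonempty_iff_ne_empty]
      rintro rfl
      simp at hs
    -- The indicator of the disjunction is 1 - ∏ (1 - [q i]). Summed over all s, the products expand
    -- ∏ (1 + (-(1 - [q i]))) = ∏ [q i].
    have h2 : ∀ s : Finset (Fin k), (-1 : ℤ) ^ s.card * (if ∃ i ∈ s, q i E then 1 else 0) =
        (-1) ^ s.card - ∏ i ∈ s, (-(1 - if q i E then 1 else 0)) := by
      intro s
      rw [Finset.prod_neg, ← mul_one_sub]
      congr 1
      split_ifs with h
      · obtain ⟨i, hi, hq⟩ := h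
        rw [Finset.prod_eq_zero hi (by simp [hq]), sub_zero]
      · push Not at h
        rw [Finset.prod_eq_one fun i hi => by simp [h i hi], sub_self]
    -- The alternating sum vanishes only for k ≠ 0. For k = 0 the empty conjunction holds
    -- everywhere, while the inclusion-exclusion sum is empty.
    have h3 : ∑ s : Finset (Fin k), (-1 : ℤ) ^ s.card = 0 := by
      have := Finset.sum_powerset_neg_one_pow_card (x := (Finset.univ : Finset (Fin k)))
      rw [Finset.powerset_univ] at this
      rw [this, if_neg]
      intro h
      have := congrArg Finset.card h
      simp at this
      exact hk this
    have h4 : ∑ s : Finset (Fin k), ∏ i ∈ s, (-(1 - if q i E then (1 : ℤ) else 0)) =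
        ∏ i : Fin k, (if q i E then (1 : ℤ) else 0) := by
      rw [← Finset.powerset_univ, ← Finset.prod_one_add]
      exact Finset.prod_congr rfl fun i _ => by ring
    rw [h1, Finset.sum_congr rfl fun s _ => h2 s, Finset.sum_sub_distrib, h3, h4, zero_sub, neg_neg]
    split_ifs with h
    · simp [h]
    · push Not at h
      obtain ⟨i, hi⟩ := h
      rw [Finset.prod_eq_zero (Finset.mem_univ i) (by simp [hi])]
  unfold wmc wsum
  push_cast
  simp only [key, mul_neg, Finset.sum_neg_distrib, Finset.mul_sum]
  rw [Finset.sum_comm]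
  congr 1
  refine Finset.sum_congr rfl fun s _ => Finset.sum_congr rfl fun E _ => ?_
  split_ifs <;> ring

end WeightedCount

/-! ### The rules of lifted inference for weighted counts -/

namespace PEForm
variable {S : Schema}

/-- The weighted count of a formula. -/
noncomputable def count (D : Finset (DBFact S)) (a b : DBFact S → ℕ) (φ : PEForm S) (v : ℕ → ℕ) :
    ℕ := wmc D a b (φ.Sat v)

theorem setIndep_of_indep {q r : BoolQuery S} (h : BoolQuery.Indep q r) : SetIndep q r := by
  intro f
  by_contra hc
  push Not at hc
  obtain ⟨⟨E, hE⟩, E', hE'⟩ := hc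
  exact h f ⟨⟨E, by tauto⟩, ⟨E', by tauto⟩⟩

theorem sat_bigOr {k : ℕ} (φ : Fin k → PEForm S) (s : Finset (Fin k)) (v : ℕ → ℕ)
    (D : Finset (DBFact S)) : (bigOr φ s).Sat v D ↔ ∃ i ∈ s, (φ i).Sat v D := by
  have : ∀ l : List (Fin k), (l.foldr (fun i ψ => (φ i).or ψ) fls).Sat v D ↔
      ∃ i ∈ l, (φ i).Sat v D := by
    intro l
    induction l with
    | nil => simp [Sat]
    | cons a l ih => simp [Sat, ih]
  simp [bigOr, this]

theorem sat_bigAnd {k : ℕ} (φ : Fin k → PEForm S) (v : ℕ → ℕ)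
    (D : Finset (DBFact S)) : (bigAnd φ).Sat v D ↔ ∀ i, (φ i).Sat v D := by
  have : ∀ l : List (Fin k), (l.foldr (fun i ψ => (φ i).and ψ) tru).Sat v D ↔
      ∀ i ∈ l, (φ i).Sat v D := by
    intro l
    induction l with
    | nil => simp [Sat]
    | cons a l ih => simp [Sat, ih]
  simp [bigAnd, this]

variable {D : Finset (DBFact S)} {a b : DBFact S → ℕ} {φ ψ : PEForm S}

theorem count_equiv (h : φ.Equivalent ψ) (v : ℕ → ℕ) : φ.count D a b v = ψ.count D a b v :=
  wmc_congr fun E _ => h v E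

/-- Inclusion-exclusion after collecting equivalent disjunctions. -/
theorem exists_count_bigAnd {k : ℕ} (hk : k ≠ 0) (φ : Fin k → PEForm S) :
    ∃ T : Finset (Finset (Fin k)), (∀ s ∈ T, s.Nonempty ∧ mobiusCoeff φ s ≠ 0) ∧
      ∀ (D : Finset (DBFact S)) (a b : DBFact S → ℕ) (v : ℕ → ℕ),
        ((bigAnd φ).count D a b v : ℤ) = ∑ s ∈ T, mobiusCoeff φ s * (bigOr φ s).count D a b v := by
  classical
  let N : Finset (Finset (Fin k)) := Finset.univ.filter fun s => s.Nonempty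
  have hN : ∀ s, s ∈ N ↔ s.Nonempty := by simp [N]
  let st : Setoid {s : Finset (Fin k) // s.Nonempty} :=
    ⟨fun s t => (bigOr φ s.1).Equivalent (bigOr φ t.1), fun _ _ _ => Iff.rfl,
      fun h v D => (h v D).symm, fun h h' v D => (h v D).trans (h' v D)⟩
  -- A representative of the equivalence class of the disjunction over s. The set T of
  -- representatives with non-zero coefficient does not depend on the database, the weights or the
  -- parameters, so that it can be built into a program.
  let r : Finset (Fin k) → Finset (Fin k) := fun s =>
    if h : s.Nonempty then (Quotient.mk st ⟨s, h⟩).out.1 else s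
  have hr : ∀ s, s.Nonempty → (r s).Nonempty ∧ (bigOr φ (r s)).Equivalent (bigOr φ s) := by
    intro s hs
    simp only [r, dif_pos hs]
    exact ⟨(Quotient.mk st ⟨s, hs⟩).out.2, Quotient.mk_out (s := st) ⟨s, hs⟩⟩
  have hr' : ∀ s t, s.Nonempty → t.Nonempty → (bigOr φ s).Equivalent (bigOr φ t) →
      r s = r t := by
    intro s t hs ht h
    simp only [r, dif_pos hs, dif_pos ht]
    rw [Quotient.sound (s := st) (a := ⟨s, hs⟩) (b := ⟨t, ht⟩) h]
  refine ⟨(N.image r).filter fun s => mobiusCoeff φ s ≠ 0, ?_, ?_⟩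
  · intro s hs
    simp only [Finset.mem_filter, Finset.mem_image, hN] at hs
    obtain ⟨⟨t, ht, rfl⟩, h0⟩ := hs
    exact ⟨(hr t ht).1, h0⟩
  · intro D a b v
    have h1 : ((bigAnd φ).count D a b v : ℤ) = - ∑ s ∈ N, (-1) ^ s.card *
        ((bigOr φ s).count D a b v : ℤ) := by
      unfold count
      rw [wmc_congr fun E _ => sat_bigAnd φ v E, wmc_forall_eq_sum hk]
      congr 1
      exact Finset.sum_congr rfl fun s _ => by rw [wmc_congr fun E _ => sat_bigOr φ s v E]
    -- Terms with coefficient 0 are put back, and the sum over all s is split into the fibres of r;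
    -- the signs in a fibre add up to the Möbius coefficient.
    rw [h1, Finset.sum_filter_of_ne (p := fun s => mobiusCoeff φ s ≠ 0)
      fun s _ h => left_ne_zero_of_mul h,
      ← Finset.sum_fiberwise_of_maps_to (g := r) fun s hs => Finset.mem_image_of_mem r hs,
      ← Finset.sum_neg_distrib]
    refine Finset.sum_congr rfl fun u hu => ?_
    obtain ⟨t, ht, rfl⟩ := Finset.mem_image.1 hu
    rw [hN] at ht
    have h2 : N.filter (fun s => r s = r t) = Finset.univ.filter fun s =>
        s.Nonempty ∧ (bigOr φ s).Equivalent (bigOr φ (r t)) := by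
      ext s
      simp only [Finset.mem_filter, hN, Finset.mem_univ, true_and]
      refine and_congr_right fun hs => ⟨fun h => ?_, fun h => ?_⟩
      · rw [← h]; exact fun v D => ((hr s hs).2 v D).symm
      · exact hr' s t hs ht fun v D => (h v D).trans ((hr t ht).2 v D)
    rw [h2, mobiusCoeff, neg_mul, Finset.sum_mul]
    congr 1
    refine Finset.sum_congr (by congr) fun s hs => ?_
    simp only [Finset.mem_filter] at hs
    rw [count_equiv hs.2.2]

end PEForm

/-! ### Programs for lifted inference -/

theorem MState.setReg_self (s : MState) (i v : ℕ) : (s.setReg i v).reg i = v := by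
  simp [MState.setReg_reg]

theorem MState.setReg_of_ne (s : MState) {i j : ℕ} (v : ℕ) (h : j ≠ i) :
    (s.setReg i v).reg j = s.reg j := by
  simp [MState.setReg_reg, h]

@[simp] theorem Cmd.keeps_for (i : ℕ) (e : Ex) (P : Cmd) (l : Loc) :
    (Cmd.for i e P).Keeps l ↔ l ≠ .reg i ∧ P.Keeps l := by
  simp only [Cmd.for, Cmd.Keeps]; tauto

@[simp] theorem Cmd.oracleFree_for (i : ℕ) (e : Ex) (P : Cmd) :
    (Cmd.for i e P).OracleFree ↔ P.OracleFree := by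
  simp [Cmd.for, Cmd.OracleFree]

/-! ### The table: column 0 holds values, 1 arities, 2 relations, 3 and 4 weights, 5 + i arguments
-/

section Table
variable {S : Schema}

/-- Row `j` of the table holds the fact `f`. -/
def IsRow (s : MState) (j : ℕ) (f : DBFact S) : Prop :=
  s.arr 2 j = f.1 ∧ ∀ i : Fin (S.arity f.1), s.arr (5 + i) j = f.2 i

/-- The facts `fs` with weights `a` and `b`, their total weight and the values `ds` are in memory. -/
structure DBState (fs : List (DBFact S)) (ds : List ℕ) (a b : DBFact S → ℕ) (s : MState) :
    Prop where
  len : s.reg 0 = fs.length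
  tot : s.reg 2 = wtot fs.toFinset a b
  dom_len : s.reg 3 = ds.length
  row : ∀ (j : ℕ) (h : j < fs.length), IsRow s j fs[j] ∧ s.arr 3 j = a fs[j] ∧ s.arr 4 j = b fs[j]
  dom : ∀ (j : ℕ) (h : j < ds.length), s.arr 0 j = ds[j]

/-- The list `ds` contains the values of the facts `fs`, and the sizes are bounded by `ℓ`. -/
structure DBOk (ℓ : ℕ) (fs : List (DBFact S)) (ds : List ℕ) (a b : DBFact S → ℕ) : Prop where
  nodup : ds.Nodup
  mem : ∀ f ∈ fs, ∀ i, f.2 i ∈ ds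
  pos : ∀ f ∈ fs, 0 < a f + b f
  tot_le : wtot fs.toFinset a b ≤ 2 ^ ℓ
  len_le : fs.length ≤ ℓ
  dom_le : ds.length ≤ ℓ

theorem DBState.congr {fs : List (DBFact S)} {ds : List ℕ} {a b : DBFact S → ℕ} {s s' : MState}
    (h : DBState fs ds a b s) (h0 : s'.reg 0 = s.reg 0) (h2 : s'.reg 2 = s.reg 2)
    (h3 : s'.reg 3 = s.reg 3) (ha : s'.arr = s.arr) : DBState fs ds a b s' where
  len := h0.trans h.len
  tot := h2.trans h.tot
  dom_len := h3.trans h.dom_len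
  row j hj := by simpa only [IsRow, ha] using h.row j hj
  dom j hj := by simpa only [ha] using h.dom j hj

theorem DBOk.tot_pos {ℓ : ℕ} {fs : List (DBFact S)} {ds : List ℕ} {a b : DBFact S → ℕ}
    (h : DBOk ℓ fs ds a b) : 0 < wtot fs.toFinset a b :=
  Finset.prod_pos fun f hf => h.pos f (List.mem_toFinset.1 hf)

/-- The program assigns only to registers from `r` on and to query variables. -/
def Cmd.LocalFrom (r : ℕ) (P : Cmd) : Prop :=
  ∀ l : Loc, (∀ i, r ≤ i → l ≠ .reg i) → l ≠ .env → P.Keeps l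

theorem Cmd.LocalFrom.mono {r r' : ℕ} {P : Cmd} (h : P.LocalFrom r') (hr : r ≤ r') :
    P.LocalFrom r := fun l hl => h l fun i hi => hl i (hr.trans hi)

theorem Cmd.LocalFrom.reg {r : ℕ} {P : Cmd} (h : P.LocalFrom r) {s s' : MState}
    (hF : P.Frame s s') {i : ℕ} (hi : i < r) : s'.reg i = s.reg i :=
  hF.reg i (h _ (fun j hj => by simp; omega) (by simp))

theorem Cmd.LocalFrom.dbState {r : ℕ} {P : Cmd} (h : P.LocalFrom r) (hr : 20 ≤ r)
    {fs : List (DBFact S)} {ds : List ℕ} {a b : DBFact S → ℕ} {s s' : MState}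
    (hD : DBState fs ds a b s) (hF : P.Frame s s') : DBState fs ds a b s' :=
  hD.congr (h.reg hF (by omega)) (h.reg hF (by omega)) (h.reg hF (by omega))
    (hF.arr (h _ (by simp) (by simp)))

/-- The program `P` computes the weighted count of `φ` into register `r`. -/
def PEForm.ComputedBy (φ : PEForm S) (r : ℕ) (P : Cmd) : Prop :=
  P.OracleFree ∧ P.LocalFrom r ∧ ∃ C, ∀ O ℓ fs ds a b s, C ≤ ℓ → DBOk ℓ fs ds a b →
    DBState fs ds a b s → WP O (4 * ℓ) P s fun s' =>
      s'.env = s.env ∧ s'.reg r = φ.count fs.toFinset a b s.env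

/-- Registers below 20 are reserved for the table and for the stages before and after. The choice of
`r` lets a compound formula place the results of its parts in registers that the other parts do not
touch. -/
def PEForm.Computable (φ : PEForm S) : Prop := ∀ r, 20 ≤ r → ∃ P, φ.ComputedBy r P

def QTerm.toEx : QTerm → Ex
  | const c => .const c
  | var x => .env x

def QTerm.bound : QTerm → ℕ
  | const c => c
  | var _ => 0

theorem QTerm.val_toEx (t : QTerm) (s : MState) : t.toEx.val s = t.eval s.env := by
  cases t <;> rfl

theorem QTerm.ok_toEx (t : QTerm) {L : ℕ} {s : MState} (h : t.bound ≤ L) : t.toEx.Ok L s := by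
  cases t with
  | const c => exact h.trans_lt Nat.lt_two_pow_self
  | var x => trivial

/-- The test whether row `j` holds an instance of the atom. -/
def QAtom.matchE (A : QAtom S) (j : Ex) : Ex :=
  (List.finRange (S.arity A.rel)).foldr
    (fun (i : Fin (S.arity A.rel)) e => Ex.eqE (.arr (.const (5 + i)) j) (A.args i).toEx * e)
    (Ex.eqE (.arr 2 j) (.const A.rel))

theorem QAtom.val_matchE (A : QAtom S) (j : Ex) (s : MState) : (A.matchE j).val s =
    if s.arr 2 (j.val s) = A.rel ∧ ∀ i : Fin (S.arity A.rel),
      s.arr (5 + i) (j.val s) = (A.args i).eval s.env then 1 else 0 := by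
  have : ∀ l : List (Fin (S.arity A.rel)), (l.foldr
      (fun (i : Fin (S.arity A.rel)) e => Ex.eqE (.arr (.const (5 + i)) j) (A.args i).toEx * e)
      (Ex.eqE (.arr 2 j) (.const A.rel))).val s =
      if s.arr 2 (j.val s) = A.rel ∧ ∀ i ∈ l,
        s.arr (5 + i) (j.val s) = (A.args i).eval s.env then 1 else 0 := by
    intro l
    induction l with
    | nil =>
      rw [List.foldr_nil, Ex.val_eqE]
      exact if_congr (by simp) rfl rfl
    | cons i l ih =>
      rw [List.foldr_cons, Ex.val_mul, ih, Ex.val_eqE, QTerm.val_toEx, Ex.val_arr, Ex.val_const,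
        ite_mul, one_mul, zero_mul, ← ite_and]
      refine if_congr ?_ rfl rfl
      simp only [List.mem_cons, forall_eq_or_imp]
      tauto
  simp [QAtom.matchE, this]

/-- Large enough to dominate the constants of the test and the column indices that it uses. -/
def QAtom.bound (A : QAtom S) : ℕ := 10 + A.rel + S.arity A.rel + ∑ i, (A.args i).bound

theorem QAtom.ok_matchE (A : QAtom S) {j : Ex} {s : MState} {L : ℕ} (hj : j.Ok L s)
    (h : A.bound + j.val s ≤ L) : (A.matchE j).Ok L s := by
  have hL : L < 2 ^ L := Nat.lt_two_pow_self
  unfold QAtom.bound at h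
  have : ∀ l : List (Fin (S.arity A.rel)),
      (l.foldr (fun (i : Fin (S.arity A.rel)) e => Ex.eqE (.arr (.const (5 + i)) j) (A.args i).toEx * e)
        (Ex.eqE (.arr 2 j) (.const A.rel))).Ok L s ∧
      (l.foldr (fun (i : Fin (S.arity A.rel)) e => Ex.eqE (.arr (.const (5 + i)) j) (A.args i).toEx * e)
        (Ex.eqE (.arr 2 j) (.const A.rel))).val s ≤ 1 := by
    intro l
    induction l with
    | nil =>
      refine ⟨Ex.ok_eqE (by omega) ?_ (by simp; omega),
        by rw [List.foldr_nil, Ex.val_eqE]; split_ifs <;> omega⟩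
      simp only [Ex.ok_arr, Ex.ok_ofNat, Ex.val_ofNat]
      exact ⟨by omega, hj, by omega⟩
    | cons i l ih =>
      have hle : ∀ x y : ℕ, x ≤ 1 → y ≤ 1 → x * y ≤ 1 := fun x y hx hy => Nat.mul_le_mul hx hy
      have h1 : (Ex.eqE (.arr (.const (5 + i)) j) (A.args i).toEx).val s ≤ 1 := by
        rw [Ex.val_eqE]; split_ifs <;> simp
      have hi : (A.args i).bound ≤ ∑ i, (A.args i).bound :=
        Finset.single_le_sum (f := fun i => (A.args i).bound) (fun _ _ => Nat.zero_le _)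
          (Finset.mem_univ i)
      have hi' := i.2
      rw [List.foldr_cons, Ex.ok_mul, Ex.val_mul]
      refine ⟨⟨Ex.ok_eqE (by omega) ?_ (QTerm.ok_toEx _ (by omega)), ih.1,
        (hle _ _ h1 ih.2).trans_lt (by omega)⟩, hle _ _ h1 ih.2⟩
      simp only [Ex.ok_arr, Ex.ok_const, Ex.val_const]
      exact ⟨by omega, hj, by omega⟩
  exact (this _).1

theorem isRow_eq_ground_iff {A : QAtom S} {s : MState} {j : ℕ} {f : DBFact S} (h : IsRow s j f)
    (v : ℕ → ℕ) : (s.arr 2 j = A.rel ∧ ∀ i : Fin (S.arity A.rel),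
      s.arr (5 + i) j = (A.args i).eval v) ↔ f = A.ground v := by
  obtain ⟨R, c⟩ := f
  obtain ⟨h1, h2⟩ := h
  simp only at h1 h2
  constructor
  · rintro ⟨h3, h4⟩
    obtain rfl : R = A.rel := Fin.ext (h1.symm.trans h3)
    simp only [QAtom.ground, Sigma.mk.injEq, heq_eq_eq, true_and]
    funext i
    rw [← h2, h4]
  · intro h
    obtain ⟨R', args⟩ := A
    simp only [QAtom.ground, Sigma.mk.injEq] at h
    obtain ⟨rfl, h⟩ := h
    simp only [heq_eq_eq] at h
    exact ⟨h1, fun i => by rw [h2, h]⟩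

/-! ### One program for each rule of lifted inference -/

theorem two_pow_le_of_le {m n : ℕ} (h : m ≤ n) : 2 ^ m ≤ 2 ^ n := Nat.pow_le_pow_right (by simp) h

theorem two_pow_lt_of_lt {m n : ℕ} (h : m < n) : 2 ^ m < 2 ^ n := Nat.pow_lt_pow_right (by simp) h

/-- Counts are at most the total weight, which is at most `2 ^ ℓ`; numbers of `4 * ℓ` bits leave
room for the product of two of them. -/
theorem mul_lt_two_pow {x y ℓ : ℕ} (hℓ : 1 ≤ ℓ) (hx : x ≤ 2 ^ ℓ) (hy : y ≤ 2 ^ ℓ) :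
    x * y < 2 ^ (4 * ℓ) := by
  calc x * y ≤ 2 ^ ℓ * 2 ^ ℓ := Nat.mul_le_mul hx hy
    _ = 2 ^ (2 * ℓ) := by rw [← pow_add]; ring_nf
    _ < _ := two_pow_lt_of_lt (by omega)

/-- A scan of the rows. A row that holds the instance of the atom under the current parameters
assigns the value from `wmc_mem`; without such a row the result stays 0. -/
theorem PEForm.computable_atom (A : QAtom S) : (PEForm.atom A).Computable := by
  intro r hr
  refine ⟨.set r 0 ;; .for (r + 1) (.reg 0) (.ite (A.matchE (.reg (r + 1)))
    (.set r (.reg 2 / (.arr 3 (.reg (r + 1)) + .arr 4 (.reg (r + 1))) * .arr 3 (.reg (r + 1))))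
    .skip), by simp [Cmd.OracleFree], ?_, A.bound + 10, ?_⟩
  · intro l hl he
    simp [Cmd.Keeps, hl r le_rfl, hl (r + 1) (by omega)]
  · intro O ℓ fs ds a b s hℓ hD hs
    have hL : 4 * ℓ < 2 ^ (4 * ℓ) := Nat.lt_two_pow_self
    refine WP.seq (WP.set (fun _ => by simp) ?_)
    refine WP.for fs.length (fun k s' => s'.env = s.env ∧ s'.reg r =
      if A.ground s.env ∈ fs.take k then wtot fs.toFinset a b /
        (a (A.ground s.env) + b (A.ground s.env)) * a (A.ground s.env) else 0)
      (by have := hD.len_le; omega) ?_ ?_ ?_ ?_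
    · simp [MState.setReg_reg]
    · intro k hk s' _ hF hI
      have h0 := hF.reg 0 (by simp [Cmd.Keeps]; omega)
      rw [MState.setReg_of_ne _ _ (by omega)] at h0
      exact ⟨trivial, h0.trans hs.len⟩
    · rintro k hk s' hF ⟨he, hI⟩ hr1
      have hs' : DBState fs ds a b s' := by
        refine hs.congr ?_ ?_ ?_ ?_
        · rw [hF.reg 0 (by simp [Cmd.Keeps]; omega), MState.setReg_of_ne _ _ (by omega)]
        · rw [hF.reg 2 (by simp [Cmd.Keeps]; omega), MState.setReg_of_ne _ _ (by omega)]
        · rw [hF.reg 3 (by simp [Cmd.Keeps]; omega), MState.setReg_of_ne _ _ (by omega)]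
        · rw [hF.arr (by simp [Cmd.Keeps]), MState.setReg_arr]
      obtain ⟨hrow, ha, hb⟩ := hs'.row k hk
      have hlen := hD.len_le
      have hm := QAtom.val_matchE A (.reg (r + 1)) s'
      simp only [Ex.val_reg, hr1, isRow_eq_ground_iff hrow, he] at hm
      have htk : A.ground s.env ∈ fs.take (k + 1) ↔
          A.ground s.env ∈ fs.take k ∨ fs[k] = A.ground s.env := by
        rw [List.take_succ_eq_append_getElem hk, List.mem_append, List.mem_singleton,
          eq_comm (a := fs[k])]
      have hle : a fs[k] + b fs[k] ≤ wtot fs.toFinset a b :=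
        Nat.le_of_dvd hD.tot_pos (Finset.dvd_prod_of_mem _ (by simp))
      have htot := hD.tot_le
      refine WP.ite (fun _ => QAtom.ok_matchE A trivial ?_) ?_ ?_
      · simp only [Ex.val_reg, hr1]; omega
      · intro hv
        have hg : fs[k] = A.ground s.env := by
          by_contra hc
          rw [hm, if_neg hc] at hv
          exact hv rfl
        refine WP.set ?_ ?_
        · intro _
          have h1 : 2 ^ ℓ < 2 ^ (4 * ℓ) := two_pow_lt_of_lt (by omega)
          simp only [Ex.ok_mul, Ex.ok_div, Ex.ok_add, Ex.ok_reg, Ex.ok_arr, Ex.ok_ofNat,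
            Ex.val_ofNat, Ex.val_reg, hr1, Ex.val_arr, ha, hb, hs'.tot, Ex.val_div, Ex.val_add,
            true_and]
          refine ⟨⟨⟨by omega, by omega⟩, ⟨by omega, by omega⟩, by omega⟩, ⟨by omega, by omega⟩, ?_⟩
          exact mul_lt_two_pow (by omega) ((Nat.div_le_self _ _).trans htot) (by omega)
        · simp only [Ex.val_mul, Ex.val_div, Ex.val_add, Ex.val_reg, Ex.val_arr, Ex.val_ofNat, hr1,
            ha, hb, hs'.tot, MState.setReg_env]
          refine ⟨by rw [MState.setReg_of_ne _ _ (by omega), hr1], he, ?_⟩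
          rw [MState.setReg_of_ne _ _ (by omega), MState.setReg_self, if_pos (htk.2 (Or.inr hg)), hg]
      · intro hv
        have hg : fs[k] ≠ A.ground s.env := by
          intro hc
          rw [hm, if_pos hc] at hv
          exact one_ne_zero hv
        refine WP.skip ⟨hr1, he, ?_⟩
        rw [MState.setReg_of_ne _ _ (by omega), hI]
        simp only [htk, hg, or_false]
    · rintro s' hF ⟨he, hI⟩
      refine ⟨he, hI.trans ?_⟩
      rw [List.take_length]
      simp only [PEForm.count, PEForm.Sat]
      rw [wmc_mem _ fun h => hD.pos _ (by simpa using h)]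
      simp only [List.mem_toFinset]

theorem PEForm.computable_tru : (PEForm.tru : PEForm S).Computable := by
  intro r hr
  refine ⟨.set r (.reg 2), by simp [Cmd.OracleFree], fun l hl he => by
    simp [Cmd.Keeps, hl r le_rfl], 0, fun O ℓ fs ds a b s hℓ hD hs => ?_⟩
  refine WP.set (fun _ => trivial) ⟨rfl, ?_⟩
  simp only [MState.setReg_self, Ex.val_reg, hs.tot, PEForm.count, PEForm.Sat]
  exact wmc_true.symm

theorem PEForm.computable_fls : (PEForm.fls : PEForm S).Computable := by
  intro r hr
  refine ⟨.set r 0, by simp [Cmd.OracleFree], fun l hl he => by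
    simp [Cmd.Keeps, hl r le_rfl], 0, fun O ℓ fs ds a b s hℓ hD hs => ?_⟩
  refine WP.set (fun _ => by simp) ⟨rfl, ?_⟩
  simp only [MState.setReg_self, Ex.val_ofNat, PEForm.count, PEForm.Sat]
  exact wmc_false.symm

/-- The truth of such a formula depends on the parameters alone, so its count is the total weight or
0. -/
theorem PEForm.computable_of_test (φ : PEForm S) (e : Ex) (C : ℕ)
    (hok : ∀ L s, C ≤ L → e.Ok L s) (hφ : ∀ s D, e.val s ≠ 0 ↔ φ.Sat s.env D) :
    φ.Computable := by
  intro r hr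
  refine ⟨.ite e (.set r (.reg 2)) (.set r 0), by simp [Cmd.OracleFree], fun l hl he => by
    simp [Cmd.Keeps, hl r le_rfl], C, fun O ℓ fs ds a b s hℓ hD hs => ?_⟩
  refine WP.ite (fun _ => hok _ _ (by omega)) (fun hv => ?_) (fun hv => ?_)
  · refine WP.set (fun _ => trivial) ⟨rfl, ?_⟩
    simp only [MState.setReg_self, Ex.val_reg, hs.tot, PEForm.count]
    rw [← wmc_true]
    exact wmc_congr fun E _ => by simp [← hφ, hv]
  · refine WP.set (fun _ => by simp) ⟨rfl, ?_⟩
    simp only [MState.setReg_self, Ex.val_ofNat, PEForm.count]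
    rw [← wmc_false (D := fs.toFinset) (a := a) (b := b)]
    exact wmc_congr fun E _ => by simp [← hφ, hv]

theorem PEForm.computable_eq (t u : QTerm) : (PEForm.eq t u : PEForm S).Computable := by
  refine PEForm.computable_of_test _ (Ex.eqE t.toEx u.toEx) (t.bound + u.bound + 1) ?_ ?_
  · intro L s hL
    exact Ex.ok_eqE (Nat.one_lt_two_pow (by omega)) (t.ok_toEx (by omega)) (u.ok_toEx (by omega))
  · intro s D
    simp [QTerm.val_toEx, PEForm.Sat]

theorem PEForm.computable_lt (t u : QTerm) : (PEForm.lt t u : PEForm S).Computable := by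
  refine PEForm.computable_of_test _ (u.toEx - t.toEx) (t.bound + u.bound + 1) ?_ ?_
  · intro L s hL
    exact ⟨u.ok_toEx (by omega), t.ok_toEx (by omega)⟩
  · intro s D
    simp only [Ex.val_sub, QTerm.val_toEx, PEForm.Sat]
    omega

theorem PEForm.Computable.equiv {φ ψ : PEForm S} (h : φ.Equivalent ψ) (hφ : φ.Computable) :
    ψ.Computable := by
  intro r hr
  obtain ⟨P, h1, h2, C, h3⟩ := hφ r hr
  refine ⟨P, h1, h2, C, fun O ℓ fs ds a b s hℓ hD hs => (h3 O ℓ fs ds a b s hℓ hD hs).mono ?_⟩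
  rintro s' - - ⟨he, hv⟩
  exact ⟨he, hv.trans (PEForm.count_equiv h _)⟩

theorem PEForm.count_le {D : Finset (DBFact S)} {a b : DBFact S → ℕ} {φ : PEForm S} {v : ℕ → ℕ} :
    φ.count D a b v ≤ wtot D a b := wmc_le

/-- The count of φ waits in register `r` while that of ψ is computed from register `r + 1` on. The
rule itself is left to the expression `e` in these two counts and the total weight in register 2. -/
theorem PEForm.computable_binary {φ ψ χ : PEForm S} (hφ : φ.Computable) (hψ : ψ.Computable)
    (e : Ex → Ex → Ex)
    (hok : ∀ (ℓ x y r W : ℕ) (s : MState), 1 ≤ ℓ → x ≤ 2 ^ ℓ → y ≤ 2 ^ ℓ → s.reg 2 = W → W ≤ 2 ^ ℓ →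
      s.reg r = x → s.reg (r + 1) = y → (e (.reg r) (.reg (r + 1))).Ok (4 * ℓ) s)
    (hval : ∀ (D : Finset (DBFact S)) (a b : DBFact S → ℕ) (s : MState) (r : ℕ), 0 < wtot D a b →
      s.reg 2 = wtot D a b → s.reg r = φ.count D a b s.env → s.reg (r + 1) = ψ.count D a b s.env →
      (e (.reg r) (.reg (r + 1))).val s = χ.count D a b s.env) : χ.Computable := by
  intro r hr
  obtain ⟨P, h1, h2, C, h3⟩ := hφ r hr
  obtain ⟨P', g1, g2, C', g3⟩ := hψ (r + 1) (by omega)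
  refine ⟨P ;; P' ;; .set r (e (.reg r) (.reg (r + 1))), ⟨h1, g1, trivial⟩, fun l hl he =>
    ⟨h2 l hl he, g2.mono (Nat.le_succ r) l hl he, hl r le_rfl⟩, C + C' + 1, ?_⟩
  intro O ℓ fs ds a b s hℓ hD hs
  refine WP.seq ((h3 O ℓ fs ds a b s (by omega) hD hs).mono ?_)
  rintro s1 - hF1 ⟨he1, hv1⟩
  have hs1 := h2.dbState hr hs hF1
  refine WP.seq ((g3 O ℓ fs ds a b s1 (by omega) hD hs1).mono ?_)
  rintro s2 - hF2 ⟨he2, hv2⟩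
  have hs2 := (g2.mono (Nat.le_succ r)).dbState hr hs1 hF2
  rw [← g2.reg hF2 (Nat.lt_succ_self r), ← he1, ← he2] at hv1
  rw [← he2] at hv2
  refine WP.set (fun _ => ?_) ⟨by rw [MState.setReg_env, he2, he1], ?_⟩
  · exact hok ℓ _ _ r _ s2 (by omega) (PEForm.count_le.trans hD.tot_le)
      (PEForm.count_le.trans hD.tot_le) hs2.tot hD.tot_le hv1 hv2
  · rw [MState.setReg_self, hval _ a b s2 r hD.tot_pos hs2.tot hv1 hv2, he2, he1]

theorem PEForm.Computable.join {φ ψ : PEForm S} (hφ : φ.Computable) (hψ : ψ.Computable)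
    (h : ∀ v, BoolQuery.Indep (φ.Sat v) (ψ.Sat v)) : (φ.and ψ).Computable := by
  refine PEForm.computable_binary hφ hψ (fun x y => x * y / .reg 2) ?_ ?_
  · rintro ℓ x y r W s hℓ hx hy h2 hW rfl rfl
    simp only [Ex.ok_div, Ex.ok_mul, Ex.ok_reg, Ex.val_reg, true_and, and_true]
    exact mul_lt_two_pow hℓ hx hy
  · intro D a b s r h0 h2 hx hy
    simp only [Ex.val_div, Ex.val_mul, Ex.val_reg, hx, hy, h2]
    exact (wmc_and (PEForm.setIndep_of_indep (h _)) h0).symm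

theorem PEForm.Computable.union {φ ψ : PEForm S} (hφ : φ.Computable) (hψ : ψ.Computable)
    (h : ∀ v, BoolQuery.Indep (φ.Sat v) (ψ.Sat v)) : (φ.or ψ).Computable := by
  refine PEForm.computable_binary hφ hψ (fun x y => x + y - x * y / .reg 2) ?_ ?_
  · rintro ℓ x y r W s hℓ hx hy h2 hW rfl rfl
    simp only [Ex.ok_sub, Ex.ok_add, Ex.ok_div, Ex.ok_mul, Ex.ok_reg, Ex.val_reg, true_and,
      and_true]
    refine ⟨?_, mul_lt_two_pow hℓ hx hy⟩
    have : 2 ^ (ℓ + 1) < 2 ^ (4 * ℓ) := two_pow_lt_of_lt (by omega)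
    rw [pow_succ] at this
    omega
  · intro D a b s r h0 h2 hx hy
    simp only [Ex.val_sub, Ex.val_add, Ex.val_div, Ex.val_mul, Ex.val_reg, hx, hy, h2]
    exact (wmc_or (PEForm.setIndep_of_indep (h _)) h0).symm

/-- The formula fails exactly if all instances fail, and instances by distinct values are
independent. With W the total weight, the count of failure is built up by multiplying with (W -
count)/W for each value in the list. Other values cannot be witnesses, as a separator takes values
occurring in the database. Register `r` saves the old value of x, `r + 1` holds the running count,
`r + 2` the loop counter and `r + 3` the count of the current instance. -/
theorem PEForm.Computable.project {φ : PEForm S} {x : ℕ} (hφ : φ.Computable)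
    (h : φ.IsSeparator x) : (PEForm.ex x φ).Computable := by
  intro r hr
  obtain ⟨P, h1, h2, C, h3⟩ := hφ (r + 3) (by omega)
  refine ⟨.set r (.env x) ;; .set (r + 1) (.reg 2) ;; .for (r + 2) (.reg 3)
    (.setv x (.arr 0 (.reg (r + 2))) ;; P ;;
      .set (r + 1) (.reg (r + 1) * (.reg 2 - .reg (r + 3)) / .reg 2)) ;;
    .setv x (.reg r) ;; .set r (.reg 2 - .reg (r + 1)), ?_, ?_, C + 1, ?_⟩
  · simp [Cmd.OracleFree, h1]
  · intro l hl he
    simp [Cmd.Keeps, hl r le_rfl, hl (r + 1) (by omega), hl (r + 2) (by omega), he,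
      h2.mono (show r ≤ r + 3 by omega) l hl he]
  · intro O ℓ fs ds a b s hℓ hD hs
    refine WP.seq (WP.set (fun _ => trivial) (WP.seq (WP.set (fun _ => trivial) ?_)))
    set s1 := (s.setReg r ((Ex.env x).val s)).setReg (r + 1)
      ((Ex.reg 2).val (s.setReg r ((Ex.env x).val s))) with hs1
    have hs1D : DBState fs ds a b s1 := by
      refine hs.congr ?_ ?_ ?_ ?_ <;>
        simp (disch := omega) [hs1, MState.setReg_of_ne]
    have hs1r : s1.reg r = s.env x := by
      simp (disch := omega) [hs1, MState.setReg_of_ne, MState.setReg_self]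
    have hs1r1 : s1.reg (r + 1) = wtot fs.toFinset a b := by
      simp (disch := omega) [hs1, MState.setReg_of_ne, MState.setReg_self, hs.tot]
    have hs1e : s1.env = s.env := rfl
    clear_value s1
    -- The loop may change the variable x, but no other one; that is enough to restore the
    -- parameters from register `r` afterwards.
    refine WP.seq (WP.for ds.length (fun k s' => s'.reg (r + 1) = wmc fs.toFinset a b
        (fun E => ∀ d ∈ ds.take k, ¬ φ.Sat (Function.update s.env x d) E) ∧
        ∃ y, s'.env = Function.update s.env x y)
      (by have := hD.dom_le; omega) ?_ ?_ ?_ ?_)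
    · refine ⟨?_, s.env x, ?_⟩
      · rw [MState.setReg_of_ne _ _ (by omega), hs1r1, ← wmc_true]
        exact wmc_congr fun E _ => by simp
      · simp [hs1e]
    · intro k hk s' _ hF hI
      exact ⟨trivial, (hF.reg 3 (by
        simp [Cmd.Keeps, h2 (.reg 3) (by simp; omega)]; omega)).trans hs1D.dom_len⟩
    · rintro k hk s' hF ⟨hr1, y, he⟩ hr2
      have hs' : DBState fs ds a b s' := by
        refine hs1D.congr (hF.reg 0 ?_) (hF.reg 2 ?_) (hF.reg 3 ?_) (hF.arr ?_)
        · simp [Cmd.Keeps, h2 (.reg 0) (by simp; omega)]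
        · simp [Cmd.Keeps, h2 (.reg 2) (by simp; omega)]
          omega
        · simp [Cmd.Keeps, h2 (.reg 3) (by simp; omega)]; omega
        · simp [Cmd.Keeps, h2 .arr (by simp)]
      have hdl := hD.dom_le
      refine WP.seq (WP.setv (fun _ => ?_) ?_)
      · simp only [Ex.ok_arr, Ex.ok_ofNat, Ex.ok_reg, Ex.val_ofNat, Ex.val_reg, hr2]
        exact ⟨by positivity, trivial, by omega⟩
      simp only [Ex.val_arr, Ex.val_ofNat, Ex.val_reg, hr2, hs'.dom k hk]
      have hs'' : DBState fs ds a b (s'.setEnv x ds[k]) := hs'.congr rfl rfl rfl rfl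
      refine WP.seq ((h3 O ℓ fs ds a b _ (by omega) hD hs'').mono ?_)
      rintro s2 - hF2 ⟨he2, hv2⟩
      have hs2 := h2.dbState (by omega) hs'' hF2
      have hr1' := h2.reg hF2 (show r + 1 < r + 3 by omega)
      have hr2' := h2.reg hF2 (show r + 2 < r + 3 by omega)
      simp only [MState.setEnv_reg, MState.setEnv_env, he, Function.update_idem] at hr1' hr2' he2 hv2
      rw [hr1] at hr1'
      refine WP.set (fun _ => ?_) ⟨?_, ?_, ds[k], by simp [he2]⟩
      · simp only [Ex.ok_div, Ex.ok_mul, Ex.ok_reg, Ex.ok_sub, Ex.val_sub, Ex.val_reg, true_and,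
          and_true, hs2.tot, hr1']
        exact mul_lt_two_pow (by omega) (wmc_le.trans hD.tot_le)
          ((Nat.sub_le _ _).trans hD.tot_le)
      · rw [MState.setReg_of_ne _ _ (by omega), hr2', hr2]
      · rw [MState.setReg_of_ne _ _ (by omega), MState.setReg_self]
        simp only [Ex.val_div, Ex.val_mul, Ex.val_reg, Ex.val_sub, hr1', hs2.tot, hv2]
        rw [List.take_succ_eq_append_getElem hk]
        refine (wmc_forall_cons (fun d => φ.Sat (Function.update s.env x d)) ds[k] (ds.take k) ?_
          hD.tot_pos).symm
        intro d hd
        refine PEForm.setIndep_of_indep (h.2 _ _ _ ?_)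
        -- The list has no repetitions, so the value at position k does not occur before it.
        rintro rfl
        obtain ⟨i, hi, hid⟩ := List.getElem_of_mem hd
        rw [List.length_take] at hi
        rw [List.getElem_take] at hid
        have := (hD.nodup.getElem_inj_iff).1 hid
        omega
    · rintro s' hF ⟨hr1, y, he⟩
      have hr' : s'.reg r = s.env x := (hF.reg r (by
        simp [Cmd.Keeps, h2 (.reg r) (by simp; omega)])).trans hs1r
      have h2' : s'.reg 2 = wtot fs.toFinset a b := (hF.reg 2 (by
        simp [Cmd.Keeps, h2 (.reg 2) (by simp; omega)]; omega)).trans hs1D.tot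
      refine WP.seq (WP.setv (fun _ => trivial) (WP.set (fun _ => ⟨trivial, trivial⟩) ⟨?_, ?_⟩))
      · simp [he, hr']
      · rw [MState.setReg_self]
        simp only [Ex.val_sub, Ex.val_reg, MState.setEnv_reg, h2', hr1, List.take_length]
        rw [← wmc_not]
        refine wmc_congr fun E hE => ?_
        simp only [PEForm.Sat]
        push Not
        constructor
        · rintro ⟨d, -, hd⟩
          exact ⟨d, hd⟩
        · rintro ⟨d, hd⟩
          obtain ⟨f, hf, i, hi⟩ := h.1 _ _ hd
          rw [Function.update_self] at hi
          exact ⟨d, hi ▸ hD.mem f (by simpa using hE hf) i, hd⟩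

/-- Signed sums on a machine without negative numbers: terms with non-negative coefficient are added
to register `r`, the others, in absolute value, to `r + 1`. Arbitrary initial contents are allowed
for the sake of the induction, and the size hypothesis bounds the sum of both registers. -/
theorem PEForm.computable_linear (T : List (ℤ × PEForm S)) (hT : ∀ p ∈ T, p.2.Computable)
    (r : ℕ) (hr : 20 ≤ r) : ∃ P : Cmd, P.OracleFree ∧ P.LocalFrom r ∧
      ∃ C, ∀ O ℓ fs ds a b s, C ≤ ℓ → DBOk ℓ fs ds a b → DBState fs ds a b s →
        s.reg r + s.reg (r + 1) + (T.map fun p => p.1.natAbs).sum * wtot fs.toFinset a b <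
          2 ^ (4 * ℓ) →
        WP O (4 * ℓ) P s fun s' => s'.env = s.env ∧
          (s'.reg r : ℤ) - s'.reg (r + 1) = s.reg r - s.reg (r + 1) +
            (T.map fun p => p.1 * (p.2.count fs.toFinset a b s.env : ℤ)).sum := by
  induction T with
  | nil =>
    refine ⟨.skip, trivial, fun _ _ _ => trivial, 0, ?_⟩
    intro O ℓ fs ds a b s _ hD hs hlt
    exact WP.skip ⟨rfl, by simp⟩
  | cons p T ih =>
    obtain ⟨P', g1, g2, C', g3⟩ := ih fun q hq => hT q (List.mem_cons_of_mem _ hq)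
    obtain ⟨P, h1, h2, C, h3⟩ := hT p (by simp) (r + 2) (by omega)
    let r' := if 0 ≤ p.1 then r else r + 1
    have hr' : r' = r ∨ r' = r + 1 := by simp only [r']; split_ifs <;> simp
    refine ⟨P ;; .set r' (.reg r' + .const p.1.natAbs * .reg (r + 2)) ;; P', ⟨h1, trivial, g1⟩,
      fun l hl he => ⟨h2.mono (by omega) l hl he, hl r' (by omega), g2 l hl he⟩,
      C + C' + p.1.natAbs + 1, ?_⟩
    intro O ℓ fs ds a b s hℓ hD hs hlt
    simp only [List.map_cons, List.sum_cons, add_mul] at hlt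
    refine WP.seq ((h3 O ℓ fs ds a b s (by omega) hD hs).mono ?_)
    rintro s1 - hF1 ⟨he1, hv1⟩
    have hs1 := h2.dbState (by omega) hs hF1
    have e0 := h2.reg hF1 (show r < r + 2 by omega)
    have e1 := h2.reg hF1 (show r + 1 < r + 2 by omega)
    have hcnt : p.1.natAbs * p.2.count fs.toFinset a b s.env ≤
      p.1.natAbs * wtot fs.toFinset a b := Nat.mul_le_mul_left _ PEForm.count_le
    have hlt' : p.1.natAbs < 2 ^ (4 * ℓ) :=
      Nat.lt_two_pow_self.trans_le (two_pow_le_of_le (by omega))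
    have er' : s1.reg r' ≤ s1.reg r + s1.reg (r + 1) := by
      rcases hr' with h | h <;> rw [h] <;> omega
    refine WP.seq (WP.set (fun _ => ?_) ?_)
    · simp only [Ex.ok_add, Ex.ok_reg, Ex.ok_mul, Ex.ok_const, Ex.val_mul, Ex.val_reg, Ex.val_const,
        true_and, hv1]
      exact ⟨⟨hlt', by omega⟩, by omega⟩
    · simp only [Ex.val_add, Ex.val_reg, Ex.val_mul, Ex.val_const, hv1]
      set c := p.2.count fs.toFinset a b s.env
      have hs2 : DBState fs ds a b (s1.setReg r' (s1.reg r' + p.1.natAbs * c)) := by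
        refine hs1.congr ?_ ?_ ?_ rfl <;> rw [MState.setReg_of_ne _ _ (by omega)]
      have hsum : (s1.setReg r' (s1.reg r' + p.1.natAbs * c)).reg r +
          (s1.setReg r' (s1.reg r' + p.1.natAbs * c)).reg (r + 1) =
          s.reg r + s.reg (r + 1) + p.1.natAbs * c := by
        rcases hr' with h | h <;> rw [h] <;>
          simp (disch := omega) only [MState.setReg_of_ne, MState.setReg_self, e0, e1] <;> omega
      have hdiff : ((s1.setReg r' (s1.reg r' + p.1.natAbs * c)).reg r : ℤ) -
          (s1.setReg r' (s1.reg r' + p.1.natAbs * c)).reg (r + 1) =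
          s.reg r - s.reg (r + 1) + p.1 * c := by
        by_cases hp : 0 ≤ p.1
        · have : (p.1.natAbs : ℤ) = p.1 := Int.natAbs_of_nonneg hp
          simp only [r', if_pos hp]
          simp (disch := omega) only [MState.setReg_of_ne, MState.setReg_self, e0, e1]
          push_cast [this]
          ring
        · have : (p.1.natAbs : ℤ) = -p.1 := Int.ofNat_natAbs_of_nonpos (by omega)
          simp only [r', if_neg hp]
          simp (disch := omega) only [MState.setReg_of_ne, MState.setReg_self, e0, e1]
          push_cast [this]
          ring
      refine (g3 O ℓ fs ds a b _ (by omega) hD hs2 (by rw [hsum]; omega)).mono ?_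
      rintro s3 - hF3 ⟨he3, hv3⟩
      refine ⟨by rw [he3, MState.setReg_env, he1], ?_⟩
      rw [hv3, hdiff, MState.setReg_env, he1, List.map_cons, List.sum_cons]
      ring

/-- Inclusion-exclusion evaluated on the representatives with non-zero coefficient, which are
exactly of the kind for which a program is given. The coefficients are constants of the program. -/
theorem PEForm.computable_mobius {k : ℕ} (φ : Fin k → PEForm S)
    (h : ∀ s : Finset (Fin k), s.Nonempty → mobiusCoeff φ s ≠ 0 → (bigOr φ s).Computable) :
    (bigAnd φ).Computable := by
  rcases eq_or_ne k 0 with rfl | hk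
  · exact PEForm.computable_tru
  intro r hr
  obtain ⟨T, hT, hsum⟩ := PEForm.exists_count_bigAnd hk φ
  obtain ⟨P, h1, h2, C, h3⟩ := PEForm.computable_linear
    (T.toList.map fun s => (mobiusCoeff φ s, bigOr φ s)) (by
      intro p hp
      simp only [List.mem_map, Finset.mem_toList] at hp
      obtain ⟨s, hs, rfl⟩ := hp
      exact h s (hT s hs).1 (hT s hs).2) r hr
  refine ⟨.set r 0 ;; .set (r + 1) 0 ;; P ;; .set r (.reg r - .reg (r + 1)),
    ⟨trivial, trivial, h1, trivial⟩, fun l hl he =>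
    ⟨hl r le_rfl, hl (r + 1) (by omega), h2 l hl he, hl r le_rfl⟩,
    -- The sum of the absolute values of the coefficients enters the threshold, so that it is at
    -- most `2 ^ ℓ` and its product with the total weight is small.
    C + ((T.toList.map fun s => (mobiusCoeff φ s, bigOr φ s)).map fun p => p.1.natAbs).sum + 1, ?_⟩
  intro O ℓ fs ds a b s hℓ hD hs
  refine WP.seq (WP.set (fun _ => by simp) (WP.seq (WP.set (fun _ => by simp) ?_)))
  have hs1 : DBState fs ds a b ((s.setReg r 0).setReg (r + 1) 0) := by
    refine hs.congr ?_ ?_ ?_ rfl <;> simp (disch := omega) only [MState.setReg_of_ne]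
  refine WP.seq ((h3 O ℓ fs ds a b _ (by omega) hD hs1 ?_).mono ?_)
  · simp (disch := omega) only [MState.setReg_of_ne, MState.setReg_self, zero_add]
    refine mul_lt_two_pow (by omega) ?_ hD.tot_le
    exact (Nat.lt_two_pow_self.trans_le (two_pow_le_of_le (by omega))).le
  · rintro s2 - hF2 ⟨he2, hv2⟩
    refine WP.set (fun _ => ⟨trivial, trivial⟩) ⟨by simp [he2], ?_⟩
    simp (disch := omega) only [MState.setReg_of_ne, MState.setReg_self, MState.setReg_env] at hv2
    rw [MState.setReg_self]
    simp only [Ex.val_sub, Ex.val_reg]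
    have := hsum fs.toFinset a b s.env
    rw [List.map_map] at hv2
    have h4 : (T.toList.map ((fun p : ℤ × PEForm S => p.1 * (p.2.count fs.toFinset a b s.env : ℤ)) ∘
        fun s => (mobiusCoeff φ s, bigOr φ s))).sum =
        ∑ u ∈ T, mobiusCoeff φ u * (bigOr φ u).count fs.toFinset a b s.env := by
      exact Finset.sum_map_toList T fun u =>
        mobiusCoeff φ u * ((bigOr φ u).count fs.toFinset a b s.env : ℤ)
    rw [h4, ← this] at hv2
    push_cast at hv2
    -- The signed sum is a count, hence non-negative, and truncated subtraction gives it correctly.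
    omega

/-- Liftable formulas can be evaluated. -/
theorem PEForm.Liftable.computable {φ : PEForm S} (h : φ.Liftable) : φ.Computable := by
  induction h with
  | tru => exact computable_tru
  | fls => exact computable_fls
  | atom A => exact computable_atom A
  | eq t u => exact computable_eq t u
  | lt t u => exact computable_lt t u
  | equiv h _ ih => exact ih.equiv h
  | join h _ _ ih1 ih2 => exact ih1.join ih2 h
  | union h _ _ ih1 ih2 => exact ih1.union ih2 h
  | project h _ ih => exact ih.project h
  | mobius φ _ ih => exact computable_mobius φ ih

end Table

/-! ### Shapley values as sums over coalitions -/

section ShapleyCount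
open Finset
open scoped Nat

/-! ### Permutations with a given set of predecessors -/

section Fintype
variable {X : Type*} [Fintype X]

/-- The elements before a are those of s exactly if the numbering lists s first and a immediately
afterwards. -/
theorem filter_lt_eq_iff (f : Numbering X) (s : Finset X) (a : X) :
    (univ.filter fun b => f b < f a) = s ↔ f.IsPrefix s ∧ (f a : ℕ) = s.card := by
  constructor
  · rintro rfl
    have h : ((univ.filter fun b => f b < f a).card : ℕ) = f a := by
      have : (univ.filter fun b => f b < f a) = (Finset.Iio (f a)).map f.symm.toEmbedding := by
        ext b
        simp
      rw [this, card_map, Fin.card_Iio]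
    refine ⟨fun x => ?_, h.symm⟩
    rw [h]
    simp
  · rintro ⟨h1, h2⟩
    ext b
    rw [h1 b, ← h2]
    simp

variable [DecidableEq X]

/-- By symmetry: for x outside s, swapping x and a matches the numberings in which x follows s with
those in which a does. Summed over the |X| - |s| choices of x, they are all numberings that start
with s, of which there are |s|!(|X| - |s|)!. -/
theorem card_filter_prefix_and_eq (s : Finset X) {a : X} (ha : a ∉ s) :
    (univ.filter fun f : Numbering X => f.IsPrefix s ∧ (f a : ℕ) = s.card).card =
      s.card ! * (Fintype.card X - 1 - s.card)! := by
  set c := fun a => (univ.filter fun f : Numbering X => f.IsPrefix s ∧ (f a : ℕ) = s.card).card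
    with hc
  have hlt : s.card < Fintype.card X := by
    rw [← card_univ]
    exact card_lt_card ((ssubset_univ_iff).2 fun h => ha (h ▸ mem_univ a))
  have hmem : ∀ x ∉ s, ∀ y, Equiv.swap x a y ∈ s ↔ y ∈ s := by
    intro x hx y
    rcases eq_or_ne y x with rfl | h1
    · simp [ha, hx]
    rcases eq_or_ne y a with rfl | h2
    · simp [ha, hx]
    rw [Equiv.swap_apply_of_ne_of_ne h1 h2]
  have hsymm : ∀ x ∉ s, c x = c a := by
    intro x hx
    refine card_bij' (fun f _ => (Equiv.swap x a).trans f) (fun f _ => (Equiv.swap x a).trans f)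
      ?_ ?_ ?_ ?_
    · intro f hf
      simp only [mem_filter, mem_univ, true_and] at hf ⊢
      exact ⟨fun y => (hmem x hx y).symm.trans (hf.1 _), by simpa using hf.2⟩
    · intro f hf
      simp only [mem_filter, mem_univ, true_and] at hf ⊢
      exact ⟨fun y => (hmem x hx y).symm.trans (hf.1 _), by simpa using hf.2⟩
    · intro f hf; ext; simp
    · intro f hf; ext; simp
  have hsum : ∑ x ∈ sᶜ, c x = (Numbering.prefixed s).card := by
    rw [hc, ← card_biUnion]
    · congr 1
      ext f
      simp only [mem_biUnion, mem_filter, mem_univ, true_and, mem_compl, Numbering.mem_prefixed]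
      constructor
      · rintro ⟨x, -, h, -⟩
        exact h
      · intro h
        refine ⟨f.symm ⟨s.card, hlt⟩, ?_, h, by simp⟩
        rw [h]
        simp
    · intro x _ y _ hxy
      rw [Function.onFun, disjoint_left]
      intro f hf hf'
      simp only [mem_filter, mem_univ, true_and] at hf hf'
      exact hxy (f.injective (Fin.ext (hf.2.trans hf'.2.symm)))
  rw [sum_congr rfl fun x hx => hsymm x (mem_compl.1 hx), sum_const, smul_eq_mul, card_compl,
    Numbering.card_prefixed] at hsum
  obtain ⟨m, hm⟩ : ∃ m, Fintype.card X - s.card = m + 1 := ⟨Fintype.card X - s.card - 1, by omega⟩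
  rw [show Fintype.card X - 1 - s.card = m by omega]
  rw [hm, Nat.factorial_succ] at hsum
  have : (m + 1) * c a = (m + 1) * (s.card ! * m !) := by rw [hsum]; ring
  exact Nat.eq_of_mul_eq_mul_left (Nat.succ_pos m) this

theorem sum_equiv_filter_lt (m : ℕ) (hm : Fintype.card X = m) (a : X) (g : Finset X → ℚ) :
    ∑ π : X ≃ Fin m, g (univ.filter fun b => π b < π a) =
      ∑ s ∈ (univ.erase a).powerset, (s.card ! * (m - 1 - s.card)! : ℕ) * g s := by
  subst hm
  rw [← sum_fiberwise_of_maps_to (s := univ) (t := (univ.erase a).powerset)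
    (g := fun π : X ≃ Fin (Fintype.card X) => univ.filter fun b => π b < π a)]
  · refine sum_congr rfl fun s hs => ?_
    rw [sum_congr rfl fun π hπ => by rw [(mem_filter.1 hπ).2], sum_const, nsmul_eq_mul]
    congr 2
    have ha : a ∉ s := fun h => by simpa using mem_powerset.1 hs h
    rw [← card_filter_prefix_and_eq s ha]
    congr 1
    ext f
    simp only [mem_filter, mem_univ, true_and]
    exact filter_lt_eq_iff f s a
  · intro π _
    rw [mem_powerset]
    intro b hb
    simp only [mem_filter, mem_univ, true_and] at hb
    simp only [mem_erase, mem_univ, and_true]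
    rintro rfl
    exact lt_irrefl _ hb

end Fintype

theorem shapleyValue_eq {α : Type*} [DecidableEq α] (L : Finset α) (G : Finset α → ℚ) (a : L) :
    shapleyValue L G a = 1 / (L.card ! : ℚ) * ∑ s ∈ (L.erase a).powerset,
      (s.card ! * (L.card - 1 - s.card)! : ℕ) * (G (insert (a : α) s) - G s) := by
  unfold shapleyValue
  congr 1
  have := sum_equiv_filter_lt L.card (Fintype.card_coe L) a fun s =>
    G (insert (a : α) (s.map (Function.Embedding.subtype _))) -
      G (s.map (Function.Embedding.subtype _))
  refine (Eq.trans ?_ this).trans ?_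
  · rfl
  · refine sum_bij' (fun s _ => s.map (Function.Embedding.subtype _))
      (fun s _ => s.subtype (· ∈ L)) ?_ ?_ ?_ ?_ ?_
    · intro s hs
      rw [mem_powerset] at hs ⊢
      intro x hx
      obtain ⟨y, hy, rfl⟩ := mem_map.1 hx
      have := hs hy
      simp only [mem_erase, mem_univ, and_true] at this
      exact mem_erase.2 ⟨fun h => this (Subtype.ext h), y.2⟩
    · intro s hs
      rw [mem_powerset] at hs ⊢
      intro x hx
      have := hs (mem_subtype.1 hx)
      simp only [mem_erase, mem_univ, and_true]
      rintro rfl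
      simp at this
    · intro s hs
      ext x
      simp
    · intro s hs
      rw [mem_powerset] at hs
      rw [subtype_map]
      exact filter_true_of_mem fun x hx => mem_of_mem_erase (hs hx)
    · intro s hs
      rw [card_map]

/-! ### Coalitions counted by size -/

variable {S : Schema}

open Classical in
/-- The number of sets of `k` facts from `D` that satisfy `q`. -/
noncomputable def slices {α : Type*} (q : Finset α → Prop) (D : Finset α) (k : ℕ) : ℕ :=
  ((D.powersetCard k).filter q).card

theorem slices_le {α : Type*} (q : Finset α → Prop) (D : Finset α) (k : ℕ) :
    slices q D k ≤ 2 ^ D.card := by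
  classical
  rw [← card_powerset]
  refine card_le_card fun s hs => ?_
  simp only [mem_filter, mem_powersetCard] at hs
  exact mem_powerset.2 hs.1.1

theorem sum_powerset_card_mul {α : Type*} {R : Type*} [CommSemiring R] (q : Finset α → Prop)
    [DecidablePred q] (D : Finset α) (w : ℕ → R) :
    ∑ E ∈ D.powerset, w E.card * (if q E then 1 else 0) =
      ∑ k ∈ range (D.card + 1), w k * (slices q D k : R) := by
  classical
  rw [sum_powerset]
  refine sum_congr rfl fun k _ => ?_
  rw [slices, card_filter]
  push_cast
  rw [mul_sum]
  refine sum_congr rfl fun E hE => ?_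
  rw [(mem_powersetCard.1 hE).2]

/-- The number of sets of `k` endogenous facts other than `f` that satisfy `q` with the exogenous
facts. -/
noncomputable def slicesWithout (q : BoolQuery S) (Dn Dx : Finset (DBFact S)) (f : DBFact S)
    (k : ℕ) : ℕ := slices (fun E => q (E ∪ Dx)) (Dn.erase f) k

/-- The number of sets of `k` endogenous facts other than `f` that satisfy `q` with `f` and the
exogenous facts. -/
noncomputable def slicesWith (q : BoolQuery S) (Dn Dx : Finset (DBFact S)) (f : DBFact S)
    (k : ℕ) : ℕ := slices (fun E => q (insert f E ∪ Dx)) (Dn.erase f) k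

/-- The constant q(Dx) cancels in the marginal contributions. Two sums of natural numbers are kept
apart so that the machine can compute each of them. -/
theorem queryShapley_eq (q : BoolQuery S) (Dn Dx : Finset (DBFact S)) (f : Dn) :
    queryShapley q Dn Dx f =
      (((∑ k ∈ range Dn.card, k ! * (Dn.card - 1 - k)! * slicesWith q Dn Dx f k : ℕ) : ℚ) -
        (∑ k ∈ range Dn.card, k ! * (Dn.card - 1 - k)! * slicesWithout q Dn Dx f k : ℕ)) /
        (Dn.card ! : ℚ) := by
  classical
  have hc : (Dn.erase f).card + 1 = Dn.card := card_erase_add_one f.2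
  rw [queryShapley, shapleyValue_eq, one_div_mul_eq_div]
  congr 1
  simp only [sub_sub_sub_cancel_right, mul_sub, sum_sub_distrib, BoolQuery.val]
  have h1 := sum_powerset_card_mul (R := ℚ) (fun E => q (insert (f : DBFact S) E ∪ Dx)) (Dn.erase f)
    fun k => ((k ! * (Dn.card - 1 - k)! : ℕ) : ℚ)
  have h2 := sum_powerset_card_mul (R := ℚ) (fun E => q (E ∪ Dx)) (Dn.erase f)
    fun k => ((k ! * (Dn.card - 1 - k)! : ℕ) : ℚ)
  rw [hc] at h1 h2
  push_cast at h1 h2 ⊢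
  exact congrArg₂ (· - ·) h1 h2

/-! ### The slice counts as digits of a weighted count -/

/-- An element whose weight of absence is 0 and of presence 1 is forced to be present at no cost;
this is how exogenous facts are treated. -/
theorem wsum_union {α : Type*} [DecidableEq α] {D D' : Finset α} {a b : α → ℕ}
    {F : Finset α → ℕ} (hd : Disjoint D D') (h : ∀ g ∈ D', a g = 1 ∧ b g = 0) :
    wsum (D ∪ D') a b F = wsum D a b fun E => F (E ∪ D') := by
  induction D' using Finset.induction_on generalizing F with
  | empty => simp
  | insert g D' hg ih =>
    rw [disjoint_insert_right] at hd
    have h1 := h g (by simp)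
    rw [union_insert, wsum_insert (by simp [hg, hd.1]), h1.1, h1.2, zero_mul, zero_add, one_mul,
      ih hd.2 fun x hx => h x (by simp [hx])]
    simp

theorem wsum_eq_sum_slices {α : Type*} [DecidableEq α] {D : Finset α} {a b : α → ℕ} {B : ℕ}
    (h : ∀ g ∈ D, a g = B ∧ b g = 1) (q : Finset α → Prop) :
    wmc D a b q = ∑ k ∈ range (D.card + 1), B ^ k * slices q D k := by
  classical
  have := sum_powerset_card_mul (R := ℕ) q D fun k => B ^ k
  simp only [Nat.cast_id] at this
  rw [← this, wmc, wsum]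
  refine sum_congr rfl fun E hE => ?_
  rw [mem_powerset] at hE
  rw [prod_congr rfl fun g hg => (h g (hE hg)).1,
    prod_congr rfl fun g hg => (h g (mem_sdiff.1 hg).1).2, prod_const, prod_const_one, mul_one]

/-- The weight of membership: `B` for endogenous facts but `B ^ n` for `f`, and `1` for exogenous
facts. -/
def factWeight (Dn : Finset (DBFact S)) (f g : DBFact S) : ℕ :=
  if g = f then (2 ^ Dn.card) ^ Dn.card else if g ∈ Dn then 2 ^ Dn.card else 1

/-- The weight of absence. -/
def factCoweight (Dn : Finset (DBFact S)) (g : DBFact S) : ℕ := if g ∈ Dn then 1 else 0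

/-- Case distinction on the presence of f, which contributes a factor B^n. The remaining n - 1
endogenous facts give B^k with k < n, so the two cases occupy disjoint ranges of exponents. -/
theorem wmc_factWeight (q : BoolQuery S) {Dn Dx : Finset (DBFact S)} (hd : Disjoint Dn Dx)
    {f : DBFact S} (hf : f ∈ Dn) :
    wmc (Dn ∪ Dx) (factWeight Dn f) (factCoweight Dn) q =
      (∑ k ∈ range Dn.card, (2 ^ Dn.card) ^ k * slicesWithout q Dn Dx f k) +
      (2 ^ Dn.card) ^ Dn.card *
        ∑ k ∈ range Dn.card, (2 ^ Dn.card) ^ k * slicesWith q Dn Dx f k := by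
  classical
  have hc : (Dn.erase f).card + 1 = Dn.card := card_erase_add_one hf
  have hw : ∀ g ∈ Dn.erase f, factWeight Dn f g = 2 ^ Dn.card ∧ factCoweight Dn g = 1 := by
    intro g hg
    rw [mem_erase] at hg
    simp [factWeight, factCoweight, hg.1, hg.2]
  rw [wmc, wsum_union hd]
  · obtain ⟨h1, h2⟩ : factWeight Dn f f = (2 ^ Dn.card) ^ Dn.card ∧ factCoweight Dn f = 1 := by
      simp [factWeight, factCoweight, hf]
    have h3 := wsum_eq_sum_slices hw fun E => q (E ∪ Dx)
    have h4 := wsum_eq_sum_slices hw fun E => q (insert f E ∪ Dx)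
    rw [hc] at h3 h4
    have key := wsum_insert (D := Dn.erase f) (f := f) (a := factWeight Dn f)
      (b := factCoweight Dn) (F := fun E => if q (E ∪ Dx) then 1 else 0) (by simp)
    rw [insert_erase hf, h1, h2, one_mul] at key
    unfold slicesWithout slicesWith
    rw [← h3, ← h4, wmc, wmc]
    convert key
  · intro g hg
    have hg' : g ∉ Dn := fun h => disjoint_left.1 hd h hg
    have hgf : g ≠ f := fun h => hg' (h ▸ hf)
    simp [factWeight, factCoweight, hg', hgf]

/-- Exogenous facts contribute 1, each other endogenous fact at most 2^(n+1) and f at most 2^(n²+1).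
As n ≥ 1, the exponents add up to at most 2n(n+1). -/
theorem wtot_factWeight_le {Dn Dx : Finset (DBFact S)} (hd : Disjoint Dn Dx) {f : DBFact S}
    (hf : f ∈ Dn) :
    wtot (Dn ∪ Dx) (factWeight Dn f) (factCoweight Dn) ≤ 2 ^ (2 * Dn.card * (Dn.card + 1)) := by
  set n := Dn.card with hn
  have hc : (Dn.erase f).card + 1 = n := card_erase_add_one hf
  rw [wtot, prod_union hd, prod_eq_one (s := Dx), mul_one, ← mul_prod_erase _ _ hf]
  · have hle : ∀ g ∈ Dn.erase f, factWeight Dn f g + factCoweight Dn g ≤ 2 ^ (n + 1) := by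
      intro g hg
      rw [mem_erase] at hg
      have := Nat.one_le_two_pow (n := n)
      simp only [factWeight, factCoweight, hg.1, hg.2, if_true, if_false, ← hn, pow_succ]
      omega
    have h1 : ∏ g ∈ Dn.erase f, (factWeight Dn f g + factCoweight Dn g) ≤ 2 ^ ((n + 1) * n) := by
      refine (prod_le_pow_card _ _ _ hle).trans ?_
      rw [← pow_mul]
      exact Nat.pow_le_pow_right (by simp) (Nat.mul_le_mul_left _ (by omega))
    have h2 : factWeight Dn f f + factCoweight Dn f ≤ 2 ^ (n * n + 1) := by
      have := Nat.one_le_two_pow (n := n * n)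
      simp only [factWeight, factCoweight, hf, if_true, ← hn, pow_succ, ← pow_mul]
      omega
    refine (Nat.mul_le_mul h2 h1).trans ?_
    rw [← pow_add]
    refine Nat.pow_le_pow_right (by simp) ?_
    have : 1 ≤ n := by omega
    nlinarith
  · intro g hg
    have hg' : g ∉ Dn := fun h => disjoint_left.1 hd h hg
    have hgf : g ≠ f := fun h => hg' (h ▸ hf)
    simp [factWeight, factCoweight, hg', hgf]

/-- Weights are odds: a product of factors a/(a+b) and b/(a+b) over all facts has the common
denominator ∏ (a+b). -/
theorem queryProb_eq_wmc_div (q : BoolQuery S) (D : Finset (DBFact S)) (a b : DBFact S → ℕ)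
    (h : ∀ g ∈ D, 0 < a g + b g) (π : DBFact S → ℚ)
    (hπ : ∀ g ∈ D, π g = (a g : ℚ) / (a g + b g : ℕ)) :
    queryProb q D π = (wmc D a b q : ℚ) / wtot D a b := by
  classical
  rw [queryProb, wmc, wsum, Nat.cast_sum, sum_div]
  refine sum_congr rfl fun E hE => ?_
  rw [mem_powerset] at hE
  have h1 : ∏ g ∈ E, π g = ((∏ g ∈ E, a g : ℕ) : ℚ) / (∏ g ∈ E, (a g + b g) : ℕ) := by
    rw [Nat.cast_prod, Nat.cast_prod, ← prod_div_distrib]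
    exact prod_congr rfl fun g hg => hπ g (hE hg)
  have h2 : ∏ g ∈ D \ E, (1 - π g) =
      ((∏ g ∈ D \ E, b g : ℕ) : ℚ) / (∏ g ∈ D \ E, (a g + b g) : ℕ) := by
    rw [Nat.cast_prod, Nat.cast_prod, ← prod_div_distrib]
    refine prod_congr rfl fun g hg => ?_
    have hg' := (mem_sdiff.1 hg).1
    have := h g hg'
    rw [hπ g hg', eq_div_iff (by positivity), sub_mul, div_mul_cancel₀ _ (by positivity)]
    push_cast
    ring
  rw [h1, h2, wtot, ← prod_sdiff hE, BoolQuery.val, div_mul_div_comm, div_mul_eq_mul_div]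
  by_cases hq : q E
  · simp only [if_pos hq]
    push_cast
    congr 1
    · ring
  · simp [hq]

end ShapleyCount

namespace WP
variable {O : List ℕ → List ℕ} {L : ℕ} {s : MState} {Q : MState → Prop} {e c j : Ex} {i : ℕ}

/-- Here and in the next two rules the new configuration is a variable with an equation, so that
goals after many assignments do not contain nested updates. -/
theorem set' (hok : Bdd L s → e.Ok L s) (hQ : ∀ s', s' = s.setReg i (e.val s) → Q s') :
    WP O L (.set i e) s Q := .set hok (hQ _ rfl)

theorem seta' (hok : Bdd L s → c.Ok L s ∧ j.Ok L s ∧ e.Ok L s ∧ c.val s + j.val s ≤ L)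
    (hQ : ∀ s', s' = s.setArr (c.val s) (j.val s) (e.val s) → Q s') :
    WP O L (.seta c j e) s Q := .seta hok (hQ _ rfl)

theorem read' (hQ : ∀ s', s' = { s with inp := s.inp.tail }.setReg i (s.inp.headD 0) → Q s') :
    WP O L (.read i) s Q := .read (hQ _ rfl)

end WP

/-! ### Reading the input -/

section Reading
variable {S : Schema} {O : List ℕ → List ℕ} {L : ℕ}

/-- The distinct values `ds` are in column `0`, and register `3` holds their number. -/
structure DomState (ds : List ℕ) (s : MState) : Prop where
  len : s.reg 3 = ds.length
  val : ∀ (j : ℕ) (h : j < ds.length), s.arr 0 j = ds[j]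
  nodup : ds.Nodup

/-- Adds the value in register `10` to the list of values. -/
def addDom : Cmd :=
  .set 11 0 ;;
  .for 12 (.reg 3) (.ite (Ex.eqE (.arr 0 (.reg 12)) (.reg 10)) (.set 11 1) .skip) ;;
  .ite (.reg 11) .skip (.seta 0 (.reg 3) (.reg 10) ;; .set 3 (.reg 3 + 1))

theorem wp_addDom {ds : List ℕ} {s : MState} (hs : DomState ds s) (hL : ds.length + 1 ≤ L) :
    WP O L addDom s fun s' => ∃ ds', DomState ds' s' ∧ ds ⊆ ds' ∧ s.reg 10 ∈ ds' ∧
      ds'.length ≤ ds.length + 1 ∧ ∀ c j, c ≠ 0 → s'.arr c j = s.arr c j := by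
  have hlt : L < 2 ^ L := Nat.lt_two_pow_self
  refine WP.seq (WP.set (fun _ => by simp) (WP.seq (WP.for ds.length
    (fun k s' => s'.reg 11 = if s.reg 10 ∈ ds.take k then 1 else 0) (by omega) ?_ ?_ ?_ ?_)))
  · simp [MState.setReg_reg]
  · intro k _ s' _ hF _
    refine ⟨trivial, ?_⟩
    rw [Ex.val_reg, hF.reg 3 (by simp [Cmd.Keeps])]
    simpa [MState.setReg_reg] using hs.len
  · intro k hk s' hF hI h12
    have h10 : s'.reg 10 = s.reg 10 := by
      rw [hF.reg 10 (by simp [Cmd.Keeps])]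
      simp [MState.setReg_reg]
    have harr : s'.arr 0 k = ds[k] := by
      rw [hF.arr (by simp [Cmd.Keeps])]
      exact hs.val k hk
    have htk : s.reg 10 ∈ ds.take (k + 1) ↔ s.reg 10 ∈ ds.take k ∨ ds[k] = s.reg 10 := by
      rw [List.take_succ_eq_append_getElem hk, List.mem_append, List.mem_singleton,
        eq_comm (a := ds[k])]
    refine WP.ite (fun _ => Ex.ok_eqE (by omega) ?_ trivial) ?_ ?_
    · simp only [Ex.ok_arr, Ex.ok_ofNat, Ex.ok_reg, Ex.val_ofNat, Ex.val_reg, h12]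
      exact ⟨by omega, trivial, by omega⟩
    · intro hv
      have hv' : ds[k] = s.reg 10 := by
        by_contra h
        simp [h12, h10, harr, h] at hv
      refine WP.set (fun _ => by simp; omega) ?_
      simp [MState.setReg_reg, h12, htk, hv']
    · intro hv
      have hv' : ds[k] ≠ s.reg 10 := by
        intro h
        simp [h12, h10, harr, h] at hv
      refine WP.skip ⟨h12, ?_⟩
      simp only [MState.setReg_reg, htk, hv', or_false]
      exact hI
  · intro s' hF hI
    rw [List.take_length] at hI
    have h10 : s'.reg 10 = s.reg 10 := by
      rw [hF.reg 10 (by simp [Cmd.Keeps])]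
      simp [MState.setReg_reg]
    have h3 : s'.reg 3 = ds.length := by
      rw [hF.reg 3 (by simp [Cmd.Keeps])]
      simpa [MState.setReg_reg] using hs.len
    have harr : s'.arr = s.arr := hF.arr (by simp [Cmd.Keeps])
    refine WP.ite (fun _ => trivial) ?_ ?_
    · intro hv
      have hmem : s.reg 10 ∈ ds := by
        by_contra h
        simp [hI, h] at hv
      exact WP.skip ⟨ds, ⟨h3, by rw [harr]; exact hs.val, hs.nodup⟩, fun _ h => h, hmem, by omega,
        fun c j _ => by rw [harr]⟩
    · intro hv
      have hmem : s.reg 10 ∉ ds := by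
        intro h
        simp [hI, h] at hv
      refine WP.seq (WP.seta (fun _ => ?_) (WP.set (fun _ => ?_) ?_))
      · simp only [Ex.ok_ofNat, Ex.ok_reg, Ex.val_ofNat, Ex.val_reg, h3]
        exact ⟨by omega, trivial, trivial, by omega⟩
      · simp only [Ex.ok_add, Ex.ok_reg, Ex.ok_ofNat, Ex.val_reg, MState.setArr_reg, h3,
          Ex.val_ofNat]
        exact ⟨trivial, by omega, by omega⟩
      · refine ⟨ds ++ [s.reg 10], ⟨?_, ?_, ?_⟩, by simp, by simp, by simp, ?_⟩
        · simp [MState.setReg_reg, h3]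
        · intro j hj
          simp only [MState.setReg_arr, MState.setArr_arr, Ex.val_ofNat, Ex.val_reg, h3, h10, harr]
          simp only [List.length_append, List.length_singleton] at hj
          by_cases hj' : j = ds.length
          · subst hj'
            simp
          · rw [if_neg (by tauto), hs.val j (by omega), List.getElem_append_left (by omega)]
        · rw [List.nodup_append]
          exact ⟨hs.nodup, by simp, by
            simp only [List.mem_singleton, forall_eq]
            exact fun a ha h => hmem (h ▸ ha)⟩
        · intro c j hc
          simp [MState.setArr_arr, hc, harr]

/-- Reads a fact into the row in register `6`. -/
def readFact : Cmd :=
  .read 8 ;; .seta 2 (.reg 6) (.reg 8) ;;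
  .for 9 (.arr 1 (.reg 8)) (.read 10 ;; .seta (5 + .reg 9) (.reg 6) (.reg 10) ;; addDom)

/-- Column `1` holds the arities of the relations. -/
def ArityState (S : Schema) (s : MState) : Prop :=
  ∀ R : Fin S.numRel, s.arr 1 R = S.arity R

/-- Column 0 belongs to the list of values, which may grow, and is therefore left out of the last
clause. Elsewhere only the current row changes, from column 2 on, so that rows read before and the
arities survive. -/
theorem wp_readFact {ds : List ℕ} {s : MState} {f : DBFact S} {rest : List ℕ}
    (hs : DomState ds s) (hA : ArityState S s) (hinp : s.inp = encFact f ++ rest)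
    (hL : 10 + ds.length + s.reg 6 + S.numRel + S.arity f.1 ≤ L) :
    WP O L readFact s fun s' => ∃ ds', DomState ds' s' ∧ ds ⊆ ds' ∧ (∀ i, f.2 i ∈ ds') ∧
      ds'.length ≤ ds.length + S.arity f.1 ∧ s'.inp = rest ∧ IsRow s' (s.reg 6) f ∧
      s'.reg 8 = f.1 ∧ ∀ c j, c ≠ 0 → (c < 2 ∨ j ≠ s.reg 6) → s'.arr c j = s.arr c j := by
  have hlt : L < 2 ^ L := Nat.lt_two_pow_self
  have hR := f.1.2
  refine WP.seq (WP.read' fun s0 hs0 => ?_)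
  simp only [hinp, encFact, List.cons_append, List.headD_cons, List.tail_cons] at hs0
  refine WP.seq (WP.seta' (fun _ => ?_) fun s1 hs1 => ?_)
  · simp only [Ex.ok_ofNat, Ex.ok_reg, Ex.val_ofNat, Ex.val_reg, hs0, MState.setReg_reg]
    exact ⟨by omega, trivial, trivial, by simp; omega⟩
  have e6 : s1.reg 6 = s.reg 6 := by simp [hs1, hs0, MState.setReg_reg]
  have e8 : s1.reg 8 = f.1 := by simp [hs1, hs0, MState.setReg_reg]
  have e3 : s1.reg 3 = s.reg 3 := by simp [hs1, hs0, MState.setReg_reg]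
  have earr : ∀ c j, s1.arr c j = if c = 2 ∧ j = s.reg 6 then (f.1 : ℕ) else s.arr c j := by
    intro c j
    simp [hs1, hs0, MState.setArr_arr, MState.setReg_reg]
  have einp : s1.inp = List.ofFn f.2 ++ rest := by simp [hs1, hs0]
  clear hs1
  refine WP.for (S.arity f.1) (fun k s' => ∃ ds', DomState ds' s' ∧ ds ⊆ ds' ∧
      (∀ i : Fin (S.arity f.1), (i : ℕ) < k → f.2 i ∈ ds') ∧
      ds'.length ≤ ds.length + k ∧ s'.inp = (List.ofFn f.2).drop k ++ rest ∧
      (∀ i : Fin (S.arity f.1), (i : ℕ) < k → s'.arr (5 + i) (s.reg 6) = f.2 i) ∧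
      ∀ c j, c ≠ 0 → (c < 5 ∨ j ≠ s.reg 6) → s'.arr c j = s1.arr c j) (by omega) ?_ ?_ ?_ ?_
  · exact ⟨ds, ⟨by simp [MState.setReg_reg, e3, hs.len], fun j h => by simp [earr, hs.val j h],
      hs.nodup⟩, fun _ h => h, by simp, by simp, by simp [einp], by simp, by simp⟩
  · rintro k hk s' _ hF ⟨ds', -, -, -, -, -, -, harr⟩
    have h8 : s'.reg 8 = f.1 := (hF.reg 8 (by simp [Cmd.Keeps, addDom])).trans e8
    simp only [Ex.ok_arr, Ex.ok_ofNat, Ex.ok_reg, Ex.val_arr, Ex.val_ofNat, Ex.val_reg, h8]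
    refine ⟨⟨by omega, trivial, by omega⟩, ?_⟩
    rw [harr 1 _ (by simp) (by simp), earr, if_neg (by simp), hA]
  · rintro k hk s' hF ⟨ds', hds, hsub, hmem, hlen, hin, hcol, harr⟩ h9
    have h6 : s'.reg 6 = s.reg 6 := (hF.reg 6 (by simp [Cmd.Keeps, addDom])).trans e6
    have hd : (List.ofFn f.2).drop k = f.2 ⟨k, hk⟩ :: (List.ofFn f.2).drop (k + 1) := by
      rw [List.drop_eq_getElem_cons (by simpa using hk)]
      simp
    refine WP.seq (WP.read' fun s0' hs0' => ?_)
    simp only [hin, hd, List.cons_append, List.headD_cons, List.tail_cons] at hs0'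
    refine WP.seq (WP.seta' (fun _ => ?_) fun s2 hs2 => ?_)
    · simp [hs0', MState.setReg_reg, h9, h6]
      omega
    have g10 : s2.reg 10 = f.2 ⟨k, hk⟩ := by simp [hs2, hs0', MState.setReg_reg]
    have g9 : s2.reg 9 = k := by simp [hs2, hs0', MState.setReg_reg, h9]
    have g3 : s2.reg 3 = s'.reg 3 := by simp [hs2, hs0', MState.setReg_reg]
    have garr : ∀ c j, s2.arr c j = if c = 5 + k ∧ j = s.reg 6 then f.2 ⟨k, hk⟩ else
        s'.arr c j := by
      intro c j
      simp [hs2, hs0', MState.setArr_arr, MState.setReg_reg, h9, h6]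
    have ginp : s2.inp = (List.ofFn f.2).drop (k + 1) ++ rest := by simp [hs2, hs0']
    clear hs2
    have hds2 : DomState ds' s2 := ⟨g3.trans hds.len, fun j h => by
      rw [garr, if_neg (by omega), hds.val j h], hds.nodup⟩
    refine (wp_addDom hds2 (by omega)).mono ?_
    rintro s3 - hF3 ⟨ds3, hds3, hsub3, hmem3, hlen3, harr3⟩
    rw [g10] at hmem3
    refine ⟨(hF3.reg 9 (by simp [Cmd.Keeps, addDom])).trans g9, ds3, ?_, ?_, ?_, by omega, ?_, ?_, ?_⟩
    · exact ⟨by simpa [MState.setReg_reg] using hds3.len, hds3.val, hds3.nodup⟩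
    · exact fun x hx => hsub3 (hsub hx)
    · intro i hi
      rcases Nat.lt_succ_iff_lt_or_eq.1 hi with hi | hi
      · exact hsub3 (hmem i hi)
      · obtain rfl : i = ⟨k, hk⟩ := Fin.ext hi
        exact hmem3
    · rw [MState.setReg_inp, hF3.inp (by simp [Cmd.Keeps, addDom]), ginp]
    · intro i hi
      rw [MState.setReg_arr, harr3 _ _ (by omega), garr]
      rcases Nat.lt_succ_iff_lt_or_eq.1 hi with hi | hi
      · rw [if_neg (by omega), hcol i hi]
      · obtain rfl : i = ⟨k, hk⟩ := Fin.ext hi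
        simp
    · intro c j hc h
      rw [MState.setReg_arr, harr3 _ _ hc, garr, if_neg (by omega), harr c j hc h]
  · rintro s' hF ⟨ds', hds, hsub, hmem, hlen, hin, hcol, harr⟩
    refine ⟨ds', hds, hsub, fun i => hmem i i.2, hlen, ?_, ⟨?_, fun i => hcol i i.2⟩, ?_, ?_⟩
    · rw [hin, List.drop_eq_nil_of_le (by simp), List.nil_append]
    · rw [harr 2 _ (by simp) (by simp), earr, if_pos ⟨rfl, rfl⟩]
    · exact (hF.reg 8 (by simp [Cmd.Keeps, addDom])).trans e8
    · intro c j hc h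
      rw [harr c j hc (by omega), earr, if_neg (by omega)]

/-- The weighted facts `rows` have been read, and at most `T` values or numbers to be read are
left. -/
structure ReadState (T : ℕ) (rows : List (DBFact S × ℕ × ℕ)) (ds : List ℕ) (s : MState) :
    Prop where
  arity : ArityState S s
  dom : DomState ds s
  mem : ∀ r ∈ rows, ∀ i, r.1.2 i ∈ ds
  size : ds.length + s.inp.length ≤ T
  len : s.reg 6 = rows.length
  row : ∀ (j : ℕ) (r : DBFact S × ℕ × ℕ), rows[j]? = some r →
    IsRow s j r.1 ∧ s.arr 3 j = r.2.1 ∧ s.arr 4 j = r.2.2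

/-- Reads as many facts as register `i` says, and gives them weights. -/
def readFacts (i : ℕ) (w w' : Ex) : Cmd :=
  .for 7 (.reg i) (readFact ;; .seta 3 (.reg 6) w ;; .seta 4 (.reg 6) w' ;; .set 6 (.reg 6 + 1))

theorem length_le_flatMap_encFact (l : List (DBFact S)) :
    l.length ≤ (l.flatMap encFact).length := by
  induction l with
  | nil => simp
  | cons f l ih => simp [encFact]; omega

theorem arity_le_sum (R : Fin S.numRel) : S.arity R ≤ ∑ R, S.arity R :=
  Finset.single_le_sum (f := S.arity) (fun _ _ => Nat.zero_le _) (Finset.mem_univ R)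

/-- The sum of the number of values and the length of the unread input never grows, because a value
is added only when a number has been read. So the list of values stays as short as the input. The
weights may depend on register 4 only, which reading does not change. -/
theorem wp_readFacts {T : ℕ} {rows : List (DBFact S × ℕ × ℕ)} {ds : List ℕ} {s : MState}
    (l : List (DBFact S)) {rest : List ℕ} {i : ℕ} {w w' : Ex} {x x' : ℕ}
    (hs : ReadState T rows ds s) (hi : s.reg i = l.length)
    (hi' : i = 1 ∨ i = 13)
    (hw : ∀ s', s'.reg 4 = s.reg 4 → w.Ok L s' ∧ w.val s' = x)
    (hw' : ∀ s', s'.reg 4 = s.reg 4 → w'.Ok L s' ∧ w'.val s' = x')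
    (hinp : s.inp = l.flatMap encFact ++ rest)
    (hL : 20 + T + rows.length + l.length + S.numRel + ∑ R, S.arity R ≤ L) :
    WP O L (readFacts i w w') s fun s' => ∃ ds',
      ReadState T (rows ++ l.map fun f => (f, x, x')) ds' s' ∧ s'.inp = rest := by
  have hlt : L < 2 ^ L := Nat.lt_two_pow_self
  refine WP.for l.length (fun k s' => ∃ ds',
    ReadState T (rows ++ (l.take k).map fun f => (f, x, x')) ds' s' ∧
      s'.inp = (l.drop k).flatMap encFact ++ rest) (by omega) ?_ ?_ ?_ ?_
  · refine ⟨ds, ⟨hs.arity, ⟨?_, hs.dom.val, hs.dom.nodup⟩, ?_, hs.size, ?_, ?_⟩, by simpa using hinp⟩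
    · simpa [MState.setReg_reg] using hs.dom.len
    · simpa using hs.mem
    · simpa [MState.setReg_reg] using hs.len
    · intro j r hr
      rw [List.take_zero, List.map_nil, List.append_nil] at hr
      exact hs.row j r hr
  · intro k _ s' _ hF _
    refine ⟨trivial, ?_⟩
    rw [Ex.val_reg, hF.reg i (by
      rcases hi' with rfl | rfl <;> simp [Cmd.Keeps, addDom, readFact]), hi]
  · rintro k hk s' hF ⟨ds', hs', hin⟩ h7
    rw [List.drop_eq_getElem_cons hk, List.flatMap_cons, List.append_assoc] at hin
    have hlen := hs'.len
    have hsize := hs'.size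
    rw [List.length_append, List.length_map, List.length_take, min_eq_left hk.le] at hlen
    have hlen' := hlen
    have har := arity_le_sum (l[k]).1
    have h4 : s'.reg 4 = s.reg 4 := hF.reg 4 (by simp [Cmd.Keeps, addDom, readFact])
    refine WP.seq ((wp_readFact hs'.dom hs'.arity hin (by omega)).mono ?_)
    rintro s1 - hF1 ⟨ds1, hd1, hsub1, hmem1, hlen1, hin1, hrow1, -, harr1⟩
    have h6 : s1.reg 6 = s'.reg 6 := hF1.reg 6 (by simp [Cmd.Keeps, addDom, readFact])
    have h7' : s1.reg 7 = k := (hF1.reg 7 (by simp [Cmd.Keeps, addDom, readFact])).trans h7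
    have h4' : s1.reg 4 = s.reg 4 := (hF1.reg 4 (by simp [Cmd.Keeps, addDom, readFact])).trans h4
    obtain ⟨k1, k2⟩ := hw s1 h4'
    refine WP.seq (WP.seta' (fun _ => ⟨by simp; omega, trivial, k1, by
      simp [h6, hlen]; omega⟩) fun t1 ht1 => ?_)
    obtain ⟨k3, k4⟩ := hw' t1 (by simpa [ht1] using h4')
    refine WP.seq (WP.seta' (fun _ => ⟨by simp; omega, trivial, k3, by
      simp [ht1, h6, hlen]; omega⟩) fun t2 ht2 => ?_)
    refine WP.set' (fun _ => by simp [ht2, ht1, h6, hlen]; omega) fun s2 hs2 => ?_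
    simp only [k2, k4, Ex.val_add, Ex.val_ofNat, Ex.val_reg, h6, hlen] at ht1 ht2 hs2
    simp only [ht1, ht2, MState.setArr_reg, h6, hlen] at hs2
    have e6 : s2.reg 6 = rows.length + k + 1 := by simp [hs2, MState.setReg_reg]
    have e7 : s2.reg 7 = k := by simp [hs2, MState.setReg_reg, h7']
    have e3 : s2.reg 3 = s1.reg 3 := by simp [hs2, MState.setReg_reg]
    have e_inp : s2.inp = s1.inp := by simp [hs2]
    have earr : ∀ c j, s2.arr c j = if c = 4 ∧ j = rows.length + k then x' else
        if c = 3 ∧ j = rows.length + k then x else s1.arr c j := fun c j => by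
      simp [hs2, MState.setArr_arr]
    clear hs2
    rw [hlen] at hrow1 harr1
    have htake : (l.take (k + 1)).map (fun f => (f, x, x')) =
        (l.take k).map (fun f => (f, x, x')) ++ [(l[k], x, x')] := by
      rw [List.take_succ_eq_append_getElem hk, List.map_append]
      rfl
    refine ⟨e7, ds1, ⟨?_, ⟨?_, ?_, hd1.nodup⟩, ?_, ?_, ?_, ?_⟩, ?_⟩
    · intro R
      rw [MState.setReg_arr, earr, if_neg (by omega), if_neg (by omega),
        harr1 1 R (by omega) (by omega)]
      exact hs'.arity R
    · rw [MState.setReg_of_ne _ _ (by omega), e3, hd1.len]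
    · intro j hj
      rw [MState.setReg_arr, earr, if_neg (by omega), if_neg (by omega), hd1.val j hj]
    · intro r hr
      rw [htake, ← List.append_assoc, List.mem_append, List.mem_singleton] at hr
      rcases hr with hr | rfl
      · exact fun i => hsub1 (hs'.mem r hr i)
      · exact hmem1
    · rw [MState.setReg_inp, e_inp, hin1]
      rw [hin] at hsize
      simp only [List.length_append, encFact, List.length_cons, List.length_ofFn] at hsize ⊢
      omega
    · rw [MState.setReg_of_ne _ _ (by omega), e6]
      simp only [List.length_append, List.length_map, List.length_take]
      omega
    · intro j r hr
      simp only [IsRow, MState.setReg_arr, earr]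
      rw [htake, ← List.append_assoc] at hr
      have hl : (rows ++ (l.take k).map fun f => (f, x, x')).length = rows.length + k := by
        rw [← hs'.len, hlen']
      rcases lt_trichotomy j (rows.length + k) with hj | rfl | hj
      · rw [List.getElem?_append_left (by omega)] at hr
        obtain ⟨⟨r1, r2⟩, r3, r4⟩ := hs'.row j r hr
        refine ⟨⟨?_, fun i => ?_⟩, ?_, ?_⟩
        · rw [if_neg (by omega), if_neg (by omega), harr1 _ _ (by omega) (by omega), r1]
        · rw [if_neg (by omega), if_neg (by omega), harr1 _ _ (by omega) (by omega), r2]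
        · rw [if_neg (by omega), if_neg (by omega), harr1 _ _ (by omega) (by omega), r3]
        · rw [if_neg (by omega), if_neg (by omega), harr1 _ _ (by omega) (by omega), r4]
      · rw [List.getElem?_append_right (by omega), hl, Nat.sub_self] at hr
        obtain rfl : (l[k], x, x') = r := Option.some_inj.1 hr
        refine ⟨⟨?_, fun i => ?_⟩, ?_, ?_⟩
        · rw [if_neg (by omega), if_neg (by omega), hrow1.1]
        · rw [if_neg (by omega), if_neg (by omega), hrow1.2]
        · rw [if_neg (by omega)]; simp
        · simp
      · rw [List.getElem?_eq_none (by rw [List.length_append, List.length_singleton]; omega)] at hr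
        cases hr
    · rw [MState.setReg_inp, e_inp, hin1]
  · rintro s' hF ⟨ds', hs', hin⟩
    rw [List.take_length] at hs'
    exact ⟨ds', hs', by simpa using hin⟩

end Reading

/-! ### Preparing the table -/

section Prepare
variable {S : Schema} {O : List ℕ → List ℕ} {L : ℕ}

/-- Stores the arities in column `1`. -/
def arityTable (S : Schema) : Cmd :=
  (List.finRange S.numRel).foldr
    (fun (R : Fin S.numRel) P => .seta 1 (.const R) (.const (S.arity R)) ;; P) .skip

theorem keeps_arityTable {l : Loc} (h : l ≠ .arr) : (arityTable S).Keeps l := by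
  unfold arityTable
  induction List.finRange S.numRel with
  | nil => simp [Cmd.Keeps]
  | cons R t ih => exact ⟨h, ih⟩

theorem oracleFree_arityTable : (arityTable S).OracleFree := by
  unfold arityTable
  induction List.finRange S.numRel with
  | nil => simp [Cmd.OracleFree]
  | cons R t ih => exact ⟨trivial, ih⟩

theorem wp_arityTable {s : MState} (hL : 1 + S.numRel + ∑ R, S.arity R ≤ L) :
    WP O L (arityTable S) s (ArityState S) := by
  have hlt : L < 2 ^ L := Nat.lt_two_pow_self
  have key : ∀ (t : List (Fin S.numRel)) (s : MState), WP O L (t.foldr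
      (fun (R : Fin S.numRel) P => .seta 1 (.const R) (.const (S.arity R)) ;; P) .skip) s fun s' =>
      ∀ R : Fin S.numRel, R ∈ t ∨ s.arr 1 R = S.arity R → s'.arr 1 R = S.arity R := by
    intro t
    induction t with
    | nil => exact fun s => WP.skip (by simp)
    | cons R t ih =>
      intro s
      have hR := R.2
      have := arity_le_sum R
      refine WP.seq (WP.seta (fun _ => ?_) ((ih _).mono fun s' _ _ h R' hR' => h R' ?_))
      · simp
        omega
      · by_cases hRR : R' = R
        · subst hRR
          simp [MState.setArr_arr]
        · have : (R' : ℕ) ≠ R := fun h => hRR (Fin.ext h)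
          simpa [MState.setArr_arr, hRR, this] using hR'
  exact (key _ s).mono fun s' _ _ h R => h R (.inl (List.mem_finRange R))

/-- With `n` in register `1`, puts `2 ^ n` into register `4` and `(2 ^ n) ^ n` into register `15`. -/
def powers : Cmd :=
  .set 4 1 ;; .for 7 (.reg 1) (.set 4 (.reg 4 + .reg 4)) ;;
  .set 15 1 ;; .for 7 (.reg 1) (.set 15 (.reg 15 * .reg 4))

theorem wp_powers {s : MState} {n : ℕ} (h1 : s.reg 1 = n) (hL : n * n + n < L) :
    WP O L powers s fun s' => s'.reg 4 = 2 ^ n ∧ s'.reg 15 = (2 ^ n) ^ n := by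
  have hlt : L < 2 ^ L := Nat.lt_two_pow_self
  refine WP.seq (WP.set' (fun _ => by simp; omega) fun s1 hs1 => WP.seq (WP.for n
    (fun k s' => s'.reg 4 = 2 ^ k) (by omega) (by simp [hs1, MState.setReg_reg]) ?_ ?_ ?_))
  · intro k _ s' _ hF _
    refine ⟨trivial, ?_⟩
    rw [Ex.val_reg, hF.reg 1 (by simp [Cmd.Keeps]), hs1, MState.setReg_of_ne _ _ (by omega), h1]
  · intro k hk s' _ hI h7
    have : 2 ^ k + 2 ^ k < 2 ^ L := by
      rw [← two_mul, ← pow_succ']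
      exact two_pow_lt_of_lt (by omega)
    refine WP.set (fun _ => by simpa [hI] using this) ?_
    simp [MState.setReg_reg, h7, hI, pow_succ, mul_two]
  intro s2 hF hI
  have h1' : s2.reg 1 = n := by
    rw [hF.reg 1 (by simp [Cmd.Keeps]), hs1, MState.setReg_of_ne _ _ (by omega), h1]
  refine WP.seq (WP.set' (fun _ => by simp; omega) fun s3 hs3 => WP.for n
    (fun k s' => s'.reg 4 = 2 ^ n ∧ s'.reg 15 = (2 ^ n) ^ k) (by omega)
    (by simp [hs3, MState.setReg_reg, hI]) ?_ ?_ fun s' _ h => h)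
  · intro k _ s' _ hF _
    refine ⟨trivial, ?_⟩
    rw [Ex.val_reg, hF.reg 1 (by simp [Cmd.Keeps]), hs3, MState.setReg_of_ne _ _ (by omega), h1']
  · intro k hk s' _ hI h7
    have : (2 ^ n) ^ k * 2 ^ n < 2 ^ L := by
      rw [← pow_succ, ← pow_mul]
      exact two_pow_lt_of_lt ((Nat.mul_le_mul_left n hk).trans_lt (by omega))
    refine WP.set (fun _ => by simpa [hI] using this) ?_
    simp [MState.setReg_reg, h7, hI, pow_succ]

/-- Among the first facts, as many as register `1` says, gives weight register `15` to the one that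
is equal to the fact in the row in register `6`. -/
def markFact : Cmd :=
  .for 7 (.reg 1) (
    .set 14 (Ex.eqE (.arr 2 (.reg 7)) (.arr 2 (.reg 6))) ;;
    .for 9 (.arr 1 (.reg 8))
      (.set 14 (.reg 14 * Ex.eqE (.arr (5 + .reg 9) (.reg 7)) (.arr (5 + .reg 9) (.reg 6)))) ;;
    .ite (.reg 14) (.seta 3 (.reg 7) (.reg 15)) .skip)

theorem IsRow.eq_iff {s : MState} {j k : ℕ} {g f : DBFact S} (hg : IsRow s j g)
    (hf : IsRow s k f) : s.arr 2 j = s.arr 2 k ∧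
      (∀ i < S.arity f.1, s.arr (5 + i) j = s.arr (5 + i) k) ↔ g = f := by
  obtain ⟨R, c⟩ := g
  obtain ⟨R', c'⟩ := f
  rw [hg.1, hf.1]
  constructor
  · rintro ⟨h1, h2⟩
    obtain rfl : R = R' := Fin.ext h1
    congr 1
    funext i
    exact (hg.2 i).symm.trans ((h2 i i.2).trans (hf.2 i))
  · intro h
    cases h
    exact ⟨rfl, fun i hi => (hg.2 ⟨i, hi⟩).trans (hf.2 ⟨i, hi⟩).symm⟩

/-- The given fact stands in a row behind the first `l.length` rows. Comparing the relation and as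
many arguments as that fact has decides equality, since equal relations have equal arities. -/
theorem wp_markFact [DecidableEq (DBFact S)] {s : MState} {l : List (DBFact S)} {f : DBFact S}
    (hA : ArityState S s) (hl : ∀ j g, l[j]? = some g → IsRow s j g) (h1 : s.reg 1 = l.length)
    (hf : IsRow s (s.reg 6) f) (h8 : s.reg 8 = f.1) (h6 : l.length ≤ s.reg 6)
    (hL : 10 + s.reg 6 + S.numRel + S.arity f.1 ≤ L) :
    WP O L markFact s fun s' =>
      (∀ j g, l[j]? = some g → s'.arr 3 j = if g = f then s.reg 15 else s.arr 3 j) ∧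
      ∀ c j, c ≠ 3 ∨ l.length ≤ j → s'.arr c j = s.arr c j := by
  have hlt : L < 2 ^ L := Nat.lt_two_pow_self
  have hR := f.1.2
  refine WP.for l.length (fun k s' =>
    (∀ j g, j < k → l[j]? = some g → s'.arr 3 j = if g = f then s.reg 15 else s.arr 3 j) ∧
      ∀ c j, c ≠ 3 ∨ k ≤ j → s'.arr c j = s.arr c j) (by omega) (by simp) ?_ ?_ ?_
  · intro k _ s' _ hF _
    exact ⟨trivial, by rw [Ex.val_reg, hF.reg 1 (by simp [Cmd.Keeps]), h1]⟩
  · rintro k hk s' hF ⟨hI1, hI2⟩ h7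
    have e6 : s'.reg 6 = s.reg 6 := hF.reg 6 (by simp [Cmd.Keeps])
    have e8 : s'.reg 8 = f.1 := (hF.reg 8 (by simp [Cmd.Keeps])).trans h8
    have e15 : s'.reg 15 = s.reg 15 := hF.reg 15 (by simp [Cmd.Keeps])
    obtain ⟨g, hg⟩ : ∃ g, l[k]? = some g := ⟨_, List.getElem?_eq_getElem hk⟩
    refine WP.seq (WP.set' (fun _ => Ex.ok_eqE (by omega) ?_ ?_) fun s1 hs1 => WP.seq (WP.for
      (S.arity f.1) (fun i s2 => s2.reg 14 = if s.arr 2 k = s.arr 2 (s.reg 6) ∧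
        ∀ i' < i, s.arr (5 + i') k = s.arr (5 + i') (s.reg 6) then 1 else 0) (by omega) ?_ ?_ ?_ ?_))
    · simp [h7]; omega
    · simp [e6]; omega
    · simp [hs1, MState.setReg_reg, h7, e6, hI2 2]
    · intro i _ s2 _ hF2 _
      have f8 : s2.reg 8 = f.1 := by
        rw [hF2.reg 8 (by simp [Cmd.Keeps]), hs1, MState.setReg_of_ne _ _ (by omega), e8]
      simp only [Ex.ok_arr, Ex.ok_ofNat, Ex.ok_reg, Ex.val_arr, Ex.val_ofNat, Ex.val_reg, f8]
      refine ⟨⟨by omega, trivial, by omega⟩, ?_⟩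
      rw [hF2.arr (by simp [Cmd.Keeps]), hs1, MState.setReg_arr, hI2 1 _ (by simp), hA]
    · intro i hi s2 hF2 hI h9
      have f7 : s2.reg 7 = k := by
        rw [hF2.reg 7 (by simp [Cmd.Keeps]), hs1, MState.setReg_of_ne _ _ (by omega), h7]
      have f6 : s2.reg 6 = s.reg 6 := by
        rw [hF2.reg 6 (by simp [Cmd.Keeps]), hs1, MState.setReg_of_ne _ _ (by omega), e6]
      have farr : ∀ j, s2.arr (5 + i) j = s.arr (5 + i) j := fun j => by
        rw [hF2.arr (by simp [Cmd.Keeps]), hs1, MState.setReg_arr, hI2 _ _ (by omega)]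
      refine WP.set' (fun _ => ⟨trivial, Ex.ok_eqE (by omega) ?_ ?_, ?_⟩) fun s3 hs3 => ?_
      · simp [h9, f7]; omega
      · simp [h9, f6]; omega
      · rw [Ex.val_eqE, Ex.val_reg, hI]
        split_ifs <;> omega
      · rw [Ex.val_mul, Ex.val_eqE, Ex.val_reg, hI] at hs3
        simp only [Ex.val_arr, Ex.val_add, Ex.val_ofNat, Ex.val_reg, h9, f7, f6, farr] at hs3
        refine ⟨by simp [hs3, MState.setReg_reg, h9], ?_⟩
        rw [MState.setReg_of_ne _ _ (by omega), hs3, MState.setReg_self, ite_zero_mul_ite_zero, mul_one]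
        exact if_congr (by rw [Nat.forall_lt_succ_right, and_assoc]) rfl rfl
    · intro s2 hF2 hI
      rw [if_congr ((hl k g hg).eq_iff hf) rfl rfl] at hI
      have f7 : s2.reg 7 = k := by
        rw [hF2.reg 7 (by simp [Cmd.Keeps]), hs1, MState.setReg_of_ne _ _ (by omega), h7]
      have f15 : s2.reg 15 = s.reg 15 := by
        rw [hF2.reg 15 (by simp [Cmd.Keeps]), hs1, MState.setReg_of_ne _ _ (by omega), e15]
      have farr : s2.arr = s'.arr := by
        rw [hF2.arr (by simp [Cmd.Keeps]), hs1, MState.setReg_arr]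
      refine WP.ite (fun _ => trivial) (fun hv => ?_) fun hv => ?_
      · have hgf : g = f := by
          by_contra h
          simp [hI, h] at hv
        refine WP.seta (fun _ => ?_) ⟨f7, ?_, ?_⟩
        · simp [f7]; omega
        · intro j g' hj hg'
          simp only [MState.setReg_arr, MState.setArr_arr, Ex.val_ofNat, Ex.val_reg, f7, f15, farr,
            true_and]
          by_cases hjk : j = k
          · subst hjk
            rw [if_pos rfl, if_pos ((Option.some_inj.1 (hg'.symm.trans hg)).trans hgf)]
          · rw [if_neg hjk, hI1 j g' (by omega) hg']
        · intro c j h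
          simp only [MState.setReg_arr, MState.setArr_arr, Ex.val_ofNat, Ex.val_reg, f7, f15, farr]
          rw [if_neg (by omega), hI2 c j (by omega)]
      · have hgf : g ≠ f := by
          intro h
          simp [hI, h] at hv
        refine WP.skip ⟨f7, ?_, ?_⟩
        · intro j g' hj hg'
          rw [MState.setReg_arr, farr]
          by_cases hjk : j = k
          · subst hjk
            rw [hI2 _ _ (by omega), if_neg]
            rwa [Option.some_inj.1 (hg'.symm.trans hg)]
          · rw [hI1 j g' (by omega) hg']
        · intro c j h
          rw [MState.setReg_arr, farr, hI2 c j (by omega)]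
  · rintro s' hF ⟨h2, h3⟩
    exact ⟨fun j g hg => h2 j g (List.getElem?_eq_some_iff.1 hg).1 hg, h3⟩

/-- Puts the total weight of all sets of facts into register `2`. -/
def totalWeight : Cmd :=
  .set 2 1 ;; .for 7 (.reg 0) (.set 2 (.reg 2 * (.arr 3 (.reg 7) + .arr 4 (.reg 7))))

theorem wp_totalWeight {s : MState} {l : List (DBFact S)} {a b : DBFact S → ℕ} (hn : l.Nodup)
    (hl : ∀ j g, l[j]? = some g → s.arr 3 j = a g ∧ s.arr 4 j = b g)
    (hpos : ∀ g ∈ l, 0 < a g + b g) (h0 : s.reg 0 = l.length) (hlen : 10 + l.length ≤ L)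
    (hL : wtot l.toFinset a b < 2 ^ L) :
    WP O L totalWeight s fun s' => s'.reg 2 = wtot l.toFinset a b := by
  have hlt : L < 2 ^ L := Nat.lt_two_pow_self
  have htot : wtot l.toFinset a b = (l.map fun g => a g + b g).prod :=
    List.prod_toFinset (fun g => a g + b g) hn
  rw [htot] at hL ⊢
  refine WP.seq (WP.set' (fun _ => by simp; omega) fun s1 hs1 => WP.for l.length
    (fun k s' => s'.reg 2 = ((l.take k).map fun g => a g + b g).prod) (by omega)
    (by simp [hs1, MState.setReg_reg]) ?_ ?_ fun s' _ h => by simpa using h)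
  · intro k _ s' _ hF _
    refine ⟨trivial, ?_⟩
    rw [Ex.val_reg, hF.reg 0 (by simp [Cmd.Keeps]), hs1, MState.setReg_of_ne _ _ (by omega), h0]
  · intro k hk s' hF hI h7
    obtain ⟨w1, w2⟩ := hl k l[k] (List.getElem?_eq_getElem hk)
    have harr : s'.arr = s.arr := by rw [hF.arr (by simp [Cmd.Keeps]), hs1, MState.setReg_arr]
    have htk : ((l.take (k + 1)).map fun g => a g + b g).prod =
        ((l.take k).map fun g => a g + b g).prod * (a l[k] + b l[k]) := by
      rw [List.take_succ_eq_append_getElem hk, List.map_append, List.prod_append, List.map_singleton,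
        List.prod_singleton]
    have hprod : ∀ k, 0 < ((l.take k).map fun g => a g + b g).prod := fun k => by
      refine List.prod_pos fun x hx => ?_
      obtain ⟨g, hg, rfl⟩ := List.mem_map.1 hx
      exact hpos g (List.mem_of_mem_take hg)
    -- A partial product divides the full product, which is positive, and so does not exceed it.
    have hle : ∀ k, ((l.take k).map fun g => a g + b g).prod < 2 ^ L := fun k => by
      refine lt_of_le_of_lt (Nat.le_of_dvd ?_ ?_) hL
      · simpa using hprod l.length
      · exact ((List.take_sublist k l).map _).prod_dvd_prod
    have h1 := hle (k + 1)
    rw [htk] at h1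
    refine WP.set' (fun _ => ⟨trivial, ⟨?_, ?_, ?_⟩, ?_⟩) fun s2 hs2 => ?_
    · simp [h7]; omega
    · simp [h7]; omega
    · simp only [Ex.val_arr, Ex.val_ofNat, Ex.val_reg, h7, harr, w1, w2]
      exact (Nat.le_mul_of_pos_left _ (hprod k)).trans_lt h1
    · simpa [h7, harr, w1, w2, hI] using h1
    · simp only [Ex.val_mul, Ex.val_add, Ex.val_arr, Ex.val_ofNat, Ex.val_reg, h7, harr, w1, w2,
        hI, ← htk] at hs2
      simp [hs2, MState.setReg_reg, h7]

end Prepare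

/-! ### The weighted table of an instance of the Shapley problem -/

section Prepare
variable {S : Schema} {O : List ℕ → List ℕ}

/-- Reads an instance of the Shapley problem and builds the table of weighted facts. -/
def prepare (S : Schema) : Cmd :=
  arityTable S ;; .read 1 ;; powers ;; readFacts 1 (.reg 4) 1 ;; .read 13 ;; readFacts 13 1 0 ;;
  .set 0 (.reg 6) ;; readFact ;; markFact ;; totalWeight

namespace ShapleyInst
variable (x : ShapleyInst S)

/-- All facts of the instance. -/
def facts : List (DBFact S) := x.endo ++ x.exo

/-- The weight of presence. -/
def weight : DBFact S → ℕ := factWeight x.endo.toFinset x.fact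

/-- The weight of absence. -/
def coweight : DBFact S → ℕ := factCoweight x.endo.toFinset

theorem card_endo : x.endo.toFinset.card = x.endo.length :=
  List.toFinset_card_of_nodup (List.nodup_append.1 x.nodup).1

theorem facts_toFinset : x.facts.toFinset = x.endo.toFinset ∪ x.exo.toFinset :=
  List.toFinset_append

theorem disjoint : Disjoint x.endo.toFinset x.exo.toFinset := by
  rw [Finset.disjoint_left]
  intro g hg hg'
  exact (List.nodup_append.1 x.nodup).2.2 g (List.mem_toFinset.1 hg) g (List.mem_toFinset.1 hg') rfl

theorem weight_of_mem {g : DBFact S} (hg : g ∈ x.endo) : x.weight g =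
    if g = x.fact then (2 ^ x.endo.length) ^ x.endo.length else 2 ^ x.endo.length := by
  rw [weight, factWeight, card_endo, if_pos (c := g ∈ _) (List.mem_toFinset.2 hg)]

theorem coweight_of_mem {g : DBFact S} (hg : g ∈ x.endo) : x.coweight g = 1 :=
  if_pos (List.mem_toFinset.2 hg)

theorem not_mem_endo {g : DBFact S} (hg : g ∈ x.exo) : g ∉ x.endo := fun h =>
  (List.nodup_append.1 x.nodup).2.2 g h g hg rfl

theorem weight_of_mem_exo {g : DBFact S} (hg : g ∈ x.exo) : x.weight g = 1 := by
  have h := x.not_mem_endo hg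
  rw [weight, factWeight, if_neg (fun h' : g = _ => h (h' ▸ x.mem)), if_neg (c := g ∈ _) (by simpa using h)]

theorem coweight_of_mem_exo {g : DBFact S} (hg : g ∈ x.exo) : x.coweight g = 0 :=
  if_neg (by simpa using x.not_mem_endo hg)

/-- In both alternatives the weight is coprime to the sum of the two weights; `enc_tid` depends on
this. -/
theorem weight_cases {g : DBFact S} (hg : g ∈ x.facts) :
    0 < x.weight g ∧ (x.coweight g = 1 ∨ x.weight g = 1 ∧ x.coweight g = 0) := by
  rcases List.mem_append.1 hg with h | h
  · refine ⟨?_, .inl (x.coweight_of_mem h)⟩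
    rw [x.weight_of_mem h]
    split_ifs <;> positivity
  · rw [x.weight_of_mem_exo h, x.coweight_of_mem_exo h]
    simp

theorem length_enc : x.enc.length = 3 + (x.endo.flatMap encFact).length +
    (x.exo.flatMap encFact).length + S.arity x.fact.1 := by
  simp only [enc, encList, encFact, List.length_append, List.length_cons, List.length_ofFn]
  omega

end ShapleyInst

/-- The table of weighted facts of the instance `x` has been built. -/
structure Prepared (x : ShapleyInst S) (ℓ : ℕ) (ds : List ℕ) (s : MState) : Prop where
  ok : DBOk ℓ x.facts ds x.weight x.coweight
  db : DBState x.facts ds x.weight x.coweight s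
  arity : ArityState S s
  count : s.reg 1 = x.endo.length
  base : s.reg 4 = 2 ^ x.endo.length
  out : s.out = []
  qry : s.qry = []

/-- Endogenous facts fill the first rows and exogenous ones the next, with weights that ignore which
fact is f; the weight of f is corrected at the end. The quadratic term in the bound on ℓ pays for
the bits of the total weight. -/
theorem wp_prepare (x : ShapleyInst S) {ℓ : ℕ} (hℓ : 20 + x.enc.length + S.numRel +
    ∑ R, S.arity R + 2 * x.endo.length * (x.endo.length + 1) ≤ ℓ) :
    WP O (4 * ℓ) (prepare S) ⟨fun _ => 0, fun _ => 0, fun _ _ => 0, x.enc, [], [], []⟩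
      fun s => ∃ ds, Prepared x ℓ ds s := by
  have hlt : 4 * ℓ < 2 ^ (4 * ℓ) := Nat.lt_two_pow_self
  have hlen := x.length_enc
  have hn := length_le_flatMap_encFact x.endo
  have hm := length_le_flatMap_encFact x.exo
  have hsq : 2 * x.endo.length * (x.endo.length + 1) = 2 * (x.endo.length * x.endo.length) +
    2 * x.endo.length := by ring
  have har := arity_le_sum x.fact.1
  have hN : x.facts.length = x.endo.length + x.exo.length := List.length_append
  generalize hs0 : MState.mk (fun _ => 0) (fun _ => 0) (fun _ _ => 0) x.enc [] [] [] = s0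
  refine WP.seq ((wp_arityTable (by omega)).mono fun s1 _ hF1 hA1 => ?_)
  have z : ∀ i, s1.reg i = 0 := fun i => by
    rw [hF1.reg i (keeps_arityTable (by simp)), ← hs0]
  have einp : s1.inp = x.enc := by rw [hF1.inp (keeps_arityTable (by simp)), ← hs0]
  have eout : s1.out = [] := by rw [hF1.out (keeps_arityTable (by simp)), ← hs0]
  have eqry : s1.qry = [] := by rw [hF1.qry (keeps_arityTable (by simp)), ← hs0]
  refine WP.seq (WP.read' fun s2 hs2 => ?_)
  rw [einp] at hs2
  simp only [ShapleyInst.enc, encList, List.cons_append, List.headD_cons, List.tail_cons] at hs2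
  refine WP.seq ((wp_powers (n := x.endo.length) (by rw [hs2, MState.setReg_self])
    (by omega)).mono fun s3 _ hF3 hp => ?_)
  have r1 : s3.reg 1 = x.endo.length := by
    rw [hF3.reg 1 (by simp [Cmd.Keeps, powers]), hs2, MState.setReg_self]
  have r6 : s3.reg 6 = 0 := by
    rw [hF3.reg 6 (by simp [Cmd.Keeps, powers]), hs2, MState.setReg_of_ne _ _ (by omega)]
    exact z 6
  have r3 : s3.reg 3 = 0 := by
    rw [hF3.reg 3 (by simp [Cmd.Keeps, powers]), hs2, MState.setReg_of_ne _ _ (by omega)]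
    exact z 3
  have rinp : s3.inp = x.endo.flatMap encFact ++
      (x.exo.length :: x.exo.flatMap encFact ++ encFact x.fact) := by
    rw [hF3.inp (by simp [Cmd.Keeps, powers]), hs2]
    simp
  have rarr : s3.arr = s1.arr := by
    rw [hF3.arr (by simp [Cmd.Keeps, powers]), hs2]
    simp
  have hR3 : ReadState (S := S) x.enc.length [] [] s3 := by
    refine ⟨by rw [ArityState, rarr]; exact hA1, ⟨r3, by simp, by simp⟩, by simp, ?_, r6, by simp⟩
    rw [rinp]
    simp [ShapleyInst.enc, encList]
  refine WP.seq ((wp_readFacts (i := 1) (w := .reg 4) (w' := 1) (x := 2 ^ x.endo.length) (x' := 1) x.endo hR3 r1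
    (.inl rfl) (fun s' h => ⟨trivial, h.trans hp.1⟩) (fun s' h => ⟨by simp; omega, rfl⟩) rinp
    (by simp; omega)).mono ?_)
  rintro s4 - hF4 ⟨ds4, hR4, rinp4⟩
  refine WP.seq (WP.read' fun s5 hs5 => ?_)
  simp only [rinp4, List.cons_append, List.headD_cons, List.tail_cons] at hs5
  have hR5 : ReadState x.enc.length ([] ++ x.endo.map fun f => (f, 2 ^ x.endo.length, 1)) ds4 s5 := by
    obtain ⟨g1, g2, g3, g4, g5, g6⟩ := hR4
    have ha : s5.arr = s4.arr := by simp [hs5]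
    refine ⟨by rw [ArityState, ha]; exact g1, ⟨?_, by rw [ha]; exact g2.val, g2.nodup⟩, g3, ?_, ?_,
      by simp only [IsRow, ha]; exact g6⟩
    · rw [← g2.len]
      simp [hs5, MState.setReg_reg]
    · rw [hs5, MState.setReg_inp]
      rw [rinp4] at g4
      simp only [List.cons_append, List.length_cons] at g4 ⊢
      omega
    · rw [← g5]
      simp [hs5, MState.setReg_reg]
  refine WP.seq ((wp_readFacts (i := 13) (w := 1) (w' := 0) (x := 1) (x' := 0) (rest := encFact x.fact) x.exo hR5
    (by simp [hs5, MState.setReg_reg])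
    (.inr rfl) (fun s' h => ⟨by simp; omega, rfl⟩) (fun s' h => ⟨by simp, rfl⟩)
    (by simp [hs5]) (by simp; omega)).mono ?_)
  rintro s6 - hF6 ⟨ds6, hR6, rinp6⟩
  rw [List.nil_append] at hR6
  have h6 : s6.reg 6 = x.facts.length := by
    rw [hR6.len, hN]
    simp
  have hds6 : ds6.length ≤ x.enc.length := by
    have := hR6.size
    omega
  refine WP.seq (WP.set' (fun _ => trivial) fun s7 hs7 => ?_)
  rw [Ex.val_reg, h6] at hs7
  have e6 : s7.reg 6 = x.facts.length := by
    rw [hs7, MState.setReg_of_ne _ _ (by omega), h6]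
  have e1 : s7.reg 1 = x.endo.length := by
    rw [hs7, MState.setReg_of_ne _ _ (by omega), hF6.reg 1 (by simp [Cmd.Keeps, readFacts, readFact, addDom]),
      hs5, MState.setReg_of_ne _ _ (by omega), hF4.reg 1 (by simp [Cmd.Keeps, readFacts, readFact, addDom]), r1]
  have e4 : s7.reg 4 = 2 ^ x.endo.length := by
    rw [hs7, MState.setReg_of_ne _ _ (by omega), hF6.reg 4 (by simp [Cmd.Keeps, readFacts, readFact, addDom]),
      hs5, MState.setReg_of_ne _ _ (by omega), hF4.reg 4 (by simp [Cmd.Keeps, readFacts, readFact, addDom]), hp.1]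
  have e15 : s7.reg 15 = (2 ^ x.endo.length) ^ x.endo.length := by
    rw [hs7, MState.setReg_of_ne _ _ (by omega), hF6.reg 15 (by simp [Cmd.Keeps, readFacts, readFact, addDom]),
      hs5, MState.setReg_of_ne _ _ (by omega), hF4.reg 15 (by simp [Cmd.Keeps, readFacts, readFact, addDom]), hp.2]
  have e_out : s7.out = [] := by
    rw [hs7, MState.setReg_out, hF6.out (by simp [Cmd.Keeps, readFacts, readFact, addDom]),
      hs5, MState.setReg_out, hF4.out (by simp [Cmd.Keeps, readFacts, readFact, addDom]),
      hF3.out (by simp [Cmd.Keeps, powers]), hs2, MState.setReg_out, eout]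
  have e_qry : s7.qry = [] := by
    rw [hs7, MState.setReg_qry, hF6.qry (by simp [Cmd.Keeps, readFacts, readFact, addDom]),
      hs5, MState.setReg_qry, hF4.qry (by simp [Cmd.Keeps, readFacts, readFact, addDom]),
      hF3.qry (by simp [Cmd.Keeps, powers]), hs2, MState.setReg_qry, eqry]
  have e_inp : s7.inp = encFact x.fact ++ [] := by
    rw [hs7, MState.setReg_inp, rinp6, List.append_nil]
  have e_arr : s7.arr = s6.arr := by rw [hs7, MState.setReg_arr]
  have e0 : s7.reg 0 = x.facts.length := by rw [hs7, MState.setReg_self]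
  have hd7 : DomState ds6 s7 := ⟨by
    rw [hs7, MState.setReg_of_ne _ _ (by omega), hR6.dom.len], by rw [e_arr]; exact hR6.dom.val,
    hR6.dom.nodup⟩
  have hA7 : ArityState S s7 := by rw [ArityState, e_arr]; exact hR6.arity
  clear hs7 hs5
  -- The fact f goes into the row behind the table: register 0 already holds the number of rows, so
  -- this copy is not counted as a fact.
  refine WP.seq ((wp_readFact hd7 hA7 e_inp (by omega)).mono ?_)
  rintro s8 - hF8 ⟨ds, hd8, hsub, -, hlen8, -, hrow8, h8, harr8⟩
  rw [e6, e_arr] at harr8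
  rw [e6] at hrow8
  have f6 : s8.reg 6 = x.facts.length := (hF8.reg 6 (by simp [Cmd.Keeps, readFact, addDom])).trans e6
  have f1 : s8.reg 1 = x.endo.length := (hF8.reg 1 (by simp [Cmd.Keeps, readFact, addDom])).trans e1
  have f0 : s8.reg 0 = x.facts.length := (hF8.reg 0 (by simp [Cmd.Keeps, readFact, addDom])).trans e0
  have f4 := (hF8.reg 4 (by simp [Cmd.Keeps, readFact, addDom])).trans e4
  have f15 := (hF8.reg 15 (by simp [Cmd.Keeps, readFact, addDom])).trans e15
  have f_out := (hF8.out (by simp [Cmd.Keeps, readFact, addDom])).trans e_out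
  have f_qry := (hF8.qry (by simp [Cmd.Keeps, readFact, addDom])).trans e_qry
  have hA8 : ArityState S s8 := fun R => (harr8 1 R (by simp) (by simp)).trans (hR6.arity R)
  have row_endo : ∀ j g, x.endo[j]? = some g →
      IsRow s8 j g ∧ s8.arr 3 j = 2 ^ x.endo.length ∧ s8.arr 4 j = 1 := by
    intro j g hg
    have hj := (List.getElem?_eq_some_iff.1 hg).1
    obtain ⟨⟨g1, g2⟩, g3, g4⟩ := hR6.row j (g, 2 ^ x.endo.length, 1) (by
      rw [List.getElem?_append_left (by simpa using hj), List.getElem?_map, hg]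
      rfl)
    refine ⟨⟨?_, fun i => ?_⟩, ?_, ?_⟩ <;> rw [harr8 _ _ (by omega) (by omega)]
    exacts [g1, g2 i, g3, g4]
  have row_exo : ∀ j g, x.exo[j]? = some g → IsRow s8 (x.endo.length + j) g ∧
      s8.arr 3 (x.endo.length + j) = 1 ∧ s8.arr 4 (x.endo.length + j) = 0 := by
    intro j g hg
    have hj := (List.getElem?_eq_some_iff.1 hg).1
    obtain ⟨⟨g1, g2⟩, g3, g4⟩ := hR6.row (x.endo.length + j) (g, 1, 0) (by
      rw [List.getElem?_append_right (by simp), List.getElem?_map]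
      simp [hg])
    refine ⟨⟨?_, fun i => ?_⟩, ?_, ?_⟩ <;> rw [harr8 _ _ (by omega) (by omega)]
    exacts [g1, g2 i, g3, g4]
  refine WP.seq ((wp_markFact hA8 (fun j g hg => (row_endo j g hg).1) f1
    (by rw [f6]; exact hrow8) h8 (by omega) (by omega)).mono ?_)
  rintro s9 - hF9 ⟨hm9, harr9⟩
  have row9 : ∀ j g, x.facts[j]? = some g →
      IsRow s9 j g ∧ s9.arr 3 j = x.weight g ∧ s9.arr 4 j = x.coweight g := by
    intro j g hg
    have key : ∀ (j : ℕ) (g : DBFact S), IsRow s8 j g → IsRow s9 j g := fun j g h =>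
      ⟨by rw [harr9 _ _ (by simp), h.1], fun i => by rw [harr9 _ _ (.inl (by omega)), h.2 i]⟩
    rw [ShapleyInst.facts] at hg
    rcases lt_or_ge j x.endo.length with hj | hj
    · rw [List.getElem?_append_left hj] at hg
      obtain ⟨g1, g2, g3⟩ := row_endo j g hg
      have hmem := List.mem_of_getElem? hg
      rw [x.weight_of_mem hmem, x.coweight_of_mem hmem]
      refine ⟨key j g g1, ?_, ?_⟩
      · rw [hm9 j g hg, f15, g2]
      · rw [harr9 _ _ (by simp), g3]
    · rw [List.getElem?_append_right hj] at hg
      obtain ⟨g1, g2, g3⟩ := row_exo _ g hg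
      rw [Nat.add_sub_cancel' hj] at g1 g2 g3
      have hmem := List.mem_of_getElem? hg
      rw [x.weight_of_mem_exo hmem, x.coweight_of_mem_exo hmem]
      refine ⟨key j g g1, ?_, ?_⟩
      · rw [harr9 _ _ (.inr hj), g2]
      · rw [harr9 _ _ (by simp), g3]
  have htot : wtot x.facts.toFinset x.weight x.coweight ≤ 2 ^ ℓ := by
    rw [x.facts_toFinset]
    refine (wtot_factWeight_le x.disjoint (List.mem_toFinset.2 x.mem)).trans ?_
    rw [x.card_endo]
    exact two_pow_le_of_le (by omega)
  have hpos : ∀ g ∈ x.facts, 0 < x.weight g + x.coweight g := fun g hg =>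
    Nat.add_pos_left (x.weight_cases hg).1 _
  refine (wp_totalWeight x.nodup (fun j g hg => (row9 j g hg).2) hpos
    ((hF9.reg 0 (by simp [Cmd.Keeps, markFact])).trans f0)
    (by rw [List.length_append]; omega)
    (lt_of_le_of_lt htot (two_pow_lt_of_lt (by omega)))).mono ?_
  intro s10 _ hF10 h2
  have harr10 : s10.arr = s9.arr := hF10.arr (by simp [Cmd.Keeps, totalWeight])
  refine ⟨ds, ⟨hd8.nodup, ?_, hpos, htot, by omega, by omega⟩, ⟨?_, h2, ?_, ?_, ?_⟩, ?_, ?_, ?_, ?_, ?_⟩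
  · intro g hg i
    refine hsub ?_
    rcases List.mem_append.1 hg with h | h
    · exact hR6.mem (g, 2 ^ x.endo.length, 1) (by simp [h]) i
    · exact hR6.mem (g, 1, 0) (by simp [h]) i
  · rw [hF10.reg 0 (by simp [Cmd.Keeps, totalWeight]), hF9.reg 0 (by simp [Cmd.Keeps, markFact]), f0]
  · rw [hF10.reg 3 (by simp [Cmd.Keeps, totalWeight]), hF9.reg 3 (by simp [Cmd.Keeps, markFact]), hd8.len]
  · intro j hj
    have := row9 j _ (List.getElem?_eq_getElem hj)
    simpa only [IsRow, harr10] using this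
  · intro j hj
    rw [harr10, harr9 _ _ (by simp), hd8.val j hj]
  · intro R
    rw [harr10, harr9 _ _ (by simp), hA8]
  · rw [hF10.reg 1 (by simp [Cmd.Keeps, totalWeight]), hF9.reg 1 (by simp [Cmd.Keeps, markFact]), f1]
  · rw [hF10.reg 4 (by simp [Cmd.Keeps, totalWeight]), hF9.reg 4 (by simp [Cmd.Keeps, markFact]), f4]
  · rw [hF10.out (by simp [Cmd.Keeps, totalWeight]), hF9.out (by simp [Cmd.Keeps, markFact]), f_out]
  · rw [hF10.qry (by simp [Cmd.Keeps, totalWeight]), hF9.qry (by simp [Cmd.Keeps, markFact]), f_qry]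

end Prepare

/-! ### From the weighted count to the Shapley value -/

section Output
open scoped Nat

/-! ### Digits to base B -/

theorem sum_pow_mul_lt {B : ℕ} (c : ℕ → ℕ) : ∀ n, (∀ k < n, c k < B) →
    ∑ k ∈ Finset.range n, B ^ k * c k < B ^ n
  | 0, _ => by simp
  | n + 1, hc => by
    have h1 := sum_pow_mul_lt c n fun k hk => hc k (by omega)
    have h2 := Nat.mul_le_mul_left (B ^ n) (hc n (by omega))
    rw [Finset.sum_range_succ, pow_succ]
    rw [Nat.succ_eq_add_one, mul_add, mul_one] at h2
    omega

theorem sum_pow_mul_add_div {B n : ℕ} {c : ℕ → ℕ} (hc : ∀ k < n, c k < B) (Y : ℕ) :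
    (∑ k ∈ Finset.range n, B ^ k * c k + B ^ n * Y) / B ^ n = Y := by
  have h := sum_pow_mul_lt c n hc
  rw [Nat.add_mul_div_left _ _ (by omega), Nat.div_eq_of_lt h, zero_add]

/-- In the induction the top digit is absorbed into the part `Y` above the digits, which is why `Y`
is arbitrary. -/
theorem sum_pow_mul_digit {B : ℕ} {c : ℕ → ℕ} {n : ℕ} (hc : ∀ k < n, c k < B) (Y : ℕ) {j : ℕ}
    (hj : j < n) : (∑ k ∈ Finset.range n, B ^ k * c k + B ^ n * Y) / B ^ j % B = c j := by
  induction n generalizing Y with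
  | zero => omega
  | succ n ih =>
    have : ∑ k ∈ Finset.range (n + 1), B ^ k * c k + B ^ (n + 1) * Y =
        ∑ k ∈ Finset.range n, B ^ k * c k + B ^ n * (c n + B * Y) := by
      rw [Finset.sum_range_succ, pow_succ]
      ring
    rw [this]
    rcases Nat.lt_succ_iff_lt_or_eq.1 hj with h | rfl
    · exact ih (fun k hk => hc k (by omega)) _ h
    · rw [sum_pow_mul_add_div fun k hk => hc k (by omega), Nat.add_mul_mod_self_left,
        Nat.mod_eq_of_lt (hc j hj)]

/-- With truncated subtraction, `a - b + (b - a)` is the absolute value of the difference; dividing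
by the greatest common divisor gives lowest terms. -/
theorem encRat_sub_div {a b m : ℕ} (hm : 0 < m) :
    encRat (((a : ℚ) - (b : ℚ)) / (m : ℚ)) =
      [if a < b then 1 else 0, (a - b + (b - a)) / Nat.gcd m (a - b + (b - a)),
        m / Nat.gcd m (a - b + (b - a))] := by
  have habs : ((a : ℤ) - b).natAbs = a - b + (b - a) := by omega
  have hd : ((a : ℚ) - b) / m = Rat.divInt ((a : ℤ) - b) m := by
    rw [Rat.divInt_eq_div]
    push_cast
    rfl
  have hg : (m : ℤ).gcd ((a : ℤ) - b) = Nat.gcd m (a - b + (b - a)) := by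
    rw [← habs, Int.gcd, Int.natAbs_natCast]
  have hneg : ((a : ℚ) - b) / m < 0 ↔ a < b := by
    rw [div_lt_iff₀ (by exact_mod_cast hm), zero_mul, sub_neg, Nat.cast_lt]
  have hdvd : ((Nat.gcd m (a - b + (b - a)) : ℕ) : ℤ) ∣ (a : ℤ) - b :=
    Int.natCast_dvd.2 (by rw [habs]; exact Nat.gcd_dvd_right _ _)
  rw [encRat, if_congr hneg rfl rfl, hd, Rat.num_divInt, Rat.den_divInt, hg,
    if_neg (c := (m : ℤ) = 0) (by exact_mod_cast hm.ne'), Int.natAbs_natCast, Int.sign_natCast_of_ne_zero hm.ne',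
    one_mul, Int.natAbs_ediv_of_dvd hdvd, habs, Int.natAbs_natCast]

/-! ### Euclid's algorithm -/

theorem two_mul_mod_lt {x y : ℕ} (hy : 0 < y) (hyx : y < x) : 2 * (x % y) < x := by
  have h1 := Nat.mod_lt x hy
  have h2 := Nat.mod_add_div x y
  have h3 : y * 1 ≤ y * (x / y) := Nat.mul_le_mul_left _ (Nat.div_pos hyx.le hy)
  omega

/-- For y < x the remainder is less than half of x and so at least one bit shorter. This bounds the
rounds of Euclid's algorithm by the bit length. -/
theorem size_mod_lt {x y : ℕ} (hy : 0 < y) (hyx : y < x) : (x % y).size < x.size := by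
  have hx : 0 < x.size := Nat.size_pos.2 (by omega)
  have h1 := two_mul_mod_lt hy hyx
  have h2 := Nat.lt_size_self x
  have h3 : 2 ^ x.size = 2 * 2 ^ (x.size - 1) := by
    rw [← pow_succ']
    congr 1
    omega
  have : (x % y).size ≤ x.size - 1 := Nat.size_le.2 (by omega)
  omega

variable {O : List ℕ → List ℕ} {L : ℕ}

/-- The remainder. -/
def Ex.modE (a b : Ex) : Ex := a - a / b * b

theorem Ex.val_modE (a b : Ex) (s : MState) : (a.modE b).val s = a.val s % b.val s := by
  simp only [modE, Ex.val_sub, Ex.val_mul, Ex.val_div]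
  have := Nat.div_add_mod (a.val s) (b.val s)
  rw [mul_comm] at this
  omega

theorem Ex.ok_modE {a b : Ex} {s : MState} (ha : a.Ok L s) (hb : b.Ok L s)
    (h : a.val s < 2 ^ L) : (a.modE b).Ok L s :=
  ⟨ha, ⟨ha, hb⟩, hb, (Nat.div_mul_le_self _ _).trans_lt h⟩

/-- Puts the greatest common divisor of registers `18` and `12` into register `13`. -/
def euclid : Cmd :=
  .set 13 (.reg 18) ;; .set 14 ((Ex.reg 12).modE (.reg 18)) ;;
  .loop (.reg 14)
    (.set 16 ((Ex.reg 13).modE (.reg 14)) ;; .set 13 (.reg 14) ;; .set 14 (.reg 16))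

theorem wp_euclid {s : MState} (hpos : 0 < s.reg 18) (hL : 2 * (s.reg 18).size ≤ L) :
    WP O L euclid s fun s' => s'.reg 13 = Nat.gcd (s.reg 18) (s.reg 12) := by
  refine WP.seq (WP.set' (fun _ => trivial) fun s1 hs1 => WP.seq (WP.set'
    (fun hb => Ex.ok_modE trivial trivial (hb.reg _)) fun s2 hs2 => ?_))
  rw [Ex.val_modE] at hs2
  have e13 : s2.reg 13 = s.reg 18 := by simp [hs2, hs1, MState.setReg_reg]
  have e14 : s2.reg 14 = s.reg 12 % s.reg 18 := by simp [hs2, hs1, MState.setReg_reg]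
  have hlt := Nat.mod_lt (s.reg 12) hpos
  -- The rank is the sum of the bit lengths of both numbers. Because of the reduction modulo
  -- register 18 before the loop, it starts at no more than twice the length of that register.
  refine WP.loop (I := fun k s' => Nat.gcd (s'.reg 14) (s'.reg 13) = Nat.gcd (s.reg 18) (s.reg 12) ∧
    s'.reg 14 < s'.reg 13 ∧ (s'.reg 13).size + (s'.reg 14).size = k) (k := _)
    ?_ ⟨?_, ?_, rfl⟩ (fun _ _ _ _ _ => trivial) ?_ ?_
  · have := Nat.size_le_size hlt.le
    rw [e13, e14]
    omega
  · rw [e13, e14, Nat.gcd_rec (s.reg 18)]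
  · rw [e13, e14]
    exact hlt
  · rintro k s' - ⟨h1, h2, h3⟩ h4
    rw [Ex.val_reg] at h4
    refine WP.seq (WP.set' (fun hb => Ex.ok_modE trivial trivial (hb.reg _)) fun t1 ht1 =>
      WP.seq (WP.set' (fun _ => trivial) fun t2 ht2 => WP.set' (fun _ => trivial) fun t3 ht3 => ?_))
    rw [Ex.val_modE] at ht1
    have f13 : t3.reg 13 = s'.reg 14 := by simp [ht3, ht2, ht1, MState.setReg_reg]
    have f14 : t3.reg 14 = s'.reg 13 % s'.reg 14 := by simp [ht3, ht2, ht1, MState.setReg_reg]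
    have h5 := size_mod_lt (Nat.pos_of_ne_zero h4) h2
    refine ⟨(t3.reg 13).size + (t3.reg 14).size, ?_, ?_, ?_, rfl⟩
    · rw [f13, f14]
      omega
    · rw [f13, f14, ← Nat.gcd_rec, h1]
    · rw [f13, f14]
      exact Nat.mod_lt _ (Nat.pos_of_ne_zero h4)
  · rintro k s' - ⟨h1, h2, h3⟩ h4
    rw [Ex.val_reg] at h4
    rwa [h4, Nat.gcd_zero_left] at h1

/-! ### Factorials and sums of digits with Shapley coefficients -/

/-- With `n` in register `1`, puts `(n - 1)!` into register `17` and `n!` into register `18`. -/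
def factorials : Cmd :=
  .set 17 1 ;; .for 7 (.reg 1 - 1) (.set 17 (.reg 17 * (.reg 7 + 1))) ;;
  .set 18 (.reg 17 * .reg 1)

theorem wp_factorials {s : MState} {n : ℕ} (h1 : s.reg 1 = n) (hn : 0 < n) (hL : n < L)
    (hL' : n ! < 2 ^ L) :
    WP O L factorials s fun s' => s'.reg 17 = (n - 1)! ∧ s'.reg 18 = n ! := by
  have hlt : L < 2 ^ L := Nat.lt_two_pow_self
  refine WP.seq (WP.set' (fun _ => by simp; omega) fun s1 hs1 => WP.seq (WP.for (n - 1)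
    (fun k s' => s'.reg 17 = k !) (by omega) (by simp [hs1, MState.setReg_reg]) ?_ ?_ ?_))
  · intro k _ s' _ hF _
    have : s'.reg 1 = n := by
      rw [hF.reg 1 (by simp [Cmd.Keeps]), hs1, MState.setReg_of_ne _ _ (by omega), h1]
    simp [this]
    omega
  · intro k hk s' _ hI h7
    have : (k + 1)! ≤ n ! := Nat.factorial_le (by omega)
    rw [Nat.factorial_succ, mul_comm] at this
    refine WP.set' (fun _ => ?_) fun s2 hs2 => ?_
    · simp [hI, h7]
      omega
    · simp only [Ex.val_mul, Ex.val_add, Ex.val_reg, Ex.val_ofNat, hI, h7] at hs2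
      rw [hs2]
      simp [MState.setReg_reg, h7, Nat.factorial_succ, mul_comm]
  · intro s' hF hI
    have h1' : s'.reg 1 = n := by
      rw [hF.reg 1 (by simp [Cmd.Keeps]), hs1, MState.setReg_of_ne _ _ (by omega), h1]
    have hf : (n - 1)! * n = n ! := by rw [mul_comm, Nat.mul_factorial_pred (by omega)]
    refine WP.set (fun _ => ?_) ?_
    · simpa [hI, h1', hf] using hL'
    · simp [MState.setReg_reg, hI, h1', hf]

/-- Splits off as many digits of register `5` to base register `4` as register `1` says, and puts
their sum, weighted by the coefficients of the Shapley value, into register `r`. -/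
def shapleySum (r : ℕ) : Cmd :=
  .set r 0 ;; .set 16 (.reg 17) ;;
  .for 7 (.reg 1) (
    .set r (.reg r + .reg 16 * (Ex.reg 5).modE (.reg 4)) ;;
    .set 5 (.reg 5 / .reg 4) ;;
    .set 16 (.reg 16 * (.reg 7 + 1) / (.reg 1 - 1 - .reg 7)))

theorem factorial_mul_factorial_le {n k : ℕ} (hk : k < n) : k ! * (n - 1 - k)! ≤ (n - 1)! :=
  Nat.le_of_dvd (Nat.factorial_pos _) (Nat.factorial_mul_factorial_dvd_factorial (by omega))

/-- The coefficient k!(n-1-k)! passes to the next one by multiplication with k + 1 and an exact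
division by n - 1 - k. Since each coefficient is at most (n-1)!, every partial sum is at most n! B.
-/
theorem wp_shapleySum {s : MState} {n B r : ℕ} (hr : 8 ≤ r) (hr' : r < 16) (h1 : s.reg 1 = n)
    (h4 : s.reg 4 = B) (hB : 0 < B) (h17 : s.reg 17 = (n - 1)!) (hn : 0 < n) (hL : n < L)
    (hL' : n ! * B < 2 ^ L) :
    WP O L (shapleySum r) s fun s' => s'.reg 5 = s.reg 5 / B ^ n ∧
      s'.reg r = ∑ k ∈ Finset.range n, k ! * (n - 1 - k)! * (s.reg 5 / B ^ k % B) := by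
  have hlt : L < 2 ^ L := Nat.lt_two_pow_self
  have hf : n * (n - 1)! = n ! := Nat.mul_factorial_pred (by omega)
  have hfac : n ! < 2 ^ L := (Nat.le_mul_of_pos_right _ hB).trans_lt hL'
  -- In the last round the divisor n - 1 - k is 0 and the coefficient becomes 0; the invariant
  -- therefore speaks of the coefficient only for k < n.
  refine WP.seq (WP.set' (fun _ => by simp) fun s1 hs1 => WP.seq (WP.set' (fun _ => trivial)
    fun s2 hs2 => WP.for n (fun k s' => s'.reg 5 = s.reg 5 / B ^ k ∧
      (k < n → s'.reg 16 = k ! * (n - 1 - k)!) ∧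
      s'.reg r = ∑ k ∈ Finset.range k, k ! * (n - 1 - k)! * (s.reg 5 / B ^ k % B))
    (by omega) ?_ ?_ ?_ fun s' _ h => ⟨h.1, h.2.2⟩))
  · rw [hs2, hs1]
    simp (disch := omega) [MState.setReg_self, MState.setReg_of_ne, h17]
  · intro k _ s' _ hF _
    refine ⟨trivial, ?_⟩
    rw [Ex.val_reg, hF.reg 1 (by simp [Cmd.Keeps]; omega), hs2, hs1]
    simpa (disch := omega) only [MState.setReg_of_ne] using h1
  · rintro k hk s' hF ⟨i1, i2, i3⟩ h7
    replace i2 := i2 hk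
    have g1 : s'.reg 1 = n := by
      rw [hF.reg 1 (by simp [Cmd.Keeps]; omega), hs2, hs1]
      simpa (disch := omega) only [MState.setReg_of_ne] using h1
    have g4 : s'.reg 4 = B := by
      rw [hF.reg 4 (by simp [Cmd.Keeps]; omega), hs2, hs1]
      simpa (disch := omega) only [MState.setReg_of_ne] using h4
    have hterm : ∀ k < n, k ! * (n - 1 - k)! * (s.reg 5 / B ^ k % B) ≤ (n - 1)! * B := fun k hk =>
      Nat.mul_le_mul (factorial_mul_factorial_le hk) (Nat.mod_lt _ hB).le
    have hsum : ∑ k ∈ Finset.range (k + 1), k ! * (n - 1 - k)! * (s.reg 5 / B ^ k % B) < 2 ^ L := by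
      refine lt_of_le_of_lt (Finset.sum_le_card_nsmul _ _ _ fun j hj =>
        hterm j (by rw [Finset.mem_range] at hj; omega)) (lt_of_le_of_lt ?_ hL')
      rw [Finset.card_range, smul_eq_mul, ← mul_assoc, ← hf]
      exact Nat.mul_le_mul_right _ (Nat.mul_le_mul_right _ hk)
    rw [Finset.sum_range_succ] at hsum
    have hcoef : k ! * (n - 1 - k)! * (k + 1) < 2 ^ L := by
      refine lt_of_le_of_lt (Nat.mul_le_mul (factorial_mul_factorial_le hk) (Nat.succ_le_of_lt hk)) ?_
      rwa [mul_comm, hf]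
    refine WP.seq (WP.set' (fun hb => ⟨trivial, ⟨trivial, Ex.ok_modE trivial trivial (hb.reg _), ?_⟩,
      ?_⟩) fun t1 ht1 => WP.seq (WP.set' (fun _ => ⟨trivial, trivial⟩) fun t2 ht2 =>
        WP.set' (fun _ => ?_) fun t3 ht3 => ?_))
    · rw [Ex.val_modE]
      simp only [Ex.val_reg, i1, i2, g4]
      omega
    · rw [Ex.val_mul, Ex.val_modE]
      simp only [Ex.val_reg, i1, i2, i3, g4]
      omega
    all_goals
      rw [Ex.val_add, Ex.val_mul, Ex.val_modE] at ht1
      simp only [Ex.val_reg, i1, i2, i3, g4, ← Finset.sum_range_succ] at ht1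
      have a5 : t2.reg 5 = s.reg 5 / B ^ (k + 1) := by
        rw [ht2, MState.setReg_self, Ex.val_div, Ex.val_reg, Ex.val_reg, ht1]
        simp (disch := omega) only [MState.setReg_of_ne, i1, g4]
        rw [Nat.div_div_eq_div_mul, pow_succ]
      have ar : t2.reg r = ∑ k ∈ Finset.range (k + 1),
          k ! * (n - 1 - k)! * (s.reg 5 / B ^ k % B) := by
        rw [ht2, MState.setReg_of_ne _ _ (by omega), ht1, MState.setReg_self]
      have a16 : t2.reg 16 = k ! * (n - 1 - k)! := by
        rw [ht2, MState.setReg_of_ne _ _ (by omega), ht1, MState.setReg_of_ne _ _ (by omega), i2]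
      have a1 : t2.reg 1 = n := by
        rw [ht2, MState.setReg_of_ne _ _ (by omega), ht1, MState.setReg_of_ne _ _ (by omega), g1]
      have a7 : t2.reg 7 = k := by
        rw [ht2, MState.setReg_of_ne _ _ (by omega), ht1, MState.setReg_of_ne _ _ (by omega), h7]
    · refine ⟨⟨trivial, ⟨trivial, ?_, ?_⟩, ?_⟩, ⟨trivial, ?_⟩, trivial⟩
      · simp; omega
      · simp [a7]; omega
      · simp only [Ex.val_add, Ex.val_reg, Ex.val_ofNat, a16, a7]
        exact hcoef
      · simp; omega
    · simp only [Ex.val_mul, Ex.val_add, Ex.val_div, Ex.val_sub, Ex.val_reg, Ex.val_ofNat, a16, a7,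
        a1] at ht3
      rw [ht3]
      simp (disch := omega) only [MState.setReg_of_ne, MState.setReg_self]
      refine ⟨a7, a5, fun hk' => ?_, ar⟩
      refine Nat.div_eq_of_eq_mul_left (by omega) ?_
      obtain ⟨m, hm⟩ : ∃ m, n - 1 - k = m + 1 := ⟨n - 1 - k - 1, by omega⟩
      rw [show n - 1 - (k + 1) = m by omega, hm, Nat.factorial_succ, Nat.factorial_succ]
      ring

/-- Computes the Shapley value from the weighted count in register `5` and writes it. -/
def writeShapley : Cmd :=
  factorials ;; shapleySum 10 ;; shapleySum 11 ;;
  .set 12 (.reg 10 - .reg 11 + (.reg 11 - .reg 10)) ;; euclid ;;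
  .write (1 - (1 - (.reg 10 - .reg 11))) ;; .write (.reg 12 / .reg 13) ;; .write (.reg 18 / .reg 13)

theorem factorial_mul_two_pow_le (n : ℕ) : n ! * 2 ^ n ≤ 2 ^ (n * n + n) := by
  rw [pow_add, pow_mul]
  refine Nat.mul_le_mul_right _ ((Nat.factorial_le_pow n).trans ?_)
  exact Nat.pow_le_pow_left Nat.lt_two_pow_self.le n

/-- The first call of `shapleySum` uses up the n lower digits, which belong to coalitions without f.
It leaves the upper ones in register 5 for the second call. -/
theorem wp_writeShapley {S : Schema} {x : ShapleyInst S} {q : BoolQuery S} {ℓ : ℕ} {s : MState}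
    (hℓ : 20 + 2 * x.endo.length * (x.endo.length + 1) ≤ ℓ)
    (h1 : s.reg 1 = x.endo.length) (h4 : s.reg 4 = 2 ^ x.endo.length)
    (h5 : s.reg 5 = wmc x.facts.toFinset x.weight x.coweight q) (hout : s.out = []) :
    WP O (4 * ℓ) writeShapley s fun s' => s'.out = encRat ((shapleyProblem q).goal x) := by
  have hlt : 4 * ℓ < 2 ^ (4 * ℓ) := Nat.lt_two_pow_self
  have hgoal : (shapleyProblem q).goal x =
    queryShapley q x.endo.toFinset x.exo.toFinset ⟨x.fact, List.mem_toFinset.2 x.mem⟩ := rfl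
  rw [x.facts_toFinset, ShapleyInst.weight, ShapleyInst.coweight,
    wmc_factWeight q x.disjoint (List.mem_toFinset.2 x.mem), x.card_endo] at h5
  rw [hgoal, queryShapley_eq, x.card_endo]
  simp only
  have hn : 0 < x.endo.length := List.length_pos_of_mem x.mem
  have hsl : ∀ p : Finset (DBFact S) → Prop, ∀ k,
      slices p (x.endo.toFinset.erase x.fact) k < 2 ^ x.endo.length := fun p k => by
    refine (slices_le _ _ _).trans_lt (two_pow_lt_of_lt ?_)
    rw [← x.card_endo]
    exact Finset.card_erase_lt_of_mem (List.mem_toFinset.2 x.mem)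
  have hc0 : ∀ k, slicesWithout q x.endo.toFinset x.exo.toFinset x.fact k < 2 ^ x.endo.length :=
    fun k => hsl _ k
  have hc1 : ∀ k, slicesWith q x.endo.toFinset x.exo.toFinset x.fact k < 2 ^ x.endo.length :=
    fun k => hsl _ k
  generalize slicesWithout q x.endo.toFinset x.exo.toFinset x.fact = c0 at *
  generalize slicesWith q x.endo.toFinset x.exo.toFinset x.fact = c1 at *
  generalize x.endo.length = n at *
  clear hsl
  have hsq : 2 * n * (n + 1) = 2 * (n * n) + 2 * n := by ring
  have hfB := (factorial_mul_two_pow_le n).trans_lt (two_pow_lt_of_lt (n := 4 * ℓ) (by omega))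
  have hfac : n ! ≤ 2 ^ (n * n + n) :=
    (Nat.le_mul_of_pos_right _ (by positivity)).trans (factorial_mul_two_pow_le n)
  have hsize : (n !).size ≤ n * n + n + 1 :=
    Nat.size_le.2 (lt_of_le_of_lt hfac (two_pow_lt_of_lt (by omega)))
  refine WP.seq ((wp_factorials h1 hn (by omega)
    (hfac.trans_lt (two_pow_lt_of_lt (by omega)))).mono ?_)
  rintro s1 - hF1 ⟨a17, a18⟩
  have a1 := (hF1.reg 1 (by simp [Cmd.Keeps, factorials])).trans h1
  have a4 := (hF1.reg 4 (by simp [Cmd.Keeps, factorials])).trans h4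
  have a5 := (hF1.reg 5 (by simp [Cmd.Keeps, factorials])).trans h5
  have a_out := (hF1.out (by simp [Cmd.Keeps, factorials])).trans hout
  refine WP.seq ((wp_shapleySum (r := 10) (by omega) (by omega) a1 a4 (by positivity) a17 hn
    (by omega) hfB).mono ?_)
  rintro s2 - hF2 ⟨b5, b10⟩
  have b1 := (hF2.reg 1 (by simp [Cmd.Keeps, shapleySum])).trans a1
  have b4 := (hF2.reg 4 (by simp [Cmd.Keeps, shapleySum])).trans a4
  have b17 := (hF2.reg 17 (by simp [Cmd.Keeps, shapleySum])).trans a17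
  have b18 := (hF2.reg 18 (by simp [Cmd.Keeps, shapleySum])).trans a18
  have b_out := (hF2.out (by simp [Cmd.Keeps, shapleySum])).trans a_out
  rw [a5, sum_pow_mul_add_div fun k _ => hc0 k] at b5
  rw [a5, Finset.sum_congr rfl fun k hk => by
    rw [sum_pow_mul_digit (fun k _ => hc0 k) _ (Finset.mem_range.1 hk)]] at b10
  refine WP.seq ((wp_shapleySum (r := 11) (by omega) (by omega) b1 b4 (by positivity) b17 hn
    (by omega) hfB).mono ?_)
  rintro s3 - hF3 ⟨-, d11⟩
  have d10 := (hF3.reg 10 (by simp [Cmd.Keeps, shapleySum])).trans b10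
  have d18 := (hF3.reg 18 (by simp [Cmd.Keeps, shapleySum])).trans b18
  have d_out := (hF3.out (by simp [Cmd.Keeps, shapleySum])).trans b_out
  -- The second block of digits is the whole number that is left, so the part above the digits is 0.
  rw [b5, Finset.sum_congr rfl fun k hk => by
    rw [← add_zero (∑ k ∈ _, (2 ^ n) ^ k * c1 k), ← mul_zero ((2 ^ n) ^ n),
      sum_pow_mul_digit (fun k _ => hc1 k) _ (Finset.mem_range.1 hk)]] at d11
  generalize ∑ k ∈ Finset.range n, k ! * (n - 1 - k)! * c0 k = A0 at *
  generalize ∑ k ∈ Finset.range n, k ! * (n - 1 - k)! * c1 k = A1 at *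
  refine WP.seq (WP.set' (fun hb => ⟨⟨trivial, trivial⟩, ⟨trivial, trivial⟩, ?_⟩) fun s4 hs4 => ?_)
  · have g1 := hb.reg 10
    have g2 := hb.reg 11
    simp only [Ex.val_sub, Ex.val_reg]
    omega
  simp only [Ex.val_add, Ex.val_sub, Ex.val_reg, d10, d11] at hs4
  have e12 : s4.reg 12 = A1 - A0 + (A0 - A1) := by
    rw [hs4, MState.setReg_self, add_comm]
  have e18 : s4.reg 18 = n ! := by rw [hs4, MState.setReg_of_ne _ _ (by omega), d18]
  have e10 : s4.reg 10 = A0 := by rw [hs4, MState.setReg_of_ne _ _ (by omega), d10]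
  have e11 : s4.reg 11 = A1 := by rw [hs4, MState.setReg_of_ne _ _ (by omega), d11]
  have e_out : s4.out = [] := by rw [hs4, MState.setReg_out, d_out]
  refine WP.seq ((wp_euclid (by rw [e18]; positivity) (by rw [e18]; omega)).mono ?_)
  intro s5 _ hF5 f13
  rw [e18, e12] at f13
  have f12 := (hF5.reg 12 (by simp [Cmd.Keeps, euclid])).trans e12
  have f18 := (hF5.reg 18 (by simp [Cmd.Keeps, euclid])).trans e18
  have f10 := (hF5.reg 10 (by simp [Cmd.Keeps, euclid])).trans e10
  have f11 := (hF5.reg 11 (by simp [Cmd.Keeps, euclid])).trans e11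
  have f_out := (hF5.out (by simp [Cmd.Keeps, euclid])).trans e_out
  refine WP.seq (WP.write (fun _ => by simp; omega) (WP.seq (WP.write (fun _ => ⟨trivial, trivial⟩)
    (WP.write (fun _ => ⟨trivial, trivial⟩) ?_))))
  rw [encRat_sub_div (Nat.factorial_pos n)]
  simp only [f_out, Ex.val_sub, Ex.val_div, Ex.val_reg, Ex.val_ofNat, f10, f11, f12, f13, f18,
    List.nil_append, List.singleton_append]
  -- The sign bit: nested truncated subtraction turns a positive difference into 1.
  have : 1 - (1 - (A0 - A1)) = if A1 < A0 then 1 else 0 := by split_ifs <;> omega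
  rw [this]
  rfl

end Output

/-! ### Assembling the programs -/

section Assembly
variable {S : Schema} {O : List ℕ → List ℕ}

theorem length_le_tapeSize (l : List ℕ) : l.length ≤ tapeSize l := by
  unfold tapeSize
  induction l with
  | nil => simp
  | cons a l ih => simp [bitLen]; omega

theorem lt_two_pow_tapeSize {l : List ℕ} {a : ℕ} (h : a ∈ l) : a < 2 ^ tapeSize l := by
  refine (Nat.lt_size_self a).trans_le (two_pow_le_of_le ?_)
  have : bitLen a ≤ tapeSize l := List.single_le_sum (by simp) _ (List.mem_map_of_mem h)
  unfold bitLen at this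
  omega

/-- The program computes the weighted count for `q`, given the table of weighted facts. -/
def CountsWeighted (O : List ℕ → List ℕ) (q : BoolQuery S) (C : ℕ) (M : Cmd) : Prop :=
  ∀ (x : ShapleyInst S) ℓ ds s, C ≤ ℓ → Prepared x ℓ ds s → WP O (4 * ℓ) M s fun s' =>
    s'.reg 1 = s.reg 1 ∧ s'.reg 4 = s.reg 4 ∧ s'.out = s.out ∧
      s'.reg 5 = wmc x.facts.toFinset x.weight x.coweight q

/-- The polynomial is chosen before the oracle and the query, as a reduction has to work in the same
time for every oracle. With T the length of the input, ℓ is T plus 2T(T+1) plus a constant; the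
quadratic term covers the total weight. -/
theorem CountsWeighted.solvesIn (M : Cmd) (C : ℕ) : ∃ p : Polynomial ℕ,
    ∀ (O : List ℕ → List ℕ) (q : BoolQuery S), CountsWeighted O q C M →
      (prepare S ;; M ;; writeShapley).compile.SolvesIn O (shapleyProblem q) p := by
  obtain ⟨p, hp⟩ := (prepare S ;; M ;; writeShapley).exists_polynomial_cost_le
  set C' := 20 + C + S.numRel + ∑ R, S.arity R with hC'
  refine ⟨p.comp (4 * (Polynomial.C C' + Polynomial.X + 2 * Polynomial.X * (Polynomial.X + 1))),
    fun O q hM x => ?_⟩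
  set T := tapeSize x.enc with hT
  have hlen : x.enc.length ≤ T := length_le_tapeSize _
  have hn : x.endo.length ≤ T := by
    have h1 := x.length_enc
    have h2 := length_le_flatMap_encFact x.endo
    omega
  have hsq : 2 * x.endo.length * (x.endo.length + 1) ≤ 2 * T * (T + 1) := by gcongr
  obtain ⟨s, ρ, t, h1, h2, h3, h4⟩ := WP.exec (O := O) (L := 4 * (C' + T + 2 * T * (T + 1)))
    (P := prepare S ;; M ;; writeShapley) (x := x.enc)
    (Q := fun s => s.out = encRat ((shapleyProblem q).goal x)) (by omega)
    (fun a ha => (lt_two_pow_tapeSize ha).trans_le (two_pow_le_of_le (by omega)))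
    (WP.seq ((wp_prepare x (by omega)).mono fun s1 _ _ ⟨ds, hs1⟩ =>
      WP.seq ((hM x _ ds s1 (by omega) hs1).mono fun s2 _ _ ⟨g1, g4, g_out, g5⟩ =>
        wp_writeShapley (by omega) (g1.trans hs1.count) (g4.trans hs1.base) g5
          (g_out.trans hs1.out))))
  refine ⟨ρ, t, h1, h2.trans ((hp _).trans_eq ?_), h3.trans h4⟩
  rw [Polynomial.eval_comp]
  congr 1
  simp
  rfl

theorem oracleFree_prepare : (prepare S).OracleFree := by
  simp [prepare, Cmd.OracleFree, oracleFree_arityTable, powers, readFacts, readFact, addDom,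
    markFact, totalWeight]

theorem oracleFree_writeShapley : writeShapley.OracleFree := by
  simp [writeShapley, Cmd.OracleFree, factorials, shapleySum, euclid]

theorem UCQ.IsSafe.inFP {Q : UCQ S} (h : Q.IsSafe) : InFP (shapleyProblem Q.toQuery) := by
  obtain ⟨φ, hφ, hQ⟩ := h
  obtain ⟨P, hP1, hP2, C, hP3⟩ := hφ.computable 20 le_rfl
  obtain ⟨p, hp⟩ := CountsWeighted.solvesIn (S := S) (P ;; .set 5 (.reg 20)) C
  have hfree : (prepare S ;; (P ;; .set 5 (.reg 20)) ;; writeShapley).OracleFree :=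
    ⟨oracleFree_prepare, ⟨hP1, trivial⟩, oracleFree_writeShapley⟩
  refine ⟨_, hfree.compile, p, hp _ _ fun x ℓ ds s hC hs => WP.seq ((hP3 _ ℓ _ ds _ _ s hC hs.ok hs.db).mono ?_)⟩
  rintro s' - hF ⟨-, hr⟩
  refine WP.set (fun _ => trivial) ⟨?_, ?_, ?_, ?_⟩
  · rw [MState.setReg_of_ne _ _ (by omega), hP2.reg hF (by omega)]
  · rw [MState.setReg_of_ne _ _ (by omega), hP2.reg hF (by omega)]
  · rw [MState.setReg_out, hF.out (hP2 _ (by simp) (by simp))]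
  · rw [MState.setReg_self, Ex.val_reg, hr]
    -- The formula is equivalent to the query under every assignment, so the values left in the
    -- query variables do not matter.
    exact wmc_congr fun D _ => hQ _ D

/-! ### Using an oracle for probabilistic query evaluation -/

theorem encRat_natCast_div {a m : ℕ} (hm : 0 < m) :
    encRat ((a : ℚ) / (m : ℚ)) = [0, a / Nat.gcd m a, m / Nat.gcd m a] := by
  simpa using encRat_sub_div (a := a) (b := 0) hm

namespace ShapleyInst
variable (x : ShapleyInst S)

/-- The tuple-independent database in which the odds of the facts are their weights. -/
def tid : TID S where
  entries := x.facts.map fun f => (f, (x.weight f : ℚ) / (x.weight f + x.coweight f : ℕ))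
  nodup := by
    rw [List.map_map]
    exact (List.map_id x.facts).symm ▸ x.nodup
  prob_mem e he := by
    obtain ⟨f, hf, rfl⟩ := List.mem_map.1 he
    refine ⟨by positivity, div_le_one_of_le₀ ?_ (by positivity)⟩
    exact_mod_cast Nat.le_add_right _ _

/-- The code of a fact with its probability. -/
def encEntry (f : DBFact S) : List ℕ :=
  encFact f ++ [0, x.weight f, x.weight f + x.coweight f]

/-- The probabilities a/(a+b) are in lowest terms as they stand, so the program can send them
without computing a greatest common divisor. -/
theorem enc_tid : x.tid.enc = x.facts.length :: x.facts.flatMap x.encEntry := by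
  rw [TID.enc, encList, tid, List.length_map, List.flatMap_map]
  congr 1
  refine List.flatMap_congr fun f hf => ?_
  obtain ⟨h1, h2⟩ := x.weight_cases hf
  have hg : Nat.gcd (x.weight f + x.coweight f) (x.weight f) = 1 := by
    rcases h2 with h2 | ⟨h2, h3⟩
    · rw [h2, Nat.gcd_comm]
      simp
    · rw [h2, Nat.gcd_one_right]
  rw [encRat_natCast_div (by omega), hg, Nat.div_one, Nat.div_one, encEntry]

theorem queryProb_tid (q : BoolQuery S) : (pqeProblem q).goal x.tid =
    (wmc x.facts.toFinset x.weight x.coweight q : ℚ) /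
      (wtot x.facts.toFinset x.weight x.coweight : ℕ) := by
  have hf : x.tid.facts = x.facts.toFinset := by
    rw [TID.facts, tid, List.map_map]
    congr 1
    exact List.map_id x.facts
  have hg : (pqeProblem q).goal x.tid = queryProb q x.tid.facts x.tid.prob := rfl
  rw [hg, hf]
  refine queryProb_eq_wmc_div q _ _ _ (fun g hg => ?_) _ fun g hg => ?_
  · exact Nat.add_pos_left (x.weight_cases (List.mem_toFinset.1 hg)).1 _
  · rw [TID.prob, tid, List.lookup_graph _ (List.mem_toFinset.1 hg)]
    rfl

end ShapleyInst

/-- Sends the tuple-independent database to the oracle. -/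
def sendTable : Cmd :=
  .send (.reg 0) ;;
  .for 7 (.reg 0) (
    .send (.arr 2 (.reg 7)) ;;
    .for 9 (.arr 1 (.arr 2 (.reg 7))) (.send (.arr (5 + .reg 9) (.reg 7))) ;;
    .send 0 ;; .send (.arr 3 (.reg 7)) ;; .send (.arr 3 (.reg 7) + .arr 4 (.reg 7)))

theorem wp_sendTable {x : ShapleyInst S} {ℓ : ℕ} {ds : List ℕ} {s : MState}
    (hs : Prepared x ℓ ds s) (hℓ : 20 + S.numRel + ∑ R, S.arity R ≤ ℓ) :
    WP O (4 * ℓ) sendTable s fun s' => s'.qry = x.tid.enc := by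
  have hlt : 4 * ℓ < 2 ^ (4 * ℓ) := Nat.lt_two_pow_self
  have hN := hs.ok.len_le
  refine WP.seq (WP.send (fun _ => trivial) (WP.for x.facts.length
    (fun k s' => s'.qry = x.facts.length :: (x.facts.take k).flatMap x.encEntry) (by omega)
    ?_ ?_ ?_ ?_))
  · simp [hs.qry, hs.db.len]
  · intro k _ s' _ hF _
    refine ⟨trivial, ?_⟩
    rw [Ex.val_reg, hF.reg 0 (by simp [Cmd.Keeps])]
    exact hs.db.len
  · intro k hk s' hF hI h7
    have harr : s'.arr = s.arr := hF.arr (by simp [Cmd.Keeps])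
    obtain ⟨⟨w1, w2⟩, w3, w4⟩ := hs.db.row k hk
    have hsum : x.weight x.facts[k] + x.coweight x.facts[k] < 2 ^ (4 * ℓ) := by
      refine lt_of_le_of_lt (Nat.le_of_dvd hs.ok.tot_pos ?_)
        (hs.ok.tot_le.trans_lt (two_pow_lt_of_lt (by omega)))
      exact Finset.dvd_prod_of_mem (fun g => x.weight g + x.coweight g)
        (List.mem_toFinset.2 (List.getElem_mem hk))
    have htk : (x.facts.take (k + 1)).flatMap x.encEntry =
        (x.facts.take k).flatMap x.encEntry ++ x.encEntry x.facts[k] := by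
      rw [List.take_succ_eq_append_getElem hk, List.flatMap_append, List.flatMap_singleton]
    generalize x.facts[k] = f at *
    have hR := f.1.2
    have har := arity_le_sum f.1
    refine WP.seq (WP.send (fun _ => ?_) (WP.seq (WP.for (S.arity f.1) (fun i s2 =>
      s2.qry = s'.qry ++ (f.1 : ℕ) :: (List.ofFn f.2).take i) (by omega) ?_ ?_ ?_ ?_)))
    · simp [h7]
      omega
    · simp [h7, harr, w1]
    · intro i _ s2 _ hF2 _
      have f7 : s2.reg 7 = k := (hF2.reg 7 (by simp [Cmd.Keeps])).trans h7
      have farr : s2.arr = s.arr := (hF2.arr (by simp [Cmd.Keeps])).trans harr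
      simp only [Ex.ok_arr, Ex.ok_ofNat, Ex.ok_reg, Ex.val_arr, Ex.val_ofNat, Ex.val_reg, f7, farr,
        w1, hs.arity f.1]
      exact ⟨⟨by omega, ⟨by omega, trivial, by omega⟩, by omega⟩, trivial⟩
    · intro i hi s2 hF2 hI2 h9
      have f7 : s2.reg 7 = k := (hF2.reg 7 (by simp [Cmd.Keeps])).trans h7
      have farr : s2.arr = s.arr := (hF2.arr (by simp [Cmd.Keeps])).trans harr
      refine WP.send (fun _ => ?_) ⟨h9, ?_⟩
      · simp [h9, f7]
        omega
      · rw [List.take_succ_eq_append_getElem (by simpa using hi)]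
        simp [hI2, h9, f7, farr, w2 ⟨i, hi⟩]
    · intro s2 hF2 hI2
      have f7 : s2.reg 7 = k := (hF2.reg 7 (by simp [Cmd.Keeps])).trans h7
      have farr : s2.arr = s.arr := (hF2.arr (by simp [Cmd.Keeps])).trans harr
      refine WP.seq (WP.send (fun _ => by simp) (WP.seq (WP.send (fun _ => ?_)
        (WP.send (fun _ => ?_) ⟨f7, ?_⟩))))
      · simp [f7]
        omega
      · simp [f7, farr, w3, w4, hsum]
        omega
      · rw [List.take_of_length_le (by simp)] at hI2
        simp [hI2, hI, htk, f7, farr, w3, w4, ShapleyInst.encEntry, encFact]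
  · intro s' _ hI
    rw [hI, List.take_length, x.enc_tid]

/-- Asks for the probability, and puts the weighted count into register `5`. -/
def countByOracle : Cmd :=
  sendTable ;; .ask ;; .recv 10 ;; .recv 11 ;; .recv 12 ;; .set 5 (.reg 11 * (.reg 2 / .reg 12))

/-- The oracle returns X/W in lowest terms, where X is the weighted count and W the total weight,
known from the table. Numerator and denominator are at most W, so the answer respects the size
bound. -/
theorem countsWeighted_countByOracle {q : BoolQuery S} (hO : IsOracleFor O (pqeProblem q)) :
    CountsWeighted O q (20 + S.numRel + ∑ R, S.arity R) countByOracle := by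
  intro x ℓ ds s hℓ hs
  refine WP.seq ((wp_sendTable hs hℓ).mono fun s1 _ hF1 hq => ?_)
  have hW := hs.ok.tot_pos
  have hWl := hs.ok.tot_le
  have hX : wmc x.facts.toFinset x.weight x.coweight q ≤ _ := wmc_le
  have hans : O s1.qry = encRat ((pqeProblem q).goal x.tid) := by
    rw [hq]
    exact hO x.tid
  have e1 := hF1.reg 1 (by simp [Cmd.Keeps, sendTable])
  have e2 := (hF1.reg 2 (by simp [Cmd.Keeps, sendTable])).trans hs.db.tot
  have e4 := hF1.reg 4 (by simp [Cmd.Keeps, sendTable])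
  have e_out := hF1.out (by simp [Cmd.Keeps, sendTable])
  rw [x.queryProb_tid, encRat_natCast_div hW] at hans
  generalize wmc x.facts.toFinset x.weight x.coweight q = X at *
  generalize wtot x.facts.toFinset x.weight x.coweight = W at *
  have hlt : W < 2 ^ (4 * ℓ) := hWl.trans_lt (two_pow_lt_of_lt (by omega))
  -- Dividing W by the returned denominator recovers the cancelled factor gcd(W, X), and multiplying
  -- the numerator by it recovers X.
  have hdiv : X / W.gcd X * (W / (W / W.gcd X)) = X := by
    rw [Nat.div_div_self (Nat.gcd_dvd_left _ _) hW.ne', Nat.div_mul_cancel (Nat.gcd_dvd_right _ _)]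
  refine WP.seq (WP.ask ?_ (WP.seq (WP.recv (WP.seq (WP.recv (WP.seq (WP.recv
    (WP.set (fun _ => ?_) ?_))))))))
  · rw [hans]
    simp only [List.mem_cons, List.not_mem_nil, or_false, forall_eq_or_imp, forall_eq]
    exact ⟨by positivity, (Nat.div_le_self _ _).trans_lt (hX.trans_lt hlt),
      (Nat.div_le_self _ _).trans_lt hlt⟩
  · refine ⟨trivial, ⟨trivial, trivial⟩, ?_⟩
    simp [MState.setReg_reg, hans, e2, hdiv]
    omega
  · simp [MState.setReg_reg, hans, e1, e2, e4, e_out, hdiv]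

theorem polyTimeReducible_shapley_pqe (q : BoolQuery S) :
    PolyTimeReducible (shapleyProblem q) (pqeProblem q) := by
  obtain ⟨p, hp⟩ := CountsWeighted.solvesIn (S := S) countByOracle (20 + S.numRel + ∑ R, S.arity R)
  exact ⟨_, p, fun O hO => hp O q (countsWeighted_countByOracle hO)⟩

end Assembly

theorem mainTheorem2 (S : Schema) :
    (∀ q : BoolQuery S, PolyTimeReducible (shapleyProblem q) (pqeProblem q)) ∧
    (∀ Q : UCQ S, Q.IsSafe → InFP (shapleyProblem Q.toQuery)) :=
  ⟨polyTimeReducible_shapley_pqe, fun _ => UCQ.IsSafe.inFP⟩
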